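/- Let $0<M<N$ be integers. Let $u=(u^1,\dots,u^N)$ be real variables with $u^i\neq 0$ for all $i$ and $u^i\neq u^j$ for $i\neq j$ (the modified variables of the Lax function ${\cal L}=p^{-M}\prod_{i=1}^N(p+u^i)$), and let $$g^{ij}(u)=\begin{cases}[1-(N-M)]\,u^iu^i, & i=j,\\ u^iu^j, & i\neq j.\end{cases}$$ Let $s^1=\sum_i u^i$, $s^2=\sum_{i<j}u^iu^j$, ..., $s^N=\prod_i u^i$ be the elementary symmetric functions. They are local coordinates on the set of admissible $u$. Put $s^\bullet=s^{N-M}$, the coefficient of $p^0$ in ${\cal L}$, and define $\alpha^i_\bullet(u)$ by $\frac{\partial}{\partial s^\bullet}=\alpha^i_\bullet\frac{\partial}{\partial u^i}$. Let $\eta$ be the contravariant 2-tensor whose components in the coordinates $s$ are $\frac{\partial}{\partial s^\bullet}g^{mn}(s)$, so that in the modified variables $$\eta^{ij}(u)=\frac{\partial u^i}{\partial s^m}\frac{\partial u^j}{\partial s^n}\frac{\partial}{\partial s^\bullet}\Big[\frac{\partial s^m}{\partial u^r}\frac{\partial s^n}{\partial u^q}g^{rq}(u)\Big].$$ Then $\eta$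 is symmetric and non-degenerate and defines a second Hamiltonian structure compatible with that of $g$. That is, for a metric $h$ with contravariant connection coefficients $\Gamma^{ij}_k=-h^{is}\Gamma^j_{sk}$ (where $\Gamma^j_{sk}$ are the Christoffel symbols of $(h^{ij})^{-1}$), write $$\{I,J\}_h=\int \frac{\delta I}{\delta u^i}\Big(h^{ij}\frac{d}{dx}+\Gamma^{ij}_k u^k_x\Big)\frac{\delta J}{\delta u^j}\,dx$$ for the bracket on local functionals; then $\{\ ,\ \}_\eta$ and $\{\ ,\ \}_g+\lambda\{\ ,\ \}_\eta$, for every real $\lambda$, are skew-symmetric and satisfy the Jacobi identity. Moreover, $\eta$ is the Lie derivative of $g$ along $\partial/\partial s^\bullet$: $$\eta^{ij}={\cal L}_{\partial/\partial s^\bullet}\,g^{ij}=\frac{\partial}{\partial s^\bullet}g^{ij}-\frac{\partial\alpha^i_\bullet}{\partial u^k}g^{kj}-\frac{\partial\alpha^j_\bullet}{\partial u^k}g^{ik}.$$ -/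

import Mathlib

open scoped ContDiff

noncomputable section

namespace HydroPoisson

variable {N : ℕ}

/-! ### Calculus on an open set of field values -/

/-- The partial derivative `∂f/∂u^i`. -/
def pderiv (i : Fin N) (f : (Fin N → ℝ) → ℝ) (u : Fin N → ℝ) : ℝ :=
  fderiv ℝ f u (Pi.single i 1)

/-- The action `X(f) = X^k ∂f/∂u^k` of a vector field on a function. -/
def dirDeriv (X : (Fin N → ℝ) → Fin N → ℝ) (f : (Fin N → ℝ) → ℝ) (u : Fin N → ℝ) : ℝ :=
  ∑ k, X u k * pderiv k f u

/-- The value `T(dφ, dψ) = T^{ij} ∂_i φ ∂_j ψ` of a contravariant 2-tensor on two differentials. -/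
def pairing (T : (Fin N → ℝ) → Matrix (Fin N) (Fin N) ℝ) (φ ψ : (Fin N → ℝ) → ℝ)
    (u : Fin N → ℝ) : ℝ :=
  ∑ i, ∑ j, T u i j * pderiv i φ u * pderiv j ψ u

/-- `L` is the Lie derivative on `U` of the contravariant 2-tensor `T` along the vector field `X`.
The Lie derivative is the derivation of the tensor algebra given by `f ↦ X(f)` on functions and by
`dφ ↦ d(X(φ))` on differentials, so
`X (T(dφ, dψ)) = (L_X T)(dφ, dψ) + T(d(Xφ), dψ) + T(dφ, d(Xψ))`; this determines it. -/
def IsLieDerivative (U : Set (Fin N → ℝ)) (X : (Fin N → ℝ) → Fin N → ℝ)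
    (T L : (Fin N → ℝ) → Matrix (Fin N) (Fin N) ℝ) : Prop :=
  ∀ φ ψ : (Fin N → ℝ) → ℝ, ContDiffOn ℝ ∞ φ U → ContDiffOn ℝ ∞ ψ U → ∀ u ∈ U,
    dirDeriv X (pairing T φ ψ) u =
      pairing L φ ψ u + pairing T (dirDeriv X φ) ψ u + pairing T φ (dirDeriv X ψ) u

/-- The Christoffel symbols `Γ^j_{sk}` of the Levi-Civita connection of the metric
`(g_{ij}) = (g^{ij})⁻¹`. -/
def christoffel (g : (Fin N → ℝ) → Matrix (Fin N) (Fin N) ℝ) (j s k : Fin N)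
    (u : Fin N → ℝ) : ℝ :=
  (1 / 2) * ∑ l, g u j l *
    (pderiv s (fun w => (g w)⁻¹ l k) u + pderiv k (fun w => (g w)⁻¹ l s) u
      - pderiv l (fun w => (g w)⁻¹ s k) u)

/-- The contravariant components `Γ^{ij}_k = - g^{is} Γ^j_{sk}` of the metric connection. -/
def contraChristoffel (g : (Fin N → ℝ) → Matrix (Fin N) (Fin N) ℝ) (i j k : Fin N)
    (u : Fin N → ℝ) : ℝ :=
  -∑ s, g u i s * christoffel g j s k u

/-! ### Local functionals and brackets of hydrodynamic type

A jet is a family `v`, where `v m i` is the value of the `m`-th `x`-derivative of `u^i`. -/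

/-- `f` is the density of a local functional of fields with values in `U`: on the jets over `U` it
is a smooth function of finitely many derivatives `u, u_x, …, u_{x…x}`. -/
def IsLocalDensity (U : Set (Fin N → ℝ)) (f : (ℕ → Fin N → ℝ) → ℝ) : Prop :=
  ∃ (d : ℕ) (F : (Fin (d + 1) → Fin N → ℝ) → ℝ), ContDiffOn ℝ ∞ F {w | w 0 ∈ U} ∧
    ∀ v : ℕ → Fin N → ℝ, v 0 ∈ U → f v = F (fun m => v m)

/-- The partial derivative of `f` with respect to the `m`-th `x`-derivative of `u^i`. -/
def jetPartial (m : ℕ) (i : Fin N) (f : (ℕ → Fin N → ℝ) → ℝ) (v : ℕ → Fin N → ℝ) : ℝ :=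
  lineDeriv ℝ f v (Pi.single m (Pi.single i 1))

/-- The total `x`-derivative `d/dx`. For a local density only finitely many terms of the sum are
nonzero at a jet over `U`. -/
def totalDeriv (f : (ℕ → Fin N → ℝ) → ℝ) (v : ℕ → Fin N → ℝ) : ℝ :=
  ∑ᶠ m : ℕ, ∑ i, v (m + 1) i * jetPartial m i f v

/-- The variational derivative `δI/δu^i = ∑_m (-d/dx)^m ∂f/∂u^i_{(m)}` of `I = ∫ f dx`. -/
def varDeriv (i : Fin N) (f : (ℕ → Fin N → ℝ) → ℝ) (v : ℕ → Fin N → ℝ) : ℝ :=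
  ∑ᶠ m : ℕ, (-1) ^ m * (totalDeriv^[m] (jetPartial m i f)) v

/-- The density `(δI/δu^i) A^{ij} (δJ/δu^j)`, where `A^{ij} = g^{ij} d/dx + Γ^{ij}_k u^k_x`, of the
bracket `{I, J}` of `I = ∫ f dx` and `J = ∫ h dx`. -/
def bracketDensity (g : (Fin N → ℝ) → Matrix (Fin N) (Fin N) ℝ)
    (Γ : Fin N → Fin N → Fin N → (Fin N → ℝ) → ℝ) (f h : (ℕ → Fin N → ℝ) → ℝ)
    (v : ℕ → Fin N → ℝ) : ℝ :=
  ∑ i, ∑ j, varDeriv i f v *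
    (g (v 0) i j * totalDeriv (varDeriv j h) v
      + (∑ k, Γ i j k (v 0) * v 1 k) * varDeriv j h v)

/-- The jet at `x` of a field `u`. -/
def jet (u : ℝ → Fin N → ℝ) (x : ℝ) : ℕ → Fin N → ℝ :=
  fun m i => iteratedDeriv m (fun y => u y i) x

/-- The functional `u ↦ ∫ f(u, u_x, …) dx` over one period of a `1`-periodic field. -/
def functional (f : (ℕ → Fin N → ℝ) → ℝ) (u : ℝ → Fin N → ℝ) : ℝ :=
  ∫ x in (0 : ℝ)..1, f (jet u x)

/-- `u` is a smooth field on the circle `ℝ/ℤ` with values in `U`. -/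
def IsField (U : Set (Fin N → ℝ)) (u : ℝ → Fin N → ℝ) : Prop :=
  ContDiff ℝ ∞ u ∧ Function.Periodic u 1 ∧ ∀ x, u x ∈ U

/-- The pair `(g, Γ)`, with smooth components on `U`, defines a Hamiltonian structure of
hydrodynamic type: its bracket on local functionals is skew-symmetric and satisfies the Jacobi
identity (bilinearity is clear). -/
def IsHamiltonianStructure (U : Set (Fin N → ℝ)) (g : (Fin N → ℝ) → Matrix (Fin N) (Fin N) ℝ)
    (Γ : Fin N → Fin N → Fin N → (Fin N → ℝ) → ℝ) : Prop :=
  (∀ i j, ContDiffOn ℝ ∞ (fun u => g u i j) U) ∧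
  (∀ i j k, ContDiffOn ℝ ∞ (Γ i j k) U) ∧
  (∀ f h, IsLocalDensity U f → IsLocalDensity U h → ∀ u, IsField U u →
    functional (bracketDensity g Γ f h) u = -functional (bracketDensity g Γ h f) u) ∧
  (∀ f h l, IsLocalDensity U f → IsLocalDensity U h → IsLocalDensity U l → ∀ u, IsField U u →
    functional (bracketDensity g Γ (bracketDensity g Γ f h) l) u
      + functional (bracketDensity g Γ (bracketDensity g Γ h l) f) u
      + functional (bracketDensity g Γ (bracketDensity g Γ l f) h) u = 0)

/-- The metric `g₂` defines a second Hamiltonian structure compatible with that of `g₁`: every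
`{ , }₁ + c { , }₂` is a Hamiltonian structure, and so is `{ , }₂`, each bracket being built from
a metric and its metric connection. -/
def AreCompatible (U : Set (Fin N → ℝ))
    (g₁ g₂ : (Fin N → ℝ) → Matrix (Fin N) (Fin N) ℝ) : Prop :=
  IsHamiltonianStructure U g₂ (contraChristoffel g₂) ∧
  ∀ c : ℝ, IsHamiltonianStructure U (fun u => g₁ u + c • g₂ u)
    (fun i j k u => contraChristoffel g₁ i j k u + c * contraChristoffel g₂ i j k u)

/-! ### The Lax function `p^{-M} ∏ (p + u^i)` -/

/-- The admissible values of the modified variables: the numerator `∏ (p + u^i)` has simple roots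
and no root in common with `p^M`. -/
def modifiedDomain (N : ℕ) : Set (Fin N → ℝ) :=
  {u | Function.Injective u ∧ ∀ i, u i ≠ 0}

/-- The metric `g^{ij}(u)` of the Hamiltonian structure in the modified variables. -/
def laxMetric (N M : ℕ) (u : Fin N → ℝ) : Matrix (Fin N) (Fin N) ℝ :=
  Matrix.of fun i j => if i = j then (1 - ((N : ℝ) - (M : ℝ))) * u i * u i else u i * u j

/-- The elementary symmetric function `s^m` of `u^1, …, u^N`; the index `m : Fin N` counts from
`0`, so that `symVar m` has degree `m + 1`. -/
def symVar (m : Fin N) (u : Fin N → ℝ) : ℝ :=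
  MvPolynomial.eval u (MvPolynomial.esymm (Fin N) ℝ ((m : ℕ) + 1))

/-- The Jacobian matrix `∂s^m/∂u^i` (row `m`, column `i`). -/
def symJacobian (u : Fin N → ℝ) : Matrix (Fin N) (Fin N) ℝ :=
  Matrix.of fun m i => pderiv i (symVar m) u

/-- The components `α^i_m = ∂u^i/∂s^m` of the coordinate vector field
`∂/∂s^m = α^i_m ∂/∂u^i` of the coordinates `s^1, …, s^N`. -/
def symField (m : Fin N) (u : Fin N → ℝ) : Fin N → ℝ :=
  fun i => (symJacobian u)⁻¹ i m

/-- The components `g^{mn}(s) = (∂s^m/∂u^p) (∂s^n/∂u^q) g^{pq}(u)` of the metric in the coordinates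
`s^1, …, s^N`, as functions of the point. -/
def laxMetricSym (N M : ℕ) (u : Fin N → ℝ) : Matrix (Fin N) (Fin N) ℝ :=
  Matrix.of fun m n => ∑ p, ∑ q, symJacobian u m p * symJacobian u n q * laxMetric N M u p q

/-- The second metric: in the coordinates `s^1, …, s^N` its components are `∂g^{mn}(s)/∂s^b`; here
they are written in the modified variables,
`η^{ij}(u) = (∂u^i/∂s^m) (∂u^j/∂s^n) ∂g^{mn}(s)/∂s^b`. -/
def secondMetric (N M : ℕ) (b : Fin N) (u : Fin N → ℝ) : Matrix (Fin N) (Fin N) ℝ :=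
  Matrix.of fun i j => ∑ m, ∑ n, symField m u i * symField n u j *
    dirDeriv (symField b) (fun w => laxMetricSym N M w m n) u

end HydroPoisson

end

open HydroPoisson

/-! Write P(p) = ∏ (p + u^i) and X = ∂/∂s^•. The argument has a formal half, valid for vector fields
in general, and an explicit half about P.

Formal half. A bracket of hydrodynamic type comes from a skew-adjoint operator A = g d/dx + Γ u_x.
The Lie derivative of A along X is an operator of the same kind, with coefficients `lieMetric` and
`lieConn`, and its bracket { , }' satisfies X{I,J} = {I,J}' + {XI,J} + {I,XJ}
(`IsSkewOperator.functional_lieDensity_bracket`). Applying X to the Jacobi identity of { , } gives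
the mixed identity between { , } and { , }' (`jacobiator_mixed`). Applying X once more, when the
second Lie derivative of A vanishes, gives twice the Jacobi identity of { , }' (`jacobiator_lie`).
These three identities are the coefficients of 1, λ, λ² in the Jacobi identity of the pencil
(`isHamiltonianStructure_lie`). It remains to show that g is Hamiltonian, that the second Lie
derivatives of g and Γ vanish, and that L_X g is non-degenerate with metric connection L_X Γ.

The first point holds because g is constant in the coordinates log |u^i|: the operator is u^i G^{ij}
(d/dx) u^j with G constant, and its trivector cancels (`jacobiator_lax`).

Explicit half. Since the u^i are distinct, the differentials dP(p) span the cotangent space, so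
tensors may be tested on them (`eq_zero_of_sum_sum_laxPart`). The function X P(p) = p^M does not
depend on u, and neither does X ∂_pP(p) = M p^(M-1); hence on these differentials the Lie derivative
is the plain derivative along X. The generating function (p - q) g(dP(p), dP(q)) is bilinear in P,
∂P at p and q, and one application of X gives (p - q) (L_X g)(dP(p), dP(q)) = (N - M) (Q(p) q^(M+1)
- Q(q) p^(M+1)), where Q = p ∂_pP - M P. Here Q = p^(M+1) ∂_p of the Lax function, and X only adds a
constant to that function, so X Q = 0 and L_X L_X g = 0. The connection is treated in the same way
through the one-forms `connForm`: after one Lie derivative they are combinations of exact forms with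
coefficients independent of u, which the second one kills (`lieConn_lieConn`).

L_X Γ is the metric connection because it is compatible with L_X g (`IsSkewOperator.lie`) and
torsion-free; the latter is a rational identity between generating functions (`lieConn_torsion`).
Non-degeneracy is a divisibility and degree argument: Q is prime to p and has degree N
(`det_lieMetric_ne_zero`). Finally η = L_X g, because the differentials ds^m are invariant under X
(`secondMetric_eq_lieMetric`). -/

open scoped ContDiff

namespace HydroPoisson

section

open Filter Topology

variable {N : ℕ}

/-! ### Local densities -/

/-- The first `d + 1` entries of a jet. -/
def trunc (d : ℕ) (v : ℕ → Fin N → ℝ) : Fin (d + 1) → Fin N → ℝ := fun m => v m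

/-- The jet with the single nonzero coordinate `u^i_{(m)} = 1`. -/
def unitJet (m : ℕ) (i : Fin N) : ℕ → Fin N → ℝ := Pi.single m (Pi.single i 1)

/-- The smooth function `F` of the derivatives of order at most `d` represents `f` over `U`. -/
structure Represents (U : Set (Fin N → ℝ)) (d : ℕ) (F : (Fin (d + 1) → Fin N → ℝ) → ℝ)
    (f : (ℕ → Fin N → ℝ) → ℝ) : Prop where
  smooth : ContDiffOn ℝ ∞ F {w | w 0 ∈ U}
  eval : ∀ v : ℕ → Fin N → ℝ, v 0 ∈ U → f v = F (trunc d v)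

/-- The derivative of `f` at the jet `v` in the direction of the jet `w`. -/
noncomputable def jetDir (f : (ℕ → Fin N → ℝ) → ℝ) (v w : ℕ → Fin N → ℝ) : ℝ :=
  ∑ᶠ m : ℕ, ∑ i, w m i * jetPartial m i f v

theorem totalDeriv_eq_jetDir (f : (ℕ → Fin N → ℝ) → ℝ) (v : ℕ → Fin N → ℝ) :
    totalDeriv f v = jetDir f v (fun m => v (m + 1)) := rfl

theorem isLocalDensity_iff {U : Set (Fin N → ℝ)} {f : (ℕ → Fin N → ℝ) → ℝ} :
    IsLocalDensity U f ↔ ∃ d F, Represents U d F f :=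
  ⟨fun ⟨d, F, h1, h2⟩ => ⟨d, F, h1, h2⟩, fun ⟨d, F, h⟩ => ⟨d, F, h.1, h.2⟩⟩

theorem isOpen_truncDomain {U : Set (Fin N → ℝ)} (hU : IsOpen U) (d : ℕ) :
    IsOpen {w : Fin (d + 1) → Fin N → ℝ | w 0 ∈ U} :=
  hU.preimage (continuous_apply 0)

/-- The space of infinite jets carries no natural norm, so differentiability of a curve of jets is
stated coordinate by coordinate; truncation turns it into a curve in a finite-dimensional space,
where the chain rule applies. -/
theorem hasDerivAt_trunc {c : ℝ → ℕ → Fin N → ℝ} {w : ℕ → Fin N → ℝ} {t : ℝ}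
    (hc : ∀ m i, HasDerivAt (fun s => c s m i) (w m i) t) (d : ℕ) :
    HasDerivAt (fun s => trunc d (c s)) (trunc d w) t :=
  hasDerivAt_pi.2 fun m => hasDerivAt_pi.2 fun i => hc m i

theorem eventually_mem_of_hasDerivAt {U : Set (Fin N → ℝ)} (hU : IsOpen U)
    {c : ℝ → ℕ → Fin N → ℝ} {w : ℕ → Fin N → ℝ} {t : ℝ}
    (hc : ∀ m i, HasDerivAt (fun s => c s m i) (w m i) t) (ht : c t 0 ∈ U) :
    ∀ᶠ s in 𝓝 t, c s 0 ∈ U := by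
  have h : ContinuousAt (fun s => c s 0) t :=
    continuousAt_pi.2 fun i => (hc 0 i).continuousAt
  exact h.eventually (hU.mem_nhds ht)

theorem hasDerivAt_add_smul (v w : ℕ → Fin N → ℝ) (m : ℕ) (i : Fin N) (t : ℝ) :
    HasDerivAt (fun s : ℝ => (v + s • w) m i) (w m i) t := by
  simpa using ((hasDerivAt_id t).mul_const (w m i)).const_add (v m i)

/-! ### Finite-order representatives of densities and their derivatives. -/

namespace Represents

variable {U : Set (Fin N → ℝ)} {d : ℕ} {F : (Fin (d + 1) → Fin N → ℝ) → ℝ}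
  {f : (ℕ → Fin N → ℝ) → ℝ}

theorem contDiffAt (h : Represents U d F f) (hU : IsOpen U) {v : ℕ → Fin N → ℝ} (hv : v 0 ∈ U) :
    ContDiffAt ℝ ∞ F (trunc d v) :=
  h.smooth.contDiffAt ((isOpen_truncDomain hU d).mem_nhds hv)

protected theorem hasDerivAt (h : Represents U d F f) (hU : IsOpen U)
    {c : ℝ → ℕ → Fin N → ℝ} {w : ℕ → Fin N → ℝ} {t : ℝ}
    (hc : ∀ m i, HasDerivAt (fun s => c s m i) (w m i) t) (ht : c t 0 ∈ U) :
    HasDerivAt (fun s => f (c s)) (fderiv ℝ F (trunc d (c t)) (trunc d w)) t := by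
  have h1 : HasDerivAt (fun s => F (trunc d (c s))) (fderiv ℝ F (trunc d (c t)) (trunc d w)) t :=
    ((h.contDiffAt hU ht).differentiableAt (by simp)).hasFDerivAt.comp_hasDerivAt t
      (hasDerivAt_trunc hc d)
  refine h1.congr_of_eventuallyEq ?_
  filter_upwards [eventually_mem_of_hasDerivAt hU hc ht] with s hs using h.eval _ hs

theorem jetPartial_eq (h : Represents U d F f) (hU : IsOpen U) (m : ℕ) (i : Fin N)
    {v : ℕ → Fin N → ℝ} (hv : v 0 ∈ U) :
    jetPartial m i f v = fderiv ℝ F (trunc d v) (trunc d (unitJet m i)) := by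
  have h1 := h.hasDerivAt hU (c := fun s => v + s • unitJet m i) (t := 0)
    (fun k j => hasDerivAt_add_smul v _ k j 0) (by simpa using hv)
  simpa [jetPartial, lineDeriv, unitJet] using h1.deriv

theorem trunc_unitJet_of_lt {m : ℕ} (hm : d < m) (i : Fin N) :
    trunc d (unitJet m i) = 0 := by
  funext k
  have : (k : ℕ) ≠ m := by have := k.2; omega
  simp [trunc, unitJet, this]

theorem jetPartial_eq_zero (h : Represents U d F f) (hU : IsOpen U) {m : ℕ} (hm : d < m)
    (i : Fin N) {v : ℕ → Fin N → ℝ} (hv : v 0 ∈ U) : jetPartial m i f v = 0 := by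
  rw [h.jetPartial_eq hU m i hv, trunc_unitJet_of_lt hm, map_zero]

theorem jetDir_eq_sum (h : Represents U d F f) (hU : IsOpen U) {v : ℕ → Fin N → ℝ} (hv : v 0 ∈ U)
    (w : ℕ → Fin N → ℝ) :
    jetDir f v w = ∑ m ∈ Finset.range (d + 1), ∑ i, w m i * jetPartial m i f v := by
  refine finsum_eq_sum_of_support_subset _ fun m hm => ?_
  by_contra hlt
  refine hm ?_
  simp only [Finset.coe_range, Set.mem_Iio, not_lt] at hlt
  exact Finset.sum_eq_zero fun i _ => by rw [h.jetPartial_eq_zero hU (by omega) i hv, mul_zero]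

theorem trunc_eq_sum (d : ℕ) (w : ℕ → Fin N → ℝ) :
    trunc d w = ∑ m ∈ Finset.range (d + 1), ∑ i, w m i • trunc d (unitJet m i) := by
  funext k j
  simp only [Finset.sum_apply, Pi.smul_apply, smul_eq_mul]
  rw [Finset.sum_eq_single_of_mem (k : ℕ) (Finset.mem_range.2 k.2)]
  · rw [Finset.sum_eq_single j]
    · simp [trunc, unitJet]
    · intro b _ hb; simp [trunc, unitJet, hb.symm]
    · simp
  · intro m _ hm
    refine Finset.sum_eq_zero fun i _ => ?_
    simp [trunc, unitJet, hm.symm]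

/-- The formal sum of partial derivatives is a Fréchet derivative of the representative. This is
what later makes symmetry of second derivatives available on jets. -/
theorem jetDir_eq (h : Represents U d F f) (hU : IsOpen U) {v : ℕ → Fin N → ℝ} (hv : v 0 ∈ U)
    (w : ℕ → Fin N → ℝ) : jetDir f v w = fderiv ℝ F (trunc d v) (trunc d w) := by
  rw [h.jetDir_eq_sum hU hv, trunc_eq_sum d w]
  simp only [map_sum, map_smul, smul_eq_mul]
  exact Finset.sum_congr rfl fun m _ => Finset.sum_congr rfl fun i _ => by
    rw [h.jetPartial_eq hU m i hv]

theorem contDiffOn_fderiv_apply (h : Represents U d F f) (hU : IsOpen U) :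
    ContDiffOn ℝ ∞ (fderiv ℝ F) {w | w 0 ∈ U} :=
  h.smooth.fderiv_of_isOpen (isOpen_truncDomain hU d) (by simp)

protected theorem jetPartial (h : Represents U d F f) (hU : IsOpen U) (m : ℕ) (i : Fin N) :
    Represents U d (fun w => fderiv ℝ F w (trunc d (unitJet m i))) (jetPartial m i f) where
  smooth := (h.contDiffOn_fderiv_apply hU).clm_apply contDiffOn_const
  eval _ hv := h.jetPartial_eq hU m i hv

/-- A representative of higher order. -/
theorem mono (h : Represents U d F f) {e : ℕ} (hde : d ≤ e) :
    Represents U e (fun w => F (fun m => w (Fin.castLE (Nat.succ_le_succ hde) m))) f where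
  smooth := by
    refine h.smooth.comp (t := {w | w 0 ∈ U}) (ContDiff.contDiffOn ?_) fun w hw => ?_
    · exact contDiff_pi.2 fun m => contDiff_apply _ _ _
    · simpa using hw
  eval v hv := h.eval v hv

end Represents

/-! ### Closure of local densities under the operations of the formal calculus. -/

section Closure

variable {U : Set (Fin N → ℝ)} {f h : (ℕ → Fin N → ℝ) → ℝ}

theorem IsLocalDensity.congr (hf : IsLocalDensity U f) (e : ∀ v, v 0 ∈ U → h v = f v) :
    IsLocalDensity U h := by
  obtain ⟨d, F, h1, h2⟩ := hf
  exact ⟨d, F, h1, fun v hv => (e v hv).trans (h2 v hv)⟩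

theorem IsLocalDensity.exists_common (hf : IsLocalDensity U f) (hh : IsLocalDensity U h) :
    ∃ d F H, Represents U d F f ∧ Represents U d H h := by
  obtain ⟨d, F, hF⟩ := isLocalDensity_iff.1 hf
  obtain ⟨e, H, hH⟩ := isLocalDensity_iff.1 hh
  exact ⟨max d e, _, _, hF.mono (le_max_left d e), hH.mono (le_max_right d e)⟩

protected theorem IsLocalDensity.add (hf : IsLocalDensity U f) (hh : IsLocalDensity U h) :
    IsLocalDensity U (fun v => f v + h v) := by
  obtain ⟨d, F, H, hF, hH⟩ := hf.exists_common hh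
  exact isLocalDensity_iff.2 ⟨d, fun w => F w + H w, hF.smooth.add hH.smooth,
    fun v hv => by rw [hF.eval v hv, hH.eval v hv]⟩

protected theorem IsLocalDensity.mul (hf : IsLocalDensity U f) (hh : IsLocalDensity U h) :
    IsLocalDensity U (fun v => f v * h v) := by
  obtain ⟨d, F, H, hF, hH⟩ := hf.exists_common hh
  exact isLocalDensity_iff.2 ⟨d, fun w => F w * H w, hF.smooth.mul hH.smooth,
    fun v hv => by rw [hF.eval v hv, hH.eval v hv]⟩

theorem isLocalDensity_comp {a : (Fin N → ℝ) → ℝ} (ha : ContDiffOn ℝ ∞ a U) :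
    IsLocalDensity U (fun v => a (v 0)) :=
  ⟨0, fun w => a (w 0), ha.comp (contDiff_apply _ _ _).contDiffOn fun _ hw => hw,
    fun _ _ => rfl⟩

theorem isLocalDensity_const (c : ℝ) : IsLocalDensity U (fun _ => c) :=
  isLocalDensity_comp (a := fun _ => c) contDiffOn_const

theorem isLocalDensity_coord (m : ℕ) (i : Fin N) : IsLocalDensity U (fun v => v m i) :=
  ⟨m, fun w => w (Fin.last m) i,
    (by fun_prop : ContDiff ℝ ∞ fun w : Fin (m + 1) → Fin N → ℝ => w (Fin.last m) i).contDiffOn,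
    fun _ _ => rfl⟩

protected theorem IsLocalDensity.sum {ι : Type*} (s : Finset ι) {f : ι → (ℕ → Fin N → ℝ) → ℝ}
    (hf : ∀ i ∈ s, IsLocalDensity U (f i)) : IsLocalDensity U (fun v => ∑ i ∈ s, f i v) := by
  classical
  induction s using Finset.induction_on with
  | empty => simpa using isLocalDensity_const (U := U) 0
  | insert a s ha ih =>
    simp only [Finset.sum_insert ha]
    exact (hf a (by simp)).add (ih fun i hi => hf i (by simp [hi]))

protected theorem IsLocalDensity.jetPartial (hf : IsLocalDensity U f) (hU : IsOpen U) (m : ℕ) (i : Fin N) :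
    IsLocalDensity U (jetPartial m i f) := by
  obtain ⟨d, F, hF⟩ := isLocalDensity_iff.1 hf
  exact isLocalDensity_iff.2 ⟨d, _, hF.jetPartial hU m i⟩

protected theorem IsLocalDensity.totalDeriv (hf : IsLocalDensity U f) (hU : IsOpen U) :
    IsLocalDensity U (totalDeriv f) := by
  obtain ⟨d, F, hF⟩ := isLocalDensity_iff.1 hf
  refine IsLocalDensity.congr (IsLocalDensity.sum (Finset.range (d + 1)) fun m _ =>
    IsLocalDensity.sum Finset.univ fun i _ =>
      (isLocalDensity_coord (m + 1) i).mul (hf.jetPartial hU m i)) fun v hv => ?_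
  rw [totalDeriv_eq_jetDir, hF.jetDir_eq_sum hU hv]

theorem IsLocalDensity.iterate_totalDeriv (hf : IsLocalDensity U f) (hU : IsOpen U) (m : ℕ) :
    IsLocalDensity U (totalDeriv^[m] f) := by
  induction m with
  | zero => exact hf
  | succ m ih => rw [Function.iterate_succ_apply']; exact ih.totalDeriv hU

/-- Because `U` is open, derivatives at a jet over `U` do not see the arbitrary values that a
density takes elsewhere. The later congruence lemmas rest on this one. -/
theorem jetPartial_congr (hU : IsOpen U) (e : ∀ v, v 0 ∈ U → f v = h v) (m : ℕ) (i : Fin N)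
    {v : ℕ → Fin N → ℝ} (hv : v 0 ∈ U) : jetPartial m i f v = jetPartial m i h v := by
  refine EventuallyEq.deriv_eq ?_
  filter_upwards [eventually_mem_of_hasDerivAt hU (c := fun s => v + s • unitJet m i) (t := 0)
    (fun k j => hasDerivAt_add_smul v _ k j 0) (by simpa using hv)] with t ht using e _ ht

theorem jetDir_congr (hU : IsOpen U) (e : ∀ v, v 0 ∈ U → f v = h v)
    {v : ℕ → Fin N → ℝ} (hv : v 0 ∈ U) (w : ℕ → Fin N → ℝ) : jetDir f v w = jetDir h v w := by
  simp only [jetDir, jetPartial_congr hU e _ _ hv]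

theorem iterate_totalDeriv_congr (hU : IsOpen U) (e : ∀ v, v 0 ∈ U → f v = h v) (m : ℕ) :
    ∀ v, v 0 ∈ U → totalDeriv^[m] f v = totalDeriv^[m] h v := by
  induction m with
  | zero => exact e
  | succ m ih =>
    intro v hv
    rw [Function.iterate_succ_apply', Function.iterate_succ_apply']
    exact jetDir_congr hU ih hv _

theorem varDeriv_congr (hU : IsOpen U) (e : ∀ v, v 0 ∈ U → f v = h v) (i : Fin N)
    {v : ℕ → Fin N → ℝ} (hv : v 0 ∈ U) : varDeriv i f v = varDeriv i h v := by
  unfold varDeriv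
  refine finsum_congr fun m => ?_
  rw [iterate_totalDeriv_congr hU (fun w hw => jetPartial_congr hU e m i hw) m v hv]

theorem iterate_totalDeriv_zero (m : ℕ) :
    totalDeriv^[m] (fun _ : ℕ → Fin N → ℝ => (0 : ℝ)) = fun _ => 0 := by
  induction m with
  | zero => rfl
  | succ m ih =>
    rw [Function.iterate_succ_apply', ih]
    funext v
    simp [totalDeriv, jetPartial, lineDeriv]

theorem Represents.varDeriv_eq_sum {d : ℕ} {F : (Fin (d + 1) → Fin N → ℝ) → ℝ}
    (hF : Represents U d F f) (hU : IsOpen U) (i : Fin N) {v : ℕ → Fin N → ℝ} (hv : v 0 ∈ U) :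
    varDeriv i f v = ∑ m ∈ Finset.range (d + 1),
      (-1) ^ m * totalDeriv^[m] (jetPartial m i f) v := by
  refine finsum_eq_sum_of_support_subset _ fun m hm => ?_
  by_contra hlt
  refine hm ?_
  simp only [Finset.coe_range, Set.mem_Iio, not_lt] at hlt
  dsimp only
  rw [iterate_totalDeriv_congr hU (h := fun _ => 0)
    (fun w hw => hF.jetPartial_eq_zero hU (by omega) i hw) m v hv, iterate_totalDeriv_zero,
    mul_zero]

protected theorem IsLocalDensity.varDeriv (hf : IsLocalDensity U f) (hU : IsOpen U) (i : Fin N) :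
    IsLocalDensity U (varDeriv i f) := by
  obtain ⟨d, F, hF⟩ := isLocalDensity_iff.1 hf
  exact IsLocalDensity.congr (IsLocalDensity.sum (Finset.range (d + 1)) fun m _ =>
    (isLocalDensity_const ((-1) ^ m)).mul ((hf.jetPartial hU m i).iterate_totalDeriv hU m))
    fun v hv => hF.varDeriv_eq_sum hU i hv

theorem IsLocalDensity.hasDerivAt (hf : IsLocalDensity U f) (hU : IsOpen U)
    {c : ℝ → ℕ → Fin N → ℝ} {w : ℕ → Fin N → ℝ} {t : ℝ}
    (hc : ∀ m i, HasDerivAt (fun s => c s m i) (w m i) t) (ht : c t 0 ∈ U) :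
    HasDerivAt (fun s => f (c s)) (jetDir f (c t) w) t := by
  obtain ⟨d, F, hF⟩ := isLocalDensity_iff.1 hf
  rw [hF.jetDir_eq hU ht]
  exact hF.hasDerivAt hU hc ht

theorem IsLocalDensity.hasDerivAt_line (hf : IsLocalDensity U f) (hU : IsOpen U)
    {v : ℕ → Fin N → ℝ} (hv : v 0 ∈ U) (w : ℕ → Fin N → ℝ) :
    HasDerivAt (fun s : ℝ => f (v + s • w)) (jetDir f v w) 0 := by
  simpa using hf.hasDerivAt hU (c := fun s => v + s • w) (t := 0)
    (fun k j => hasDerivAt_add_smul v _ k j 0) (by simpa using hv)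

/-- Uniqueness of the derivative along a line: every rule for `jetDir` reduces to the corresponding
rule of one-variable calculus. -/
theorem jetDir_eq_of_hasDerivAt (hf : IsLocalDensity U f) (hU : IsOpen U)
    {v : ℕ → Fin N → ℝ} (hv : v 0 ∈ U) {w : ℕ → Fin N → ℝ} {a : ℝ}
    (h : HasDerivAt (fun s : ℝ => f (v + s • w)) a 0) : jetDir f v w = a :=
  (hf.hasDerivAt_line hU hv w).unique h

theorem jetDir_mul (hf : IsLocalDensity U f) (hh : IsLocalDensity U h) (hU : IsOpen U)
    {v : ℕ → Fin N → ℝ} (hv : v 0 ∈ U) (w : ℕ → Fin N → ℝ) :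
    jetDir (fun v => f v * h v) v w = jetDir f v w * h v + f v * jetDir h v w :=
  jetDir_eq_of_hasDerivAt (hf.mul hh) hU hv <| by
    simpa using (hf.hasDerivAt_line hU hv w).fun_mul (hh.hasDerivAt_line hU hv w)

theorem jetDir_add (hf : IsLocalDensity U f) (hh : IsLocalDensity U h) (hU : IsOpen U)
    {v : ℕ → Fin N → ℝ} (hv : v 0 ∈ U) (w : ℕ → Fin N → ℝ) :
    jetDir (fun v => f v + h v) v w = jetDir f v w + jetDir h v w :=
  jetDir_eq_of_hasDerivAt (hf.add hh) hU hv <|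
    (hf.hasDerivAt_line hU hv w).add (hh.hasDerivAt_line hU hv w)

theorem jetDir_sum {ι : Type*} (s : Finset ι) {f : ι → (ℕ → Fin N → ℝ) → ℝ}
    (hf : ∀ i ∈ s, IsLocalDensity U (f i)) (hU : IsOpen U)
    {v : ℕ → Fin N → ℝ} (hv : v 0 ∈ U) (w : ℕ → Fin N → ℝ) :
    jetDir (fun v => ∑ i ∈ s, f i v) v w = ∑ i ∈ s, jetDir (f i) v w :=
  jetDir_eq_of_hasDerivAt (IsLocalDensity.sum s hf) hU hv <|
    HasDerivAt.fun_sum fun i hi => (hf i hi).hasDerivAt_line hU hv w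

theorem jetDir_coord (m : ℕ) (i : Fin N) (v w : ℕ → Fin N → ℝ) :
    jetDir (fun v => v m i) v w = w m i :=
  jetDir_eq_of_hasDerivAt (U := Set.univ) (isLocalDensity_coord m i) isOpen_univ (Set.mem_univ _)
    (hasDerivAt_add_smul v w m i 0)

theorem fderiv_apply_eq_sum (a : (Fin N → ℝ) → ℝ) (u y : Fin N → ℝ) :
    fderiv ℝ a u y = ∑ s, pderiv s a u * y s := by
  conv_lhs => rw [← Finset.univ_sum_single y]
  rw [map_sum]
  refine Finset.sum_congr rfl fun s _ => ?_
  rw [show (Pi.single s (y s) : Fin N → ℝ) = y s • Pi.single s 1 by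
    rw [← Pi.single_smul]; simp, map_smul, smul_eq_mul, mul_comm, pderiv]

theorem jetDir_comp {a : (Fin N → ℝ) → ℝ} (ha : ContDiffOn ℝ ∞ a U) (hU : IsOpen U)
    {v : ℕ → Fin N → ℝ} (hv : v 0 ∈ U) (w : ℕ → Fin N → ℝ) :
    jetDir (fun v => a (v 0)) v w = ∑ s, pderiv s a (v 0) * w 0 s := by
  rw [← fderiv_apply_eq_sum]
  refine jetDir_eq_of_hasDerivAt (isLocalDensity_comp ha) hU hv ?_
  have hd : DifferentiableAt ℝ a (v 0) :=
    (ha.contDiffAt (hU.mem_nhds hv)).differentiableAt (by simp)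
  have h1 : HasDerivAt (fun s : ℝ => (v + s • w) 0) (w 0) 0 :=
    hasDerivAt_pi.2 fun i => hasDerivAt_add_smul v w 0 i 0
  have h2 : HasFDerivAt a (fderiv ℝ a (v 0)) ((v + (0 : ℝ) • w) 0) := by
    simpa using hd.hasFDerivAt
  exact h2.comp_hasDerivAt 0 h1

end Closure

/-! ### Smooth loops -/

/-- A smooth `1`-periodic function on the line. -/
def IsLoop {E : Type*} [NormedAddCommGroup E] [NormedSpace ℝ E] (a : ℝ → E) : Prop :=
  ContDiff ℝ ∞ a ∧ Function.Periodic a 1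

section Loop

variable {a b : ℝ → ℝ}

protected theorem IsLoop.add (ha : IsLoop a) (hb : IsLoop b) : IsLoop (fun x => a x + b x) :=
  ⟨ha.1.add hb.1, fun x => by simp only [ha.2 x, hb.2 x]⟩

protected theorem IsLoop.mul (ha : IsLoop a) (hb : IsLoop b) : IsLoop (fun x => a x * b x) :=
  ⟨ha.1.mul hb.1, fun x => by simp only [ha.2 x, hb.2 x]⟩

theorem isLoop_const (c : ℝ) : IsLoop (fun _ : ℝ => c) := ⟨contDiff_const, fun _ => rfl⟩

protected theorem IsLoop.sum {ι : Type*} (s : Finset ι) {a : ι → ℝ → ℝ} (ha : ∀ i ∈ s, IsLoop (a i)) :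
    IsLoop (fun x => ∑ i ∈ s, a i x) :=
  ⟨ContDiff.sum fun i hi => (ha i hi).1, fun x => Finset.sum_congr rfl fun i hi => (ha i hi).2 x⟩

protected theorem IsLoop.deriv (ha : IsLoop a) : IsLoop (deriv a) := by
  refine ⟨(contDiff_infty_iff_deriv.1 ha.1).2, fun x => ?_⟩
  rw [← deriv_comp_add_const]
  exact congrArg (fun f => deriv f x) (funext ha.2)

protected theorem IsLoop.iteratedDeriv (ha : IsLoop a) (m : ℕ) : IsLoop (iteratedDeriv m a) := by
  induction m with
  | zero => simpa using ha
  | succ m ih => rw [iteratedDeriv_succ]; exact ih.deriv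

protected theorem IsLoop.hasDerivAt (ha : IsLoop a) (x : ℝ) : HasDerivAt a (deriv a x) x :=
  (ha.1.differentiable (by simp) x).hasDerivAt

theorem IsLoop.intervalIntegrable (ha : IsLoop a) :
    IntervalIntegrable a MeasureTheory.volume 0 1 :=
  ha.1.continuous.intervalIntegrable _ _

theorem IsLoop.integral_deriv (ha : IsLoop a) : ∫ x in (0 : ℝ)..1, deriv a x = 0 := by
  rw [intervalIntegral.integral_deriv_eq_sub (fun x _ => ha.1.differentiable (by simp) x)
    ha.deriv.intervalIntegrable]
  simpa [sub_eq_zero] using ha.2 0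

/-- Integration by parts without boundary terms, by periodicity. -/
theorem IsLoop.integral_deriv_mul (ha : IsLoop a) (hb : IsLoop b) :
    ∫ x in (0 : ℝ)..1, deriv a x * b x = -∫ x in (0 : ℝ)..1, a x * deriv b x := by
  have h := (ha.mul hb).integral_deriv
  have e : ∀ x, deriv (fun x => a x * b x) x
      = deriv a x * b x + a x * deriv b x := fun x =>
    ((ha.hasDerivAt x).mul (hb.hasDerivAt x)).deriv
  simp only [e] at h
  rw [intervalIntegral.integral_add (ha.deriv.mul hb).intervalIntegrable
    (ha.mul hb.deriv).intervalIntegrable] at h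
  linarith

theorem IsLoop.integral_iteratedDeriv_mul (ha : IsLoop a) (hb : IsLoop b) (m : ℕ) :
    ∫ x in (0 : ℝ)..1, a x * iteratedDeriv m b x =
      (-1) ^ m * ∫ x in (0 : ℝ)..1, iteratedDeriv m a x * b x := by
  induction m generalizing a with
  | zero => simp
  | succ m ih =>
    have h := ha.integral_deriv_mul (hb.iteratedDeriv m)
    rw [iteratedDeriv_succ, iteratedDeriv_succ', pow_succ, mul_assoc, mul_comm (-1 : ℝ),
      mul_neg_one, mul_neg, ← ih ha.deriv, h, neg_neg]

theorem isLoop_pi {ξ : ℝ → Fin N → ℝ} : IsLoop ξ ↔ ∀ i, IsLoop (fun x => ξ x i) :=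
  ⟨fun h i => ⟨contDiff_pi.1 h.1 i, fun x => congrFun (h.2 x) i⟩,
    fun h => ⟨contDiff_pi.2 fun i => (h i).1, fun x => funext fun i => (h i).2 x⟩⟩

theorem IsField.isLoop {U : Set (Fin N → ℝ)} {u : ℝ → Fin N → ℝ} (hu : IsField U u) :
    IsLoop u := ⟨hu.1, hu.2.1⟩

protected theorem IsLoop.jet {ξ : ℝ → Fin N → ℝ} (h : IsLoop ξ) (m : ℕ) (i : Fin N) :
    IsLoop (fun x => jet ξ x m i) :=
  (isLoop_pi.1 h i).iteratedDeriv m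

theorem IsLoop.hasDerivAt_jet {ξ : ℝ → Fin N → ℝ} (h : IsLoop ξ) (m : ℕ) (i : Fin N) (x : ℝ) :
    HasDerivAt (fun x => jet ξ x m i) (jet ξ x (m + 1) i) x := by
  have := (h.jet m i).hasDerivAt x
  simpa only [jet, iteratedDeriv_succ] using this

theorem jet_zero (ξ : ℝ → Fin N → ℝ) (x : ℝ) : jet ξ x 0 = ξ x := by
  funext i; simp [jet]

theorem jet_one (ξ : ℝ → Fin N → ℝ) (x : ℝ) (i : Fin N) :
    jet ξ x 1 i = deriv (fun y => ξ y i) x := by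
  simp [jet, iteratedDeriv_one]

theorem jet_add_smul {u ξ : ℝ → Fin N → ℝ} (hu : IsLoop u) (hξ : IsLoop ξ) (ε x : ℝ) :
    jet (u + ε • ξ) x = jet u x + ε • jet ξ x := by
  funext m i
  have h1 : ContDiffAt ℝ m (fun y => u y i) x :=
    ((isLoop_pi.1 hu i).1.of_le (by exact_mod_cast le_top)).contDiffAt
  have h2 : ContDiffAt ℝ m (fun y => ξ y i) x :=
    ((isLoop_pi.1 hξ i).1.of_le (by exact_mod_cast le_top)).contDiffAt
  have h3 : ContDiffAt ℝ m (ε • fun y => ξ y i) x := contDiffAt_const.smul h2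
  have h4 := iteratedDeriv_add h1 h3
  have h5 : iteratedDeriv m (ε • fun y => ξ y i) x = ε • iteratedDeriv m (fun y => ξ y i) x :=
    iteratedDeriv_const_smul h2 ε
  rw [h5] at h4
  exact h4

theorem IsLoop.add_smul {u ξ : ℝ → Fin N → ℝ} (hu : IsLoop u) (hξ : IsLoop ξ) (ε : ℝ) :
    IsLoop (u + ε • ξ) :=
  ⟨hu.1.add (contDiff_const.smul hξ.1), fun x => by simp [hu.2 x, hξ.2 x]⟩

end Loop

/-! ### Densities along fields -/

section Fields

variable {U : Set (Fin N → ℝ)} {f h : (ℕ → Fin N → ℝ) → ℝ} {u : ℝ → Fin N → ℝ}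

theorem IsField.jet_mem (hu : IsField U u) (x : ℝ) : jet u x 0 ∈ U := by
  rw [jet_zero]; exact hu.2.2 x

theorem IsField.periodic_jet (hu : IsField U u) : Function.Periodic (jet u) 1 := fun x => by
  funext m i
  exact (hu.isLoop.jet m i).2 x

theorem IsLocalDensity.isLoop (hf : IsLocalDensity U f) (hu : IsField U u) :
    IsLoop (fun x => f (jet u x)) := by
  obtain ⟨d, F, hF⟩ := isLocalDensity_iff.1 hf
  refine ⟨?_, fun x => by simp only [hu.periodic_jet x]⟩
  have h1 : ContDiff ℝ ∞ (fun x => trunc d (jet u x)) :=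
    contDiff_pi.2 fun m => contDiff_pi.2 fun i => (hu.isLoop.jet m i).1
  have h2 : ContDiff ℝ ∞ (fun x => F (trunc d (jet u x))) := by
    rw [← contDiffOn_univ] at h1 ⊢
    exact hF.smooth.comp h1 fun x _ => hu.jet_mem x
  rwa [funext fun x => hF.eval _ (hu.jet_mem x)]

/-- The velocity of the curve x ↦ `jet u x` is the shifted jet, so the formal total derivative
becomes an actual x-derivative along a field. -/
theorem IsLocalDensity.hasDerivAt_jet (hf : IsLocalDensity U f) (hU : IsOpen U)
    (hu : IsField U u) (x : ℝ) :
    HasDerivAt (fun x => f (jet u x)) (totalDeriv f (jet u x)) x :=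
  hf.hasDerivAt hU (fun m i => hu.isLoop.hasDerivAt_jet m i x) (hu.jet_mem x)

theorem IsLocalDensity.iteratedDeriv_jet (hf : IsLocalDensity U f) (hU : IsOpen U)
    (hu : IsField U u) (m : ℕ) (x : ℝ) :
    iteratedDeriv m (fun x => f (jet u x)) x = totalDeriv^[m] f (jet u x) := by
  induction m generalizing x with
  | zero => simp
  | succ m ih =>
    rw [iteratedDeriv_succ, funext ih, Function.iterate_succ_apply']
    exact ((hf.iterate_totalDeriv hU m).hasDerivAt_jet hU hu x).deriv

theorem IsLocalDensity.isLoop_jetDir (hf : IsLocalDensity U f) (hU : IsOpen U)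
    (hu : IsField U u) {ξ : ℝ → Fin N → ℝ} (hξ : IsLoop ξ) :
    IsLoop (fun x => jetDir f (jet u x) (jet ξ x)) := by
  obtain ⟨d, F, hF⟩ := isLocalDensity_iff.1 hf
  simp only [fun x => hF.jetDir_eq_sum hU (hu.jet_mem x) (jet ξ x)]
  exact IsLoop.sum _ fun m _ => IsLoop.sum _ fun i _ =>
    (hξ.jet m i).mul ((hf.jetPartial hU m i).isLoop hu)

/-- The first variation formula. -/
theorem integral_jetDir (hf : IsLocalDensity U f) (hU : IsOpen U) (hu : IsField U u)
    {ξ : ℝ → Fin N → ℝ} (hξ : IsLoop ξ) :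
    ∫ x in (0 : ℝ)..1, jetDir f (jet u x) (jet ξ x) =
      ∫ x in (0 : ℝ)..1, ∑ i, varDeriv i f (jet u x) * ξ x i := by
  obtain ⟨d, F, hF⟩ := isLocalDensity_iff.1 hf
  have hp := fun m i => hf.jetPartial hU m i
  simp only [fun x => hF.jetDir_eq_sum hU (hu.jet_mem x) (jet ξ x),
    fun i x => hF.varDeriv_eq_sum hU i (hu.jet_mem x), Finset.sum_mul]
  rw [intervalIntegral.integral_finsetSum, intervalIntegral.integral_finsetSum]
  · simp_rw [fun i => intervalIntegral.integral_finsetSum (μ := MeasureTheory.volume) (a := 0)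
      (b := 1) (s := Finset.range (d + 1)) (f := fun m x => (-1) ^ m *
        totalDeriv^[m] (jetPartial m i f) (jet u x) * ξ x i) fun m _ =>
      (((isLoop_const ((-1) ^ m)).mul (((hp m i).iterate_totalDeriv hU m).isLoop hu)).mul
        (isLoop_pi.1 hξ i)).intervalIntegrable]
    rw [Finset.sum_comm]
    refine Finset.sum_congr rfl fun m _ => ?_
    rw [intervalIntegral.integral_finsetSum]
    · refine Finset.sum_congr rfl fun i _ => ?_
      -- Integrating by parts m times moves all derivatives from ξ to the partial derivative of f
      -- and produces the sign (-1)^m of the variational derivative.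
      have := ((hp m i).isLoop hu).integral_iteratedDeriv_mul (isLoop_pi.1 hξ i) m
      simp only [(hp m i).iteratedDeriv_jet hU hu] at this
      simp only [mul_assoc]
      rw [intervalIntegral.integral_const_mul, ← this]
      exact intervalIntegral.integral_congr fun x _ => mul_comm _ _
    · intro i _
      exact ((hξ.jet m i).mul ((hp m i).isLoop hu)).intervalIntegrable
  · intro i _
    exact (IsLoop.sum _ fun m _ => ((isLoop_const ((-1) ^ m)).mul
      (((hp m i).iterate_totalDeriv hU m).isLoop hu)).mul (isLoop_pi.1 hξ i)).intervalIntegrable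
  · intro m _
    exact (IsLoop.sum _ fun i _ => (hξ.jet m i).mul ((hp m i).isLoop hu)).intervalIntegrable

/-! ### Variation of fields -/

/-- Differentiation under the integral sign when the integrand is smooth only near the segment {0} ×
[0, 1]. The tube lemma provides a compact rectangle in `O`, on which the ε-derivative is bounded by
a constant. -/
theorem hasDerivAt_integral_of_contDiffOn {O : Set (ℝ × ℝ)} (hO : IsOpen O) {Ψ : ℝ × ℝ → ℝ}
    (hΨ : ContDiffOn ℝ ∞ Ψ O) (h0 : ∀ x ∈ Set.Icc (0 : ℝ) 1, ((0 : ℝ), x) ∈ O) {D : ℝ → ℝ}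
    (hD : ∀ x ∈ Set.Icc (0 : ℝ) 1, HasDerivAt (fun ε => Ψ (ε, x)) (D x) 0) :
    HasDerivAt (fun ε => ∫ x in (0 : ℝ)..1, Ψ (ε, x)) (∫ x in (0 : ℝ)..1, D x) 0 := by
  obtain ⟨V, W, hV, -, h0V, hIW, hVW⟩ := generalized_tube_lemma (isCompact_singleton (x := (0 : ℝ)))
    (isCompact_Icc (a := (0 : ℝ)) (b := 1)) hO (by
      rintro ⟨e, x⟩ ⟨he, hx⟩
      rw [Set.mem_singleton_iff] at he
      subst he
      exact h0 x hx)
  obtain ⟨r, hr, hrV⟩ := Metric.nhds_basis_closedBall.mem_iff.1 (hV.mem_nhds (h0V rfl))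
  have hKO : Metric.closedBall (0 : ℝ) r ×ˢ Set.Icc (0 : ℝ) 1 ⊆ O :=
    (Set.prod_mono hrV hIW).trans hVW
  have hd : ContinuousOn (fun p => fderiv ℝ Ψ p (1, 0)) O :=
    ((hΨ.fderiv_of_isOpen (m := ∞) hO (by simp)).clm_apply contDiffOn_const).continuousOn
  have hslice : ∀ e ∈ Metric.closedBall (0 : ℝ) r, ∀ {G : ℝ × ℝ → ℝ}, ContinuousOn G O →
      ContinuousOn (fun x => G (e, x)) (Set.Icc 0 1) := fun e he G hG =>
    hG.comp (by fun_prop) fun x hx => hKO ⟨he, hx⟩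
  have hint : ∀ e ∈ Metric.closedBall (0 : ℝ) r, ∀ {G : ℝ × ℝ → ℝ}, ContinuousOn G O →
      IntervalIntegrable (fun x => G (e, x)) MeasureTheory.volume 0 1 := fun e he G hG =>
    ContinuousOn.intervalIntegrable (by simpa using hslice e he hG)
  obtain ⟨C, hC⟩ := ((isCompact_closedBall (0 : ℝ) r).prod (isCompact_Icc (a := (0 : ℝ))
    (b := 1))).exists_bound_of_continuousOn (hd.mono hKO)
  have hder : ∀ e ∈ Metric.closedBall (0 : ℝ) r, ∀ x ∈ Set.Icc (0 : ℝ) 1,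
      HasDerivAt (fun ε => Ψ (ε, x)) (fderiv ℝ Ψ (e, x) (1, 0)) e := fun e he x hx => by
    have h1 : HasFDerivAt Ψ (fderiv ℝ Ψ (e, x)) ((fun ε : ℝ => (ε, x)) e) :=
      ((hΨ.contDiffAt (hO.mem_nhds (hKO ⟨he, hx⟩))).differentiableAt (by simp)).hasFDerivAt
    have h2 : HasDerivAt (fun ε : ℝ => (ε, x)) (1, 0) e :=
      (hasDerivAt_id e).prodMk (hasDerivAt_const e x)
    exact h1.comp_hasDerivAt e h2
  have hI : Set.uIoc (0 : ℝ) 1 ⊆ Set.Icc 0 1 := by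
    rw [Set.uIoc_of_le zero_le_one]; exact Set.Ioc_subset_Icc_self
  have h00 : (0 : ℝ) ∈ Metric.closedBall (0 : ℝ) r := Metric.mem_closedBall_self hr.le
  have key := (intervalIntegral.hasDerivAt_integral_of_dominated_loc_of_deriv_le
    (μ := MeasureTheory.volume) (a := 0) (b := 1) (bound := fun _ => C)
    (F := fun ε x => Ψ (ε, x)) (F' := fun ε x => fderiv ℝ Ψ (ε, x) (1, 0)) (x₀ := 0)
    (Metric.closedBall_mem_nhds 0 hr)
    (by
      filter_upwards [Metric.closedBall_mem_nhds (0 : ℝ) hr] with e he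
      exact ((hint e he hΨ.continuousOn).def').aestronglyMeasurable)
    (hint 0 h00 hΨ.continuousOn) ((hint 0 h00 hd).def').aestronglyMeasurable
    (Eventually.of_forall fun x hx e he => hC (e, x) ⟨he, hI hx⟩)
    intervalIntegrable_const
    (Eventually.of_forall fun x hx e he => hder e he x (hI hx))).2
  have e : ∫ x in (0 : ℝ)..1, D x = ∫ x in (0 : ℝ)..1, fderiv ℝ Ψ (0, x) (1, 0) :=
    intervalIntegral.integral_congr fun x hx =>
      (hD x (by rwa [Set.uIcc_of_le zero_le_one] at hx)).unique
        (hder 0 h00 x (by rwa [Set.uIcc_of_le zero_le_one] at hx))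
  rw [e]
  exact key

/-- The pairs `(ε, x)` at which the deformed field `u + ε ξ` takes values in `U`. -/
def variationDomain (U : Set (Fin N → ℝ)) (u ξ : ℝ → Fin N → ℝ) : Set (ℝ × ℝ) :=
  {p | u p.2 + p.1 • ξ p.2 ∈ U}

theorem isOpen_variationDomain (hU : IsOpen U) {ξ : ℝ → Fin N → ℝ} (hu : IsLoop u)
    (hξ : IsLoop ξ) : IsOpen (variationDomain U u ξ) := by
  refine hU.preimage ?_
  have h1 := hu.1.continuous
  have h2 := hξ.1.continuous
  fun_prop

theorem zero_mem_variationDomain (hu : IsField U u) (ξ : ℝ → Fin N → ℝ) (x : ℝ) :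
    ((0 : ℝ), x) ∈ variationDomain U u ξ := by
  simpa [variationDomain] using hu.2.2 x

theorem IsLocalDensity.contDiffOn_variation (hf : IsLocalDensity U f) {ξ : ℝ → Fin N → ℝ}
    (hu : IsLoop u) (hξ : IsLoop ξ) :
    ContDiffOn ℝ ∞ (fun p : ℝ × ℝ => f (jet u p.2 + p.1 • jet ξ p.2))
      (variationDomain U u ξ) := by
  obtain ⟨d, F, hF⟩ := isLocalDensity_iff.1 hf
  have h1 : ContDiff ℝ ∞ (fun p : ℝ × ℝ => trunc d (jet u p.2 + p.1 • jet ξ p.2)) :=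
    contDiff_pi.2 fun m => contDiff_pi.2 fun i =>
      ((hu.jet m i).1.comp contDiff_snd).add
        (contDiff_fst.mul ((hξ.jet m i).1.comp contDiff_snd))
  have hmem : ∀ p ∈ variationDomain U u ξ, (jet u p.2 + p.1 • jet ξ p.2) 0 ∈ U := fun p hp => by
    simpa [jet_zero, variationDomain] using hp
  refine (hF.smooth.comp h1.contDiffOn fun p hp => hmem p hp).congr fun p hp => ?_
  exact hF.eval _ (hmem p hp)

/-- The tube lemma controls one period; periodicity covers the rest of the line. -/
theorem eventually_isField (hU : IsOpen U) (hu : IsField U u) {ξ : ℝ → Fin N → ℝ}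
    (hξ : IsLoop ξ) : ∀ᶠ ε : ℝ in 𝓝 0, IsField U (u + ε • ξ) := by
  obtain ⟨V, W, hV, -, h0V, hIW, hVW⟩ := generalized_tube_lemma (isCompact_singleton (x := (0 : ℝ)))
    (isCompact_Icc (a := (0 : ℝ)) (b := 1)) (isOpen_variationDomain hU hu.isLoop hξ) (by
      rintro ⟨e, x⟩ ⟨he, hx⟩
      rw [Set.mem_singleton_iff] at he
      subst he
      exact zero_mem_variationDomain hu ξ x)
  filter_upwards [hV.mem_nhds (h0V rfl)] with ε hε
  have hl := hu.isLoop.add_smul hξ ε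
  refine ⟨hl.1, hl.2, fun x => ?_⟩
  obtain ⟨y, hy, hxy⟩ := hl.2.exists_mem_Ico₀ one_pos x
  rw [hxy]
  exact hVW (Set.mk_mem_prod hε (hIW (Set.Ico_subset_Icc_self hy)))

/-- The derivative of a functional along a deformation of the field. -/
theorem hasDerivAt_functional (hf : IsLocalDensity U f) (hU : IsOpen U) (hu : IsField U u)
    {ξ : ℝ → Fin N → ℝ} (hξ : IsLoop ξ) :
    HasDerivAt (fun ε : ℝ => functional f (u + ε • ξ))
      (∫ x in (0 : ℝ)..1, ∑ i, varDeriv i f (jet u x) * ξ x i) 0 := by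
  rw [← integral_jetDir hf hU hu hξ]
  have := hasDerivAt_integral_of_contDiffOn (isOpen_variationDomain hU hu.isLoop hξ)
    (hf.contDiffOn_variation hu.isLoop hξ) (fun x _ => zero_mem_variationDomain hu ξ x)
    (D := fun x => jetDir f (jet u x) (jet ξ x))
    (fun x _ => hf.hasDerivAt_line hU (hu.jet_mem x) (jet ξ x))
  simpa only [functional, jet_add_smul hu.isLoop hξ] using this

/-- Puts the second variation in the form of the Hessian of F on two truncated jets, a form in which
symmetry is evident. -/
theorem IsLocalDensity.jetDir_jetPartial_sum {d : ℕ} {F : (Fin (d + 1) → Fin N → ℝ) → ℝ}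
    (hF : Represents U d F f) (hU : IsOpen U) {v : ℕ → Fin N → ℝ} (hv : v 0 ∈ U)
    (w z : ℕ → Fin N → ℝ) :
    ∑ m ∈ Finset.range (d + 1), ∑ i, z m i * jetDir (jetPartial m i f) v w =
      fderiv ℝ (fderiv ℝ F) (trunc d v) (trunc d w) (trunc d z) := by
  have hd : DifferentiableAt ℝ (fderiv ℝ F) (trunc d v) :=
    ((hF.contDiffOn_fderiv_apply hU).contDiffAt
      ((isOpen_truncDomain hU d).mem_nhds hv)).differentiableAt (by simp)
  rw [Represents.trunc_eq_sum d z]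
  simp only [map_sum, map_smul, smul_eq_mul]
  refine Finset.sum_congr rfl fun m _ => Finset.sum_congr rfl fun i _ => ?_
  rw [(hF.jetPartial hU m i).jetDir_eq hU hv, fderiv_clm_apply hd (by fun_prop)]
  simp

theorem two_le_infty : (2 : WithTop ℕ∞) ≤ ∞ := 
  WithTop.coe_le_coe.2 (le_top : (2 : ℕ∞) ≤ ⊤)

/-- The second variation of a functional is symmetric. -/
theorem secondVariation_symm (hf : IsLocalDensity U f) (hU : IsOpen U) (hu : IsField U u)
    {ξ η : ℝ → Fin N → ℝ} (hξ : IsLoop ξ) (hη : IsLoop η) :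
    ∫ x in (0 : ℝ)..1, ∑ i, jetDir (varDeriv i f) (jet u x) (jet ξ x) * η x i =
      ∫ x in (0 : ℝ)..1, ∑ i, jetDir (varDeriv i f) (jet u x) (jet η x) * ξ x i := by
  obtain ⟨d, F, hF⟩ := isLocalDensity_iff.1 hf
  -- Differentiating the first variation formula in direction η at the fields u + ε ξ identifies the
  -- second variation with the integral of the Hessian of F, which is symmetric in ξ and η.
  have main : ∀ {ξ η : ℝ → Fin N → ℝ}, IsLoop ξ → IsLoop η →
      ∫ x in (0 : ℝ)..1, ∑ i, jetDir (varDeriv i f) (jet u x) (jet ξ x) * η x i =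
        ∫ x in (0 : ℝ)..1, fderiv ℝ (fderiv ℝ F) (trunc d (jet u x)) (trunc d (jet ξ x))
          (trunc d (jet η x)) := by
    intro ξ η hξ hη
    have hO := isOpen_variationDomain hU hu.isLoop hξ
    have h0 : ∀ x ∈ Set.Icc (0 : ℝ) 1, ((0 : ℝ), x) ∈ variationDomain U u ξ :=
      fun x _ => zero_mem_variationDomain hu ξ x
    have h1 := hasDerivAt_integral_of_contDiffOn hO (Ψ := fun p => ∑ i,
        varDeriv i f (jet u p.2 + p.1 • jet ξ p.2) * η p.2 i)
      (ContDiffOn.sum fun i _ => ((hf.varDeriv hU i).contDiffOn_variation hu.isLoop hξ).mul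
        ((isLoop_pi.1 hη i).1.comp contDiff_snd).contDiffOn) h0
      (D := fun x => ∑ i, jetDir (varDeriv i f) (jet u x) (jet ξ x) * η x i)
      (fun x _ => HasDerivAt.fun_sum fun i _ =>
        ((hf.varDeriv hU i).hasDerivAt_line hU (hu.jet_mem x) (jet ξ x)).mul_const (η x i))
    have h2 := hasDerivAt_integral_of_contDiffOn hO (Ψ := fun p =>
        ∑ m ∈ Finset.range (d + 1), ∑ i, jet η p.2 m i *
          jetPartial m i f (jet u p.2 + p.1 • jet ξ p.2))
      (ContDiffOn.sum fun m _ => ContDiffOn.sum fun i _ =>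
        ((hη.jet m i).1.comp contDiff_snd).contDiffOn.mul
          ((hf.jetPartial hU m i).contDiffOn_variation hu.isLoop hξ)) h0
      (D := fun x => ∑ m ∈ Finset.range (d + 1), ∑ i, jet η x m i *
        jetDir (jetPartial m i f) (jet u x) (jet ξ x))
      (fun x _ => HasDerivAt.fun_sum fun m _ => HasDerivAt.fun_sum fun i _ =>
        ((hf.jetPartial hU m i).hasDerivAt_line hU (hu.jet_mem x) (jet ξ x)).const_mul (jet η x m i))
    -- The first variation formula is available at u + ε ξ only when that is still a field with
    -- values in `U`, hence for small ε, which is enough for the derivative at 0.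
    have h3 := h1.congr_of_eventuallyEq (f₁ := fun ε => ∫ x in (0 : ℝ)..1,
        ∑ m ∈ Finset.range (d + 1), ∑ i, jet η x m i *
          jetPartial m i f (jet u x + ε • jet ξ x)) (by
      filter_upwards [eventually_isField hU hu hξ] with ε hε
      have := integral_jetDir hf hU hε hη
      simp only [fun x => hF.jetDir_eq_sum hU (hε.jet_mem x) (jet η x)] at this
      simp only [jet_add_smul hu.isLoop hξ] at this
      exact this)
    rw [h3.unique h2]
    exact intervalIntegral.integral_congr fun x _ =>
      IsLocalDensity.jetDir_jetPartial_sum hF hU (hu.jet_mem x) _ _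
  rw [main hξ hη, main hη hξ]
  refine intervalIntegral.integral_congr fun x _ => ?_
  exact ((hF.contDiffAt hU (hu.jet_mem x)).isSymmSndFDerivAt (by simpa using two_le_infty)).eq _ _

/-- Total derivatives commute with variations. -/
theorem hasDerivAt_jetDir (hf : IsLocalDensity U f) (hU : IsOpen U) (hu : IsField U u)
    {ξ : ℝ → Fin N → ℝ} (hξ : IsLoop ξ) (x : ℝ) :
    HasDerivAt (fun x => jetDir f (jet u x) (jet ξ x))
      (jetDir (totalDeriv f) (jet u x) (jet ξ x)) x := by
  obtain ⟨d, F, hF⟩ := isLocalDensity_iff.1 hf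
  have hd : HasFDerivAt (fderiv ℝ F) (fderiv ℝ (fderiv ℝ F) (trunc d (jet u x)))
      (trunc d (jet u x)) :=
    (((hF.contDiffOn_fderiv_apply hU).contDiffAt ((isOpen_truncDomain hU d).mem_nhds
      (hu.jet_mem x))).differentiableAt (by simp)).hasFDerivAt
  have a1 : HasDerivAt (fun x => fderiv ℝ F (trunc d (jet u x)))
      (fderiv ℝ (fderiv ℝ F) (trunc d (jet u x)) (trunc d (fun m => jet u x (m + 1)))) x :=
    hd.comp_hasDerivAt x (hasDerivAt_trunc (fun m i => hu.isLoop.hasDerivAt_jet m i x) d)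
  have a2 : HasDerivAt (fun x => trunc d (jet ξ x)) (trunc d (fun m => jet ξ x (m + 1))) x :=
    hasDerivAt_trunc (fun m i => hξ.hasDerivAt_jet m i x) d
  have h1 := a1.clm_apply a2
  have h2 : jetDir (totalDeriv f) (jet u x) (jet ξ x) =
      fderiv ℝ (fderiv ℝ F) (trunc d (jet u x)) (trunc d (fun m => jet u x (m + 1)))
        (trunc d (jet ξ x)) +
        fderiv ℝ F (trunc d (jet u x)) (trunc d (fun m => jet ξ x (m + 1))) := by
    refine jetDir_eq_of_hasDerivAt (hf.totalDeriv hU) hU (hu.jet_mem x) ?_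
    set v := jet u x
    set w := jet ξ x
    have hl : ∀ m i, HasDerivAt (fun s : ℝ => (v + s • w) m i) (w m i) 0 :=
      fun m i => hasDerivAt_add_smul v w m i 0
    have e0 : v + (0 : ℝ) • w = v := by simp
    have hd' : HasFDerivAt (fderiv ℝ F) (fderiv ℝ (fderiv ℝ F) (trunc d v))
      (trunc d (v + (0 : ℝ) • w)) := by rw [e0]; exact hd
    have b1 : HasDerivAt (fun s : ℝ => fderiv ℝ F (trunc d (v + s • w)))
        (fderiv ℝ (fderiv ℝ F) (trunc d v) (trunc d w)) 0 :=
      hd'.comp_hasDerivAt (0 : ℝ) (hasDerivAt_trunc hl d)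
    have b2 : HasDerivAt (fun s : ℝ => trunc d (fun m => (v + s • w) (m + 1)))
        (trunc d (fun m => w (m + 1))) 0 := hasDerivAt_trunc (fun m i => hl (m + 1) i) d
    have h3 := b1.clm_apply b2
    simp only [e0] at h3
    -- The x-derivative and the variation differentiate F in opposite orders; symmetry of the second
    -- derivative makes the results agree.
    rw [((hF.contDiffAt hU (hu.jet_mem x)).isSymmSndFDerivAt (by simpa using two_le_infty)).eq]
    refine h3.congr_of_eventuallyEq ?_
    filter_upwards [eventually_mem_of_hasDerivAt hU hl (by rw [e0]; exact hu.jet_mem x)] with s hs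
    rw [totalDeriv_eq_jetDir, hF.jetDir_eq hU hs]
  rw [h2]
  refine h1.congr_of_eventuallyEq (Eventually.of_forall fun y => ?_)
  exact hF.jetDir_eq hU (hu.jet_mem y) _

end Fields

/-! ### Operators of hydrodynamic type along a field -/

/-- The gradient `δI/δu^i` of `I = ∫ f dx` along the field `u`. -/
noncomputable def grad (f : (ℕ → Fin N → ℝ) → ℝ) (u : ℝ → Fin N → ℝ) : ℝ → Fin N → ℝ :=
  fun x i => varDeriv i f (jet u x)

/-- The operator `g^{ij} d/dx + Γ^{ij}_k u^k_x` applied to a covector field along `u`. -/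
noncomputable def opField (g : (Fin N → ℝ) → Matrix (Fin N) (Fin N) ℝ)
    (Γ : Fin N → Fin N → Fin N → (Fin N → ℝ) → ℝ) (u a : ℝ → Fin N → ℝ) : ℝ → Fin N → ℝ :=
  fun x i => ∑ j, (g (u x) i j * jet a x 1 j + (∑ k, Γ i j k (u x) * jet u x 1 k) * a x j)

/-- The variation of the operator `g^{ij} d/dx + Γ^{ij}_k u^k_x` under `u ↦ u + ε ξ`, applied to a
covector field along `u`. -/
noncomputable def opVariation (g : (Fin N → ℝ) → Matrix (Fin N) (Fin N) ℝ)
    (Γ : Fin N → Fin N → Fin N → (Fin N → ℝ) → ℝ) (u ξ a : ℝ → Fin N → ℝ) : ℝ → Fin N → ℝ :=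
  fun x i => ∑ j, ((∑ s, pderiv s (fun w => g w i j) (u x) * ξ x s) * jet a x 1 j +
    (∑ k, ((∑ s, pderiv s (Γ i j k) (u x) * ξ x s) * jet u x 1 k +
      Γ i j k (u x) * jet ξ x 1 k)) * a x j)

/-- The pairing `∫ a_i ξ^i dx`. -/
noncomputable def loopPairing (a ξ : ℝ → Fin N → ℝ) : ℝ :=
  ∫ x in (0 : ℝ)..1, ∑ i, a x i * ξ x i

/-- Smooth components on `U` that define a skew-adjoint operator of hydrodynamic type. -/
structure IsSkewOperator (U : Set (Fin N → ℝ)) (g : (Fin N → ℝ) → Matrix (Fin N) (Fin N) ℝ)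
    (Γ : Fin N → Fin N → Fin N → (Fin N → ℝ) → ℝ) : Prop where
  smooth_metric : ∀ i j, ContDiffOn ℝ ∞ (fun u => g u i j) U
  smooth_conn : ∀ i j k, ContDiffOn ℝ ∞ (Γ i j k) U
  symm : ∀ u ∈ U, ∀ i j, g u i j = g u j i
  pderiv_metric : ∀ u ∈ U, ∀ i j k, pderiv k (fun w => g w i j) u = Γ i j k u + Γ j i k u

section

variable {U : Set (Fin N → ℝ)} {u : ℝ → Fin N → ℝ}

theorem isLoop_comp {a : (Fin N → ℝ) → ℝ} (ha : ContDiffOn ℝ ∞ a U) (hu : IsField U u) :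
    IsLoop (fun x => a (u x)) := by
  simpa only [jet_zero] using (isLocalDensity_comp ha).isLoop hu

theorem hasDerivAt_comp_field {a : (Fin N → ℝ) → ℝ} (ha : ContDiffOn ℝ ∞ a U) (hU : IsOpen U)
    (hu : IsField U u) (x : ℝ) :
    HasDerivAt (fun x => a (u x)) (∑ s, pderiv s a (u x) * jet u x 1 s) x := by
  have h := (isLocalDensity_comp ha).hasDerivAt_jet hU hu x
  rw [totalDeriv_eq_jetDir, jetDir_comp ha hU (hu.jet_mem x)] at h
  simpa only [jet_zero] using h

theorem contDiffOn_pderiv {a : (Fin N → ℝ) → ℝ} (ha : ContDiffOn ℝ ∞ a U) (hU : IsOpen U)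
    (i : Fin N) : ContDiffOn ℝ ∞ (fun u => pderiv i a u) U :=
  (ha.fderiv_of_isOpen (m := ∞) hU (by simp)).clm_apply contDiffOn_const

theorem isLoop_grad {f : (ℕ → Fin N → ℝ) → ℝ} (hf : IsLocalDensity U f) (hU : IsOpen U)
    (hu : IsField U u) : IsLoop (grad f u) :=
  isLoop_pi.2 fun i => (hf.varDeriv hU i).isLoop hu

theorem jet_grad_one {f : (ℕ → Fin N → ℝ) → ℝ} (hf : IsLocalDensity U f) (hU : IsOpen U)
    (hu : IsField U u) (x : ℝ) (i : Fin N) :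
    jet (grad f u) x 1 i = totalDeriv (varDeriv i f) (jet u x) := by
  rw [jet_one]
  exact ((hf.varDeriv hU i).hasDerivAt_jet hU hu x).deriv

theorem isLoop_loopPairing {a ξ : ℝ → Fin N → ℝ} (ha : IsLoop a) (hξ : IsLoop ξ) :
    IsLoop (fun x => ∑ i, a x i * ξ x i) :=
  IsLoop.sum _ fun i _ => (isLoop_pi.1 ha i).mul (isLoop_pi.1 hξ i)

/-- A bracket depends on its arguments only through their gradients along the field, so from here on
it is a pairing of covector and vector fields along a fixed loop. -/
theorem functional_bracketDensity (g : (Fin N → ℝ) → Matrix (Fin N) (Fin N) ℝ)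
    (Γ : Fin N → Fin N → Fin N → (Fin N → ℝ) → ℝ) (f : (ℕ → Fin N → ℝ) → ℝ)
    {h : (ℕ → Fin N → ℝ) → ℝ} (hh : IsLocalDensity U h) (hU : IsOpen U) (hu : IsField U u) :
    functional (bracketDensity g Γ f h) u = loopPairing (grad f u) (opField g Γ u (grad h u)) := by
  refine intervalIntegral.integral_congr fun x _ => ?_
  simp only [bracketDensity, opField, jet_grad_one hh hU hu, Finset.mul_sum, grad, jet_zero]

/-- The derivative of the functional of `f` in the direction `ξ` determines, and is determined by,
the pairing with the gradient; hence linear relations between functionals carry over. -/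
theorem sum_loopPairing_grad_eq_zero {ι : Type*} (s : Finset ι) (c : ι → ℝ)
    {f : ι → (ℕ → Fin N → ℝ) → ℝ} (hf : ∀ k ∈ s, IsLocalDensity U (f k)) (hU : IsOpen U)
    (h0 : ∀ u, IsField U u → ∑ k ∈ s, c k * functional (f k) u = 0) (hu : IsField U u)
    {ξ : ℝ → Fin N → ℝ} (hξ : IsLoop ξ) :
    ∑ k ∈ s, c k * loopPairing (grad (f k) u) ξ = 0 := by
  have h1 : HasDerivAt (fun ε : ℝ => ∑ k ∈ s, c k * functional (f k) (u + ε • ξ))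
      (∑ k ∈ s, c k * loopPairing (grad (f k) u) ξ) 0 :=
    HasDerivAt.fun_sum fun k hk => (hasDerivAt_functional (hf k hk) hU hu hξ).const_mul (c k)
  refine h1.unique ((hasDerivAt_const (0 : ℝ) (0 : ℝ)).congr_of_eventuallyEq ?_)
  filter_upwards [eventually_isField hU hu hξ] with ε hε using h0 _ hε

variable {g : (Fin N → ℝ) → Matrix (Fin N) (Fin N) ℝ}
  {Γ : Fin N → Fin N → Fin N → (Fin N → ℝ) → ℝ}

namespace IsSkewOperator

theorem isLoop_opField (H : IsSkewOperator U g Γ) (hu : IsField U u) {a : ℝ → Fin N → ℝ}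
    (ha : IsLoop a) : IsLoop (opField g Γ u a) :=
  isLoop_pi.2 fun i => IsLoop.sum _ fun j _ =>
    ((isLoop_comp (H.smooth_metric i j) hu).mul (ha.jet 1 j)).add
      ((IsLoop.sum _ fun k _ => (isLoop_comp (H.smooth_conn i j k) hu).mul
        (hu.isLoop.jet 1 k)).mul (isLoop_pi.1 ha j))

theorem isLoop_opVariation (H : IsSkewOperator U g Γ) (hU : IsOpen U) (hu : IsField U u)
    {ξ a : ℝ → Fin N → ℝ} (hξ : IsLoop ξ) (ha : IsLoop a) : IsLoop (opVariation g Γ u ξ a) :=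
  isLoop_pi.2 fun i => IsLoop.sum _ fun j _ =>
    ((IsLoop.sum _ fun s _ => (isLoop_comp (contDiffOn_pderiv (H.smooth_metric i j) hU s) hu).mul
      (isLoop_pi.1 hξ s)).mul (ha.jet 1 j)).add
      ((IsLoop.sum _ fun k _ => ((IsLoop.sum _ fun s _ =>
        (isLoop_comp (contDiffOn_pderiv (H.smooth_conn i j k) hU s) hu).mul
          (isLoop_pi.1 hξ s)).mul (hu.isLoop.jet 1 k)).add
            ((isLoop_comp (H.smooth_conn i j k) hu).mul (hξ.jet 1 k))).mul (isLoop_pi.1 ha j))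

theorem isLocalDensity_bracketDensity (H : IsSkewOperator U g Γ) (hU : IsOpen U)
    {f h : (ℕ → Fin N → ℝ) → ℝ} (hf : IsLocalDensity U f) (hh : IsLocalDensity U h) :
    IsLocalDensity U (bracketDensity g Γ f h) :=
  IsLocalDensity.sum _ fun i _ => IsLocalDensity.sum _ fun j _ =>
    (hf.varDeriv hU i).mul
      (((isLocalDensity_comp (H.smooth_metric i j)).mul ((hh.varDeriv hU j).totalDeriv hU)).add
        ((IsLocalDensity.sum _ fun k _ => (isLocalDensity_comp (H.smooth_conn i j k)).mul
          (isLocalDensity_coord 1 k)).mul (hh.varDeriv hU j)))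

/-- The derivative of g^{ij} a_i b_j along the field equals a·Ab + b·Aa, by symmetry of g and ∂_k
g^{ij} = Γ^{ij}_k + Γ^{ji}_k; its integral over a period is zero. -/
theorem loopPairing_opField (H : IsSkewOperator U g Γ) (hU : IsOpen U) (hu : IsField U u)
    {a b : ℝ → Fin N → ℝ} (ha : IsLoop a) (hb : IsLoop b) :
    loopPairing a (opField g Γ u b) = -loopPairing b (opField g Γ u a) := by
  have hL : IsLoop (fun x => ∑ i, ∑ j, g (u x) i j * (a x i * b x j)) :=
    IsLoop.sum _ fun i _ => IsLoop.sum _ fun j _ =>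
      (isLoop_comp (H.smooth_metric i j) hu).mul ((isLoop_pi.1 ha i).mul (isLoop_pi.1 hb j))
  have hd : ∀ x, deriv (fun x => ∑ i, ∑ j, g (u x) i j * (a x i * b x j)) x =
      ∑ i, a x i * opField g Γ u b x i + ∑ i, b x i * opField g Γ u a x i := by
    intro x
    have h1 : HasDerivAt (fun x => ∑ i, ∑ j, g (u x) i j * (a x i * b x j))
        (∑ i, ∑ j, ((∑ k, pderiv k (fun w => g w i j) (u x) * jet u x 1 k) * (a x i * b x j) +
          g (u x) i j * (jet a x 1 i * b x j + a x i * jet b x 1 j))) x := by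
      refine HasDerivAt.fun_sum fun i _ => HasDerivAt.fun_sum fun j _ => ?_
      have hai : HasDerivAt (fun x => a x i) (jet a x 1 i) x := by
        simpa [jet] using ha.hasDerivAt_jet 0 i x
      have hbj : HasDerivAt (fun x => b x j) (jet b x 1 j) x := by
        simpa [jet] using hb.hasDerivAt_jet 0 j x
      exact (hasDerivAt_comp_field (H.smooth_metric i j) hU hu x).fun_mul (hai.fun_mul hbj)
    rw [h1.deriv]
    have hx := hu.2.2 x
    have e1 : ∑ i, b x i * opField g Γ u a x i = ∑ i, ∑ j, b x j * (g (u x) i j * jet a x 1 i +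
        (∑ k, Γ j i k (u x) * jet u x 1 k) * a x i) := by
      rw [Finset.sum_comm]
      simp only [opField, Finset.mul_sum]
      refine Finset.sum_congr rfl fun i _ => Finset.sum_congr rfl fun j _ => ?_
      rw [H.symm _ hx i j]
    rw [e1]
    simp only [opField, Finset.mul_sum]
    rw [← Finset.sum_add_distrib]
    refine Finset.sum_congr rfl fun i _ => ?_
    rw [← Finset.sum_add_distrib]
    refine Finset.sum_congr rfl fun j _ => ?_
    simp only [H.pderiv_metric _ hx, add_mul, Finset.sum_add_distrib]
    ring
  have h0 := hL.integral_deriv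
  simp only [hd] at h0
  rw [intervalIntegral.integral_add
    (isLoop_loopPairing ha (H.isLoop_opField hu hb)).intervalIntegrable
    (isLoop_loopPairing hb (H.isLoop_opField hu ha)).intervalIntegrable] at h0
  exact eq_neg_of_add_eq_zero_left h0

theorem functional_bracketDensity_skew (H : IsSkewOperator U g Γ) (hU : IsOpen U)
    {f h : (ℕ → Fin N → ℝ) → ℝ} (hf : IsLocalDensity U f) (hh : IsLocalDensity U h)
    (hu : IsField U u) :
    functional (bracketDensity g Γ f h) u = -functional (bracketDensity g Γ h f) u := by
  rw [functional_bracketDensity g Γ f hh hU hu, functional_bracketDensity g Γ h hf hU hu,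
    H.loopPairing_opField hU hu (isLoop_grad hf hU hu) (isLoop_grad hh hU hu)]

/-- The variation of a gradient. -/
noncomputable def _root_.HydroPoisson.gradVariation (f : (ℕ → Fin N → ℝ) → ℝ)
    (u ξ : ℝ → Fin N → ℝ) : ℝ → Fin N → ℝ :=
  fun x i => jetDir (varDeriv i f) (jet u x) (jet ξ x)

theorem _root_.HydroPoisson.isLoop_gradVariation {f : (ℕ → Fin N → ℝ) → ℝ}
    (hf : IsLocalDensity U f) (hU : IsOpen U) (hu : IsField U u) {ξ : ℝ → Fin N → ℝ}
    (hξ : IsLoop ξ) : IsLoop (gradVariation f u ξ) :=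
  isLoop_pi.2 fun i => (hf.varDeriv hU i).isLoop_jetDir hU hu hξ

theorem _root_.HydroPoisson.loopPairing_gradVariation_symm {f : (ℕ → Fin N → ℝ) → ℝ}
    (hf : IsLocalDensity U f) (hU : IsOpen U) (hu : IsField U u) {ξ η : ℝ → Fin N → ℝ}
    (hξ : IsLoop ξ) (hη : IsLoop η) :
    loopPairing (gradVariation f u ξ) η = loopPairing (gradVariation f u η) ξ :=
  secondVariation_symm hf hU hu hξ hη

/-- The Leibniz rule for the three ingredients of a bracket: the two gradients and the operator. The
variation of (δJ/δu)_x is the x-derivative of the variation of δJ/δu, by `hasDerivAt_jetDir`. -/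
theorem jetDir_bracketDensity (H : IsSkewOperator U g Γ) (hU : IsOpen U)
    {f h : (ℕ → Fin N → ℝ) → ℝ} (hf : IsLocalDensity U f) (hh : IsLocalDensity U h)
    (hu : IsField U u) {ξ : ℝ → Fin N → ℝ} (hξ : IsLoop ξ) (x : ℝ) :
    jetDir (bracketDensity g Γ f h) (jet u x) (jet ξ x) =
      ∑ i, gradVariation f u ξ x i * opField g Γ u (grad h u) x i +
      ∑ i, grad f u x i * opField g Γ u (gradVariation h u ξ) x i +
      ∑ i, grad f u x i * opVariation g Γ u ξ (grad h u) x i := by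
  have hf' := fun i => hf.varDeriv hU i
  have hh' := fun i => hh.varDeriv hU i
  have hm := fun i j => isLocalDensity_comp (H.smooth_metric i j)
  have hc := fun i j k => isLocalDensity_comp (H.smooth_conn i j k)
  have hy := fun k : Fin N => isLocalDensity_coord (U := U) 1 k
  have hcy := fun i j => IsLocalDensity.sum Finset.univ fun k _ => (hc i j k).mul (hy k)
  have hq := fun i j => ((hm i j).mul ((hh' j).totalDeriv hU)).add ((hcy i j).mul (hh' j))
  have hx := hu.jet_mem x
  have key : ∀ i j, jetDir (fun v => varDeriv i f v * (g (v 0) i j * totalDeriv (varDeriv j h) v +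
      (∑ k, Γ i j k (v 0) * v 1 k) * varDeriv j h v)) (jet u x) (jet ξ x) =
      gradVariation f u ξ x i * (g (u x) i j * jet (grad h u) x 1 j +
        (∑ k, Γ i j k (u x) * jet u x 1 k) * grad h u x j) +
      grad f u x i * (g (u x) i j * jet (gradVariation h u ξ) x 1 j +
        (∑ k, Γ i j k (u x) * jet u x 1 k) * gradVariation h u ξ x j) +
      grad f u x i * ((∑ s, pderiv s (fun w => g w i j) (u x) * ξ x s) * jet (grad h u) x 1 j +
        (∑ k, ((∑ s, pderiv s (Γ i j k) (u x) * ξ x s) * jet u x 1 k +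
        Γ i j k (u x) * jet ξ x 1 k)) * grad h u x j) := by
    intro i j
    rw [jetDir_mul (hf' i) (hq i j) hU hx,
      jetDir_add ((hm i j).mul ((hh' j).totalDeriv hU)) ((hcy i j).mul (hh' j)) hU hx,
      jetDir_mul (hm i j) ((hh' j).totalDeriv hU) hU hx, jetDir_mul (hcy i j) (hh' j) hU hx,
      jetDir_sum _ (fun k _ => (hc i j k).mul (hy k)) hU hx, jetDir_comp (H.smooth_metric i j) hU hx]
    simp only [jetDir_mul (hc i j _) (hy _) hU hx, jetDir_comp (H.smooth_conn i j _) hU hx,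
      jetDir_coord, jet_zero]
    have e : jet (gradVariation h u ξ) x 1 j =
        jetDir (totalDeriv (varDeriv j h)) (jet u x) (jet ξ x) := by
      rw [jet_one]
      exact (hasDerivAt_jetDir (hh' j) hU hu hξ x).deriv
    rw [e, jet_grad_one hh hU hu]
    simp only [gradVariation, grad]
    ring
  have e : bracketDensity g Γ f h = fun v => ∑ i, ∑ j, varDeriv i f v *
      (g (v 0) i j * totalDeriv (varDeriv j h) v +
        (∑ k, Γ i j k (v 0) * v 1 k) * varDeriv j h v) := rfl
  rw [e, jetDir_sum _ (fun i _ => IsLocalDensity.sum _ fun j _ => (hf' i).mul (hq i j)) hU hx]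
  simp only [jetDir_sum _ (fun j _ => (hf' _).mul (hq _ j)) hU hx, key]
  simp only [opField, opVariation, Finset.mul_sum]
  simp only [← Finset.sum_add_distrib]

/-- The derivative of a bracket in the direction `ξ`. -/
theorem loopPairing_grad_bracketDensity (H : IsSkewOperator U g Γ) (hU : IsOpen U)
    {f h : (ℕ → Fin N → ℝ) → ℝ} (hf : IsLocalDensity U f) (hh : IsLocalDensity U h)
    (hu : IsField U u) {ξ : ℝ → Fin N → ℝ} (hξ : IsLoop ξ) :
    loopPairing (grad (bracketDensity g Γ f h) u) ξ =
      loopPairing (gradVariation f u ξ) (opField g Γ u (grad h u)) -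
      loopPairing (gradVariation h u ξ) (opField g Γ u (grad f u)) +
      loopPairing (grad f u) (opVariation g Γ u ξ (grad h u)) := by
  have hgf := isLoop_grad hf hU hu
  have hgh := isLoop_grad hh hU hu
  have hvf := isLoop_gradVariation hf hU hu hξ
  have hvh := isLoop_gradVariation hh hU hu hξ
  have h1 := integral_jetDir (H.isLocalDensity_bracketDensity hU hf hh) hU hu hξ
  simp only [H.jetDir_bracketDensity hU hf hh hu hξ] at h1
  rw [intervalIntegral.integral_add, intervalIntegral.integral_add] at h1
  -- Skew-adjointness moves the operator off the variation of the second gradient, at the price of a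
  -- sign.
  · have h2 := H.loopPairing_opField hU hu hgf hvh
    simp only [loopPairing, grad] at h1 h2 ⊢
    linarith
  · exact (isLoop_loopPairing hvf (H.isLoop_opField hu hgh)).intervalIntegrable
  · exact (isLoop_loopPairing hgf (H.isLoop_opField hu hvh)).intervalIntegrable
  · exact ((isLoop_loopPairing hvf (H.isLoop_opField hu hgh)).add
      (isLoop_loopPairing hgf (H.isLoop_opField hu hvh))).intervalIntegrable
  · exact (isLoop_loopPairing hgf (H.isLoop_opVariation hU hu hξ hgh)).intervalIntegrable

/-- The Jacobi identity follows from the vanishing of the trivector of the operator. -/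
theorem jacobi (H : IsSkewOperator U g Γ) (hU : IsOpen U)
    (hT : ∀ u, IsField U u → ∀ a b c : ℝ → Fin N → ℝ, IsLoop a → IsLoop b → IsLoop c →
      loopPairing a (opVariation g Γ u (opField g Γ u c) b) +
      loopPairing b (opVariation g Γ u (opField g Γ u a) c) +
      loopPairing c (opVariation g Γ u (opField g Γ u b) a) = 0)
    {f h l : (ℕ → Fin N → ℝ) → ℝ} (hf : IsLocalDensity U f) (hh : IsLocalDensity U h)
    (hl : IsLocalDensity U l) (hu : IsField U u) :
    functional (bracketDensity g Γ (bracketDensity g Γ f h) l) u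
      + functional (bracketDensity g Γ (bracketDensity g Γ h l) f) u
      + functional (bracketDensity g Γ (bracketDensity g Γ l f) h) u = 0 := by
  have Af := H.isLoop_opField hu (isLoop_grad hf hU hu)
  have Ah := H.isLoop_opField hu (isLoop_grad hh hU hu)
  have Al := H.isLoop_opField hu (isLoop_grad hl hU hu)
  -- After expansion the six second-variation terms cancel in pairs by symmetry of the three
  -- Hessians; only the terms with the variation of the operator survive, and they form the
  -- trivector.
  rw [functional_bracketDensity g Γ _ hl hU hu, functional_bracketDensity g Γ _ hf hU hu,
    functional_bracketDensity g Γ _ hh hU hu,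
    H.loopPairing_grad_bracketDensity hU hf hh hu Al,
    H.loopPairing_grad_bracketDensity hU hh hl hu Af,
    H.loopPairing_grad_bracketDensity hU hl hf hu Ah,
    loopPairing_gradVariation_symm hf hU hu Al Ah, loopPairing_gradVariation_symm hh hU hu Al Af,
    loopPairing_gradVariation_symm hl hU hu Af Ah]
  linarith [hT u hu _ _ _ (isLoop_grad hf hU hu) (isLoop_grad hh hU hu) (isLoop_grad hl hU hu)]

end IsSkewOperator

end

/-! ### Lie derivatives of operators of hydrodynamic type -/

/-- The components of the Lie derivative of the contravariant 2-tensor `g` along `X`. -/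
noncomputable def lieMetric (X : (Fin N → ℝ) → Fin N → ℝ)
    (g : (Fin N → ℝ) → Matrix (Fin N) (Fin N) ℝ) (u : Fin N → ℝ) : Matrix (Fin N) (Fin N) ℝ :=
  Matrix.of fun i j => dirDeriv X (fun w => g w i j) u
    - ∑ k, pderiv k (fun w => X w i) u * g u k j - ∑ k, pderiv k (fun w => X w j) u * g u i k

/-- The components of the Lie derivative along `X` of the contravariant connection coefficients `Γ`
belonging to `g`. -/
noncomputable def lieConn (X : (Fin N → ℝ) → Fin N → ℝ)
    (g : (Fin N → ℝ) → Matrix (Fin N) (Fin N) ℝ)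
    (Γ : Fin N → Fin N → Fin N → (Fin N → ℝ) → ℝ) (i j k : Fin N) (u : Fin N → ℝ) : ℝ :=
  dirDeriv X (Γ i j k) u + ∑ s, Γ i j s u * pderiv k (fun w => X w s) u
    - ∑ s, pderiv s (fun w => X w i) u * Γ s j k u - ∑ s, Γ i s k u * pderiv s (fun w => X w j) u
    - ∑ s, g u i s * pderiv k (pderiv s (fun w => X w j)) u

/-- The density `X^i δI/δu^i` of the derivative of `I = ∫ f dx` along `X`. -/
noncomputable def lieDensity (X : (Fin N → ℝ) → Fin N → ℝ) (f : (ℕ → Fin N → ℝ) → ℝ)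
    (v : ℕ → Fin N → ℝ) : ℝ :=
  ∑ i, varDeriv i f v * X (v 0) i

/-- Pointwise form of L_X A = δ_X A - (∂X) A - A (∂X)ᵀ, where δ_X A is the variation of the operator
along X. Here a i s stands for ∂_s X^i, c j k s for ∂_k ∂_s X^j, q for a covector, p for q_x and y
for u_x. The term of `lieConn` with second derivatives of X comes from d/dx falling on (∂X)ᵀ. -/
theorem lie_operator_identity (G : Fin N → Fin N → ℝ) (dG : Fin N → Fin N → Fin N → ℝ)
    (Γ : Fin N → Fin N → Fin N → ℝ) (dΓ : Fin N → Fin N → Fin N → Fin N → ℝ) (X : Fin N → ℝ)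
    (a : Fin N → Fin N → ℝ) (c : Fin N → Fin N → Fin N → ℝ) (p q y : Fin N → ℝ) (i : Fin N) :
    ∑ j, ((∑ s, X s * dG i j s - ∑ s, a i s * G s j - ∑ s, a j s * G i s) * p j +
      (∑ k, (∑ s, X s * dΓ i j k s + ∑ s, Γ i j s * a s k - ∑ s, a i s * Γ s j k
        - ∑ s, Γ i s k * a j s - ∑ s, G i s * c j k s) * y k) * q j) =
    ∑ j, ((∑ s, dG i j s * X s) * p j + (∑ k, ((∑ s, dΓ i j k s * X s) * y k +
        Γ i j k * ∑ s, a k s * y s)) * q j) -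
      ∑ s, a i s * (∑ j, (G s j * p j + (∑ k, Γ s j k * y k) * q j)) -
      ∑ s, (G i s * (∑ j, (p j * a j s + q j * ∑ k, c j k s * y k)) +
        (∑ k, Γ i s k * y k) * ∑ j, q j * a j s) := by
  have h1 : ∑ s, a i s * ∑ j, G s j * p j = ∑ j, (∑ s, a i s * G s j) * p j := by
    simp only [Finset.mul_sum, Finset.sum_mul]
    rw [Finset.sum_comm]
    simp only [mul_assoc]
  have h2 : ∑ s, a i s * ∑ j, (∑ k, Γ s j k * y k) * q j =
      ∑ j, (∑ k, (∑ s, a i s * Γ s j k) * y k) * q j := by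
    simp only [Finset.mul_sum, Finset.sum_mul]
    rw [Finset.sum_comm]
    refine Finset.sum_congr rfl fun j _ => ?_
    rw [Finset.sum_comm]
    simp only [mul_assoc]
  have h3 : ∑ s, G i s * ∑ j, p j * a j s = ∑ j, (∑ s, a j s * G i s) * p j := by
    simp only [Finset.mul_sum, Finset.sum_mul]
    rw [Finset.sum_comm]
    exact Finset.sum_congr rfl fun j _ => Finset.sum_congr rfl fun s _ => by ring
  have h4 : ∑ s, G i s * ∑ j, q j * ∑ k, c j k s * y k =
      ∑ j, (∑ k, (∑ s, G i s * c j k s) * y k) * q j := by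
    simp only [Finset.mul_sum, Finset.sum_mul]
    rw [Finset.sum_comm]
    refine Finset.sum_congr rfl fun j _ => ?_
    rw [Finset.sum_comm]
    exact Finset.sum_congr rfl fun j _ => Finset.sum_congr rfl fun s _ => by ring
  have h5 : ∑ s, (∑ k, Γ i s k * y k) * ∑ j, q j * a j s =
      ∑ j, (∑ k, (∑ s, Γ i s k * a j s) * y k) * q j := by
    simp only [Finset.mul_sum, Finset.sum_mul]
    rw [Finset.sum_comm]
    refine Finset.sum_congr rfl fun j _ => ?_
    rw [Finset.sum_comm]
    exact Finset.sum_congr rfl fun j _ => Finset.sum_congr rfl fun s _ => by ring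
  have h6 : ∀ j, ∑ k, Γ i j k * ∑ s, a k s * y s = ∑ k, (∑ s, Γ i j s * a s k) * y k := by
    intro j
    simp only [Finset.mul_sum, Finset.sum_mul]
    rw [Finset.sum_comm]
    simp only [mul_assoc]
  have h7 : ∀ j, ∑ s, dG i j s * X s = ∑ s, X s * dG i j s := fun j => by simp only [mul_comm]
  have h8 : ∀ j k, ∑ s, dΓ i j k s * X s = ∑ s, X s * dΓ i j k s := fun j k => by
    simp only [mul_comm]
  simp only [Finset.sum_add_distrib, Finset.sum_sub_distrib, add_mul, sub_mul, mul_add, h1, h2, h3,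
    h4, h5, h6, h7, h8]
  ring

section

variable {U : Set (Fin N → ℝ)} {u : ℝ → Fin N → ℝ} {X : (Fin N → ℝ) → Fin N → ℝ}
  {g g' : (Fin N → ℝ) → Matrix (Fin N) (Fin N) ℝ}
  {Γ Γ' : Fin N → Fin N → Fin N → (Fin N → ℝ) → ℝ}

theorem isLocalDensity_lieDensity (hX : ∀ i, ContDiffOn ℝ ∞ (fun u => X u i) U) (hU : IsOpen U)
    {f : (ℕ → Fin N → ℝ) → ℝ} (hf : IsLocalDensity U f) : IsLocalDensity U (lieDensity X f) :=
  IsLocalDensity.sum _ fun i _ => (hf.varDeriv hU i).mul (isLocalDensity_comp (hX i))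

theorem isLoop_fieldComp (hX : ∀ i, ContDiffOn ℝ ∞ (fun u => X u i) U) (hu : IsField U u) :
    IsLoop (fun x => X (u x)) :=
  isLoop_pi.2 fun i => isLoop_comp (hX i) hu

theorem functional_lieDensity (X : (Fin N → ℝ) → Fin N → ℝ) (f : (ℕ → Fin N → ℝ) → ℝ)
    (u : ℝ → Fin N → ℝ) :
    functional (lieDensity X f) u = loopPairing (grad f u) (fun x => X (u x)) := by
  simp only [functional, lieDensity, loopPairing, grad, jet_zero]

/-- The derivative in the direction `ξ` of the functional `∫ X^i δI/δu^i dx`. -/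
theorem loopPairing_grad_lieDensity (hX : ∀ i, ContDiffOn ℝ ∞ (fun u => X u i) U) (hU : IsOpen U)
    {f : (ℕ → Fin N → ℝ) → ℝ} (hf : IsLocalDensity U f) (hu : IsField U u)
    {ξ : ℝ → Fin N → ℝ} (hξ : IsLoop ξ) :
    loopPairing (grad (lieDensity X f) u) ξ =
      loopPairing (gradVariation f u ξ) (fun x => X (u x)) +
      loopPairing (fun x s => ∑ i, grad f u x i * pderiv s (fun w => X w i) (u x)) ξ := by
  have h := integral_jetDir (isLocalDensity_lieDensity hX hU hf) hU hu hξ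
  have hl := fun i => isLocalDensity_comp (hX i)
  have e : ∀ x, jetDir (lieDensity X f) (jet u x) (jet ξ x) =
      ∑ i, gradVariation f u ξ x i * X (u x) i +
      ∑ s, (∑ i, grad f u x i * pderiv s (fun w => X w i) (u x)) * ξ x s := by
    intro x
    have e0 : lieDensity X f = fun v => ∑ i, varDeriv i f v * X (v 0) i := rfl
    rw [e0, jetDir_sum _ (fun i _ => (hf.varDeriv hU i).mul (hl i)) hU (hu.jet_mem x)]
    simp only [jetDir_mul (hf.varDeriv hU _) (hl _) hU (hu.jet_mem x),
      jetDir_comp (hX _) hU (hu.jet_mem x), jet_zero, Finset.sum_add_distrib, gradVariation, grad]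
    congr 1
    simp only [Finset.mul_sum, Finset.sum_mul]
    rw [Finset.sum_comm]
    simp only [mul_assoc]
  simp only [e] at h
  rw [intervalIntegral.integral_add] at h
  · exact h.symm
  · exact (isLoop_loopPairing (isLoop_gradVariation hf hU hu hξ)
      (isLoop_fieldComp hX hu)).intervalIntegrable
  · refine (isLoop_loopPairing (isLoop_pi.2 fun s => IsLoop.sum _ fun i _ =>
      (isLoop_pi.1 (isLoop_grad hf hU hu) i).mul
        (isLoop_comp (contDiffOn_pderiv (hX i) hU s) hu)) hξ).intervalIntegrable

/-- The bracket of the Lie derivative of an operator is the Lie derivative of the bracket. -/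
theorem IsSkewOperator.functional_lieDensity_bracket (H : IsSkewOperator U g Γ) (hU : IsOpen U)
    (hX : ∀ i, ContDiffOn ℝ ∞ (fun u => X u i) U)
    (hg : ∀ u ∈ U, g' u = lieMetric X g u) (hΓ : ∀ u ∈ U, ∀ i j k, Γ' i j k u = lieConn X g Γ i j k u)
    {f h : (ℕ → Fin N → ℝ) → ℝ} (hf : IsLocalDensity U f) (hh : IsLocalDensity U h)
    (hu : IsField U u) :
    functional (lieDensity X (bracketDensity g Γ f h)) u =
      functional (bracketDensity g' Γ' f h) u +
      functional (bracketDensity g Γ (lieDensity X f) h) u +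
      functional (bracketDensity g Γ f (lieDensity X h)) u := by
  have hgf := isLoop_grad hf hU hu
  have hgh := isLoop_grad hh hU hu
  have hξ := isLoop_fieldComp hX hu
  have hXf := isLocalDensity_lieDensity hX hU hf
  have hXh := isLocalDensity_lieDensity hX hU hh
  have Af := H.isLoop_opField hu hgf
  have Ah := H.isLoop_opField hu hgh
  have hψ : ∀ {f : (ℕ → Fin N → ℝ) → ℝ}, IsLocalDensity U f →
      IsLoop (fun x s => ∑ i, grad f u x i * pderiv s (fun w => X w i) (u x)) := fun hf =>
    isLoop_pi.2 fun s => IsLoop.sum _ fun i _ =>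
      (isLoop_pi.1 (isLoop_grad hf hU hu) i).mul (isLoop_comp (contDiffOn_pderiv (hX i) hU s) hu)
  have Aψ := H.isLoop_opField hu (hψ hh)
  have hX1 : ∀ x i, jet (fun x => X (u x)) x 1 i =
      ∑ s, pderiv s (fun w => X w i) (u x) * jet u x 1 s := fun x i => by
    rw [jet_one]; exact (hasDerivAt_comp_field (hX i) hU hu x).deriv
  have hψ1 : ∀ x s, jet (fun x s => ∑ i, grad h u x i * pderiv s (fun w => X w i) (u x)) x 1 s =
      ∑ j, (jet (grad h u) x 1 j * pderiv s (fun w => X w j) (u x) + grad h u x j *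
        ∑ k, pderiv k (pderiv s (fun w => X w j)) (u x) * jet u x 1 k) := fun x s => by
    rw [jet_one]
    refine (HasDerivAt.fun_sum fun j _ => HasDerivAt.fun_mul (c := fun x => grad h u x j) ?_
      (hasDerivAt_comp_field (contDiffOn_pderiv (hX j) hU s) hU hu x)).deriv
    simpa [jet] using hgh.hasDerivAt_jet 0 j x
  -- The formula of `lie_operator_identity`, paired with the gradient of f and integrated.
  have key : functional (bracketDensity g' Γ' f h) u =
      loopPairing (grad f u) (opVariation g Γ u (fun x => X (u x)) (grad h u)) -
      loopPairing (fun x s => ∑ i, grad f u x i * pderiv s (fun w => X w i) (u x))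
        (opField g Γ u (grad h u)) -
      loopPairing (grad f u) (opField g Γ u
        (fun x s => ∑ i, grad h u x i * pderiv s (fun w => X w i) (u x))) := by
    have c1 := (isLoop_loopPairing hgf (H.isLoop_opVariation hU hu hξ hgh)).intervalIntegrable
    have c2 := (isLoop_loopPairing (hψ hf) Ah).intervalIntegrable
    have c3 := (isLoop_loopPairing hgf Aψ).intervalIntegrable
    rw [functional_bracketDensity g' Γ' f hh hU hu]
    unfold loopPairing
    rw [← intervalIntegral.integral_sub c1 c2, ← intervalIntegral.integral_sub (c1.sub c2) c3]
    refine intervalIntegral.integral_congr fun x _ => ?_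
    have e1 : ∑ s, (∑ i, grad f u x i * pderiv s (fun w => X w i) (u x)) *
        opField g Γ u (grad h u) x s = ∑ i, grad f u x i *
          ∑ s, pderiv s (fun w => X w i) (u x) * opField g Γ u (grad h u) x s := by
      simp only [Finset.mul_sum, Finset.sum_mul]
      rw [Finset.sum_comm]
      simp only [mul_assoc]
    simp only [e1]
    rw [← Finset.sum_sub_distrib, ← Finset.sum_sub_distrib]
    refine Finset.sum_congr rfl fun i _ => ?_
    rw [← mul_sub, ← mul_sub]
    congr 1
    simp only [opField, opVariation, hX1, hψ1, hg _ (hu.2.2 x), hΓ _ (hu.2.2 x), lieMetric, lieConn,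
      dirDeriv, Matrix.of_apply]
    exact lie_operator_identity (g (u x)) (fun i j s => pderiv s (fun w => g w i j) (u x))
      (fun i j k => Γ i j k (u x)) (fun i j k s => pderiv s (Γ i j k) (u x)) (X (u x))
      (fun i s => pderiv s (fun w => X w i) (u x))
      (fun j k s => pderiv k (pderiv s (fun w => X w j)) (u x)) (jet (grad h u) x 1) (grad h u x)
      (jet u x 1) i
  -- The second variations of f and h enter both sides in the directions X and A grad with the roles
  -- exchanged; symmetry of the Hessians identifies them.
  rw [functional_lieDensity, H.loopPairing_grad_bracketDensity hU hf hh hu hξ, key,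
    H.functional_bracketDensity_skew hU hf hXh hu, functional_bracketDensity g Γ _ hh hU hu,
    functional_bracketDensity g Γ _ hf hU hu, loopPairing_grad_lieDensity hX hU hf hu Ah,
    loopPairing_grad_lieDensity hX hU hh hu Af, loopPairing_gradVariation_symm hf hU hu Ah hξ,
    loopPairing_gradVariation_symm hh hU hu Af hξ, H.loopPairing_opField hU hu hgf (hψ hh)]
  ring

end

/-! ### Jacobi identities along a Lie derivative -/

/-- The cyclic sum `{{f, h}₂, l}₁ + {{h, l}₂, f}₁ + {{l, f}₂, h}₁`. -/
noncomputable def jacobiator (g₁ : (Fin N → ℝ) → Matrix (Fin N) (Fin N) ℝ)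
    (Γ₁ : Fin N → Fin N → Fin N → (Fin N → ℝ) → ℝ)
    (g₂ : (Fin N → ℝ) → Matrix (Fin N) (Fin N) ℝ)
    (Γ₂ : Fin N → Fin N → Fin N → (Fin N → ℝ) → ℝ) (f h l : (ℕ → Fin N → ℝ) → ℝ)
    (u : ℝ → Fin N → ℝ) : ℝ :=
  functional (bracketDensity g₁ Γ₁ (bracketDensity g₂ Γ₂ f h) l) u
    + functional (bracketDensity g₁ Γ₁ (bracketDensity g₂ Γ₂ h l) f) u
    + functional (bracketDensity g₁ Γ₁ (bracketDensity g₂ Γ₂ l f) h) u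

theorem functional_add {U : Set (Fin N → ℝ)} {u : ℝ → Fin N → ℝ} {f h : (ℕ → Fin N → ℝ) → ℝ}
    (hf : IsLocalDensity U f) (hh : IsLocalDensity U h) (c : ℝ) (hu : IsField U u) :
    functional (fun v => f v + c * h v) u = functional f u + c * functional h u := by
  simp only [functional]
  rw [intervalIntegral.integral_add (hf.isLoop hu).intervalIntegrable
    ((isLoop_const c).mul (hh.isLoop hu)).intervalIntegrable, intervalIntegral.integral_const_mul]

theorem bracketDensity_zero (f h : (ℕ → Fin N → ℝ) → ℝ) :
    bracketDensity (fun _ => 0) (fun _ _ _ _ => 0) f h = fun _ => 0 := by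
  funext v
  simp [bracketDensity]

theorem bracketDensity_pencil (g₁ : (Fin N → ℝ) → Matrix (Fin N) (Fin N) ℝ)
    (Γ₁ : Fin N → Fin N → Fin N → (Fin N → ℝ) → ℝ)
    (g₂ : (Fin N → ℝ) → Matrix (Fin N) (Fin N) ℝ)
    (Γ₂ : Fin N → Fin N → Fin N → (Fin N → ℝ) → ℝ) (c : ℝ) (f h : (ℕ → Fin N → ℝ) → ℝ) :
    bracketDensity (fun u => g₁ u + c • g₂ u) (fun i j k u => Γ₁ i j k u + c * Γ₂ i j k u) f h =
      fun v => bracketDensity g₁ Γ₁ f h v + c * bracketDensity g₂ Γ₂ f h v := by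
  funext v
  simp only [bracketDensity, Finset.mul_sum]
  rw [← Finset.sum_add_distrib]
  refine Finset.sum_congr rfl fun i _ => ?_
  rw [← Finset.sum_add_distrib]
  refine Finset.sum_congr rfl fun j _ => ?_
  simp only [Matrix.add_apply, Matrix.smul_apply, smul_eq_mul, add_mul, Finset.sum_add_distrib,
    mul_assoc, ← Finset.mul_sum]
  ring

section

variable {U : Set (Fin N → ℝ)} {u : ℝ → Fin N → ℝ} {X : (Fin N → ℝ) → Fin N → ℝ}
  {g g' g₁ g₁' g₂ g₂' : (Fin N → ℝ) → Matrix (Fin N) (Fin N) ℝ}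
  {Γ Γ' Γ₁ Γ₁' Γ₂ Γ₂' : Fin N → Fin N → Fin N → (Fin N → ℝ) → ℝ}
  {f h l : (ℕ → Fin N → ℝ) → ℝ}

theorem isSkewOperator_zero (U : Set (Fin N → ℝ)) :
    IsSkewOperator U (fun _ => 0) (fun _ _ _ _ => 0) where
  smooth_metric _ _ := contDiffOn_const
  smooth_conn _ _ _ := contDiffOn_const
  symm _ _ _ _ := rfl
  pderiv_metric _ _ _ _ _ := by simp [pderiv]

theorem pderiv_add_const_mul {a b : (Fin N → ℝ) → ℝ} {w : Fin N → ℝ}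
    (ha : DifferentiableAt ℝ a w) (hb : DifferentiableAt ℝ b w) (c : ℝ) (k : Fin N) :
    pderiv k (fun w => a w + c * b w) w = pderiv k a w + c * pderiv k b w := by
  simp only [pderiv]
  rw [fderiv_fun_add ha (hb.const_mul c), fderiv_const_mul hb]
  simp

theorem IsSkewOperator.pencil (H₁ : IsSkewOperator U g₁ Γ₁) (H₂ : IsSkewOperator U g₂ Γ₂)
    (hU : IsOpen U) (c : ℝ) :
    IsSkewOperator U (fun u => g₁ u + c • g₂ u) (fun i j k u => Γ₁ i j k u + c * Γ₂ i j k u) where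
  smooth_metric i j := (H₁.smooth_metric i j).add (contDiffOn_const.mul (H₂.smooth_metric i j))
  smooth_conn i j k := (H₁.smooth_conn i j k).add (contDiffOn_const.mul (H₂.smooth_conn i j k))
  symm u hu i j := by simp [H₁.symm u hu i j, H₂.symm u hu i j]
  pderiv_metric u hu i j k := by
    have h1 := ((H₁.smooth_metric i j).contDiffAt (hU.mem_nhds hu)).differentiableAt (by simp)
    have h2 := ((H₂.smooth_metric i j).contDiffAt (hU.mem_nhds hu)).differentiableAt (by simp)
    have := pderiv_add_const_mul h1 h2 c k
    rw [H₁.pderiv_metric u hu, H₂.pderiv_metric u hu] at this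
    simp only [Matrix.add_apply, Matrix.smul_apply, smul_eq_mul]
    rw [this]
    ring

/-- Linear relations between functionals are preserved by taking brackets. -/
theorem IsSkewOperator.sum_functional_bracketDensity {n : ℕ} (H : IsSkewOperator U g Γ)
    (hU : IsOpen U) (c : Fin n → ℝ) {F : Fin n → (ℕ → Fin N → ℝ) → ℝ}
    (hF : ∀ k, IsLocalDensity U (F k))
    (h0 : ∀ u, IsField U u → ∑ k, c k * functional (F k) u = 0) (hl : IsLocalDensity U l)
    (hu : IsField U u) : ∑ k, c k * functional (bracketDensity g Γ (F k) l) u = 0 := by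
  simp only [functional_bracketDensity g Γ _ hl hU hu]
  exact sum_loopPairing_grad_eq_zero _ c (fun k _ => hF k) hU h0 hu
    (H.isLoop_opField hu (isLoop_grad hl hU hu))

/-- Linear relations between functionals are preserved by the derivative along `X`. -/
theorem sum_functional_lieDensity {n : ℕ} (hU : IsOpen U)
    (hX : ∀ i, ContDiffOn ℝ ∞ (fun u => X u i) U) (c : Fin n → ℝ)
    {F : Fin n → (ℕ → Fin N → ℝ) → ℝ} (hF : ∀ k, IsLocalDensity U (F k))
    (h0 : ∀ u, IsField U u → ∑ k, c k * functional (F k) u = 0) (hu : IsField U u) :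
    ∑ k, c k * functional (lieDensity X (F k)) u = 0 := by
  simp only [functional_lieDensity]
  exact sum_loopPairing_grad_eq_zero _ c (fun k _ => hF k) hU h0 hu (isLoop_fieldComp hX hu)

/-- The Leibniz rule for the derivative of an iterated bracket along `X`. -/
theorem functional_lieDensity_bracket_bracket (hU : IsOpen U)
    (hX : ∀ i, ContDiffOn ℝ ∞ (fun u => X u i) U) (H₁ : IsSkewOperator U g₁ Γ₁)
    (H₂ : IsSkewOperator U g₂ Γ₂) (H₂' : IsSkewOperator U g₂' Γ₂')
    (hg₁ : ∀ u ∈ U, g₁' u = lieMetric X g₁ u)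
    (hΓ₁ : ∀ u ∈ U, ∀ i j k, Γ₁' i j k u = lieConn X g₁ Γ₁ i j k u)
    (hg₂ : ∀ u ∈ U, g₂' u = lieMetric X g₂ u)
    (hΓ₂ : ∀ u ∈ U, ∀ i j k, Γ₂' i j k u = lieConn X g₂ Γ₂ i j k u)
    (hf : IsLocalDensity U f) (hh : IsLocalDensity U h) (hl : IsLocalDensity U l)
    (hu : IsField U u) :
    functional (lieDensity X (bracketDensity g₁ Γ₁ (bracketDensity g₂ Γ₂ f h) l)) u =
      functional (bracketDensity g₁' Γ₁' (bracketDensity g₂ Γ₂ f h) l) u +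
      functional (bracketDensity g₁ Γ₁ (bracketDensity g₂' Γ₂' f h) l) u +
      functional (bracketDensity g₁ Γ₁ (bracketDensity g₂ Γ₂ (lieDensity X f) h) l) u +
      functional (bracketDensity g₁ Γ₁ (bracketDensity g₂ Γ₂ f (lieDensity X h)) l) u +
      functional (bracketDensity g₁ Γ₁ (bracketDensity g₂ Γ₂ f h) (lieDensity X l)) u := by
  have hXf := isLocalDensity_lieDensity hX hU hf
  have hXh := isLocalDensity_lieDensity hX hU hh
  have hfh := H₂.isLocalDensity_bracketDensity hU hf hh
  rw [H₁.functional_lieDensity_bracket hU hX hg₁ hΓ₁ hfh hl hu]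
  have := H₁.sum_functional_bracketDensity hU ![1, -1, -1, -1]
    (F := ![lieDensity X (bracketDensity g₂ Γ₂ f h), bracketDensity g₂' Γ₂' f h,
      bracketDensity g₂ Γ₂ (lieDensity X f) h, bracketDensity g₂ Γ₂ f (lieDensity X h)])
    (by
      simp only [Fin.forall_fin_succ, IsEmpty.forall_iff, and_true]
      exact ⟨isLocalDensity_lieDensity hX hU hfh, H₂'.isLocalDensity_bracketDensity hU hf hh,
        H₂.isLocalDensity_bracketDensity hU hXf hh, H₂.isLocalDensity_bracketDensity hU hf hXh⟩)
    (fun u hu => by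
      simp only [Fin.sum_univ_four, Matrix.cons_val]
      linarith [H₂.functional_lieDensity_bracket hU hX hg₂ hΓ₂ hf hh hu]) hl hu
  simp only [Fin.sum_univ_four, Matrix.cons_val] at this
  linarith

/-- The Leibniz rule for the derivative of a jacobiator along `X`. -/
theorem functional_lieDensity_jacobiator (hU : IsOpen U)
    (hX : ∀ i, ContDiffOn ℝ ∞ (fun u => X u i) U) (H₁ : IsSkewOperator U g₁ Γ₁)
    (H₂ : IsSkewOperator U g₂ Γ₂) (H₂' : IsSkewOperator U g₂' Γ₂')
    (hg₁ : ∀ u ∈ U, g₁' u = lieMetric X g₁ u)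
    (hΓ₁ : ∀ u ∈ U, ∀ i j k, Γ₁' i j k u = lieConn X g₁ Γ₁ i j k u)
    (hg₂ : ∀ u ∈ U, g₂' u = lieMetric X g₂ u)
    (hΓ₂ : ∀ u ∈ U, ∀ i j k, Γ₂' i j k u = lieConn X g₂ Γ₂ i j k u)
    (hf : IsLocalDensity U f) (hh : IsLocalDensity U h) (hl : IsLocalDensity U l)
    (hu : IsField U u) :
    functional (lieDensity X (bracketDensity g₁ Γ₁ (bracketDensity g₂ Γ₂ f h) l)) u +
      functional (lieDensity X (bracketDensity g₁ Γ₁ (bracketDensity g₂ Γ₂ h l) f)) u +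
      functional (lieDensity X (bracketDensity g₁ Γ₁ (bracketDensity g₂ Γ₂ l f) h)) u =
    jacobiator g₁' Γ₁' g₂ Γ₂ f h l u + jacobiator g₁ Γ₁ g₂' Γ₂' f h l u +
      jacobiator g₁ Γ₁ g₂ Γ₂ (lieDensity X f) h l u +
      jacobiator g₁ Γ₁ g₂ Γ₂ f (lieDensity X h) l u +
      jacobiator g₁ Γ₁ g₂ Γ₂ f h (lieDensity X l) u := by
  rw [functional_lieDensity_bracket_bracket hU hX H₁ H₂ H₂' hg₁ hΓ₁ hg₂ hΓ₂ hf hh hl hu,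
    functional_lieDensity_bracket_bracket hU hX H₁ H₂ H₂' hg₁ hΓ₁ hg₂ hΓ₂ hh hl hf hu,
    functional_lieDensity_bracket_bracket hU hX H₁ H₂ H₂' hg₁ hΓ₁ hg₂ hΓ₂ hl hf hh hu]
  simp only [jacobiator]
  ring

theorem jacobiator_zero_left (f h l : (ℕ → Fin N → ℝ) → ℝ) (u : ℝ → Fin N → ℝ) :
    jacobiator (fun _ => 0) (fun _ _ _ _ => 0) g Γ f h l u = 0 := by
  simp [jacobiator, bracketDensity_zero, functional]

theorem IsSkewOperator.jacobiator_zero_right (H : IsSkewOperator U g Γ) (hU : IsOpen U)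
    (hf : IsLocalDensity U f) (hh : IsLocalDensity U h) (hl : IsLocalDensity U l)
    (hu : IsField U u) :
    jacobiator g Γ (fun _ => 0) (fun _ _ _ _ => 0) f h l u = 0 := by
  have key : ∀ {l : (ℕ → Fin N → ℝ) → ℝ}, IsLocalDensity U l →
      functional (bracketDensity g Γ (fun _ => 0) l) u = 0 := fun {l} hl => by
    simpa using H.sum_functional_bracketDensity hU ![1] (F := ![fun _ => 0])
      (by simpa using isLocalDensity_const 0) (fun u _ => by simp [functional]) hl hu
  simp only [jacobiator, bracketDensity_zero, key hf, key hh, key hl, add_zero]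

/-! ### The Jacobi identities of the pencil spanned by an operator and its Lie derivative. -/

section Pencil

variable (hU : IsOpen U) (hX : ∀ i, ContDiffOn ℝ ∞ (fun u => X u i) U)
  (H : IsSkewOperator U g Γ) (H' : IsSkewOperator U g' Γ')
  (hg : ∀ u ∈ U, g' u = lieMetric X g u)
  (hΓ : ∀ u ∈ U, ∀ i j k, Γ' i j k u = lieConn X g Γ i j k u)
  (hJ : ∀ f h l, IsLocalDensity U f → IsLocalDensity U h → IsLocalDensity U l →
    ∀ u, IsField U u → jacobiator g Γ g Γ f h l u = 0)

include hU hX H H' hg hΓ hJ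

/-- Apply X to the Jacobi identity of g. The terms in which X falls on an argument f, h or l are
again jacobiators of g and vanish; those in which it falls on one of the two brackets are the claim.
-/
theorem jacobiator_mixed (hf : IsLocalDensity U f) (hh : IsLocalDensity U h)
    (hl : IsLocalDensity U l) (hu : IsField U u) :
    jacobiator g' Γ' g Γ f h l u + jacobiator g Γ g' Γ' f h l u = 0 := by
  have hXf := isLocalDensity_lieDensity hX hU hf
  have hXh := isLocalDensity_lieDensity hX hU hh
  have hXl := isLocalDensity_lieDensity hX hU hl
  have hB : ∀ {f h l}, IsLocalDensity U f → IsLocalDensity U h → IsLocalDensity U l →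
      IsLocalDensity U (bracketDensity g Γ (bracketDensity g Γ f h) l) := fun hf hh hl =>
    H.isLocalDensity_bracketDensity hU (H.isLocalDensity_bracketDensity hU hf hh) hl
  have h0 := sum_functional_lieDensity hU hX ![1, 1, 1]
    (F := ![bracketDensity g Γ (bracketDensity g Γ f h) l,
      bracketDensity g Γ (bracketDensity g Γ h l) f, bracketDensity g Γ (bracketDensity g Γ l f) h])
    (by
      simp only [Fin.forall_fin_succ, IsEmpty.forall_iff, and_true]
      exact ⟨hB hf hh hl, hB hh hl hf, hB hl hf hh⟩)
    (fun u hu => by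
      simp only [Fin.sum_univ_three, Matrix.cons_val, one_mul]
      exact hJ f h l hf hh hl u hu) hu
  simp only [Fin.sum_univ_three, Matrix.cons_val, one_mul] at h0
  rw [functional_lieDensity_jacobiator hU hX H H H' hg hΓ hg hΓ hf hh hl hu,
    hJ _ _ _ hXf hh hl u hu, hJ _ _ _ hf hXh hl u hu, hJ _ _ _ hf hh hXl u hu] at h0
  linarith

variable (hg0 : ∀ u ∈ U, lieMetric X g' u = 0) (hΓ0 : ∀ u ∈ U, ∀ i j k, lieConn X g' Γ' i j k u = 0)

include hg0 hΓ0

/-- Apply X to the mixed identity. Each of its two cyclic sums contributes one jacobiator of g'; the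
terms with the Lie derivative of g' vanish, and those with X on an argument vanish by the mixed
identity. Hence twice the jacobiator of g' is zero. -/
theorem jacobiator_lie (hf : IsLocalDensity U f) (hh : IsLocalDensity U h)
    (hl : IsLocalDensity U l) (hu : IsField U u) : jacobiator g' Γ' g' Γ' f h l u = 0 := by
  have hXf := isLocalDensity_lieDensity hX hU hf
  have hXh := isLocalDensity_lieDensity hX hU hh
  have hXl := isLocalDensity_lieDensity hX hU hl
  have hB : ∀ {f h l}, IsLocalDensity U f → IsLocalDensity U h → IsLocalDensity U l →
      IsLocalDensity U (bracketDensity g' Γ' (bracketDensity g Γ f h) l) := fun hf hh hl =>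
    H'.isLocalDensity_bracketDensity hU (H.isLocalDensity_bracketDensity hU hf hh) hl
  have hB' : ∀ {f h l}, IsLocalDensity U f → IsLocalDensity U h → IsLocalDensity U l →
      IsLocalDensity U (bracketDensity g Γ (bracketDensity g' Γ' f h) l) := fun hf hh hl =>
    H.isLocalDensity_bracketDensity hU (H'.isLocalDensity_bracketDensity hU hf hh) hl
  have hM := fun {f h l} hf hh hl {u} hu =>
    jacobiator_mixed (f := f) (h := h) (l := l) (u := u) hU hX H H' hg hΓ hJ hf hh hl hu
  have h0 := sum_functional_lieDensity hU hX ![1, 1, 1, 1, 1, 1]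
    (F := ![bracketDensity g' Γ' (bracketDensity g Γ f h) l,
      bracketDensity g' Γ' (bracketDensity g Γ h l) f,
      bracketDensity g' Γ' (bracketDensity g Γ l f) h,
      bracketDensity g Γ (bracketDensity g' Γ' f h) l,
      bracketDensity g Γ (bracketDensity g' Γ' h l) f,
      bracketDensity g Γ (bracketDensity g' Γ' l f) h])
    (by
      simp only [Fin.forall_fin_succ, IsEmpty.forall_iff, and_true]
      exact ⟨hB hf hh hl, hB hh hl hf, hB hl hf hh, hB' hf hh hl, hB' hh hl hf, hB' hl hf hh⟩)
    (fun u hu => by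
      have := hM hf hh hl hu
      simp only [Fin.sum_univ_six, Matrix.cons_val, one_mul]
      simp only [jacobiator] at this
      linarith) hu
  simp only [Fin.sum_univ_six, Matrix.cons_val, one_mul] at h0
  have Z := isSkewOperator_zero U
  have hg0' : ∀ u ∈ U, (0 : Matrix (Fin N) (Fin N) ℝ) = lieMetric X g' u := fun u hu =>
    (hg0 u hu).symm
  have hΓ0' : ∀ u ∈ U, ∀ i j k, (0 : ℝ) = lieConn X g' Γ' i j k u := fun u hu i j k =>
    (hΓ0 u hu i j k).symm
  -- The vanishing Lie derivative of g' is entered as the zero operator, so that the Leibniz rule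
  -- applies without a special case.
  have e1 := functional_lieDensity_jacobiator (g₁' := fun _ => 0) (Γ₁' := fun _ _ _ _ => 0)
    hU hX H' H H' hg0' hΓ0' hg hΓ hf hh hl hu
  have e2 := functional_lieDensity_jacobiator (g₂' := fun _ => 0) (Γ₂' := fun _ _ _ _ => 0)
    hU hX H H' Z hg hΓ hg0' hΓ0' hf hh hl hu
  rw [jacobiator_zero_left] at e1
  rw [H.jacobiator_zero_right hU hf hh hl hu] at e2
  linarith [hM hXf hh hl hu, hM hf hXh hl hu, hM hf hh hXl hu]

/-- If the Lie derivative of a Hamiltonian structure along `X` is an operator of hydrodynamic type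
whose own Lie derivative vanishes, then it is a Hamiltonian structure, compatible with the first. -/
theorem isHamiltonianStructure_lie :
    IsHamiltonianStructure U g' Γ' ∧ ∀ c : ℝ, IsHamiltonianStructure U (fun u => g u + c • g' u)
      (fun i j k u => Γ i j k u + c * Γ' i j k u) := by
  refine ⟨⟨H'.smooth_metric, H'.smooth_conn, fun f h hf hh u hu =>
    H'.functional_bracketDensity_skew hU hf hh hu, fun f h l hf hh hl u hu =>
    jacobiator_lie hU hX H H' hg hΓ hJ hg0 hΓ0 hf hh hl hu⟩, fun c => ?_⟩
  have Hc := H.pencil H' hU c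
  refine ⟨Hc.smooth_metric, Hc.smooth_conn, fun f h hf hh u hu =>
    Hc.functional_bracketDensity_skew hU hf hh hu, fun f h l hf hh hl u hu => ?_⟩
  -- Bilinear expansion in c. The inner bracket of the pencil may be split under the outer one
  -- because linear relations between functionals are preserved by brackets.
  have key : ∀ {f h l}, IsLocalDensity U f → IsLocalDensity U h → IsLocalDensity U l →
      functional (bracketDensity (fun u => g u + c • g' u)
        (fun i j k u => Γ i j k u + c * Γ' i j k u) (bracketDensity (fun u => g u + c • g' u)
        (fun i j k u => Γ i j k u + c * Γ' i j k u) f h) l) u =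
      functional (bracketDensity g Γ (bracketDensity g Γ f h) l) u +
      c * functional (bracketDensity g Γ (bracketDensity g' Γ' f h) l) u +
      c * functional (bracketDensity g' Γ' (bracketDensity g Γ f h) l) u +
      c ^ 2 * functional (bracketDensity g' Γ' (bracketDensity g' Γ' f h) l) u := by
    intro f h l hf hh hl
    have hb := H.isLocalDensity_bracketDensity hU hf hh
    have hb' := H'.isLocalDensity_bracketDensity hU hf hh
    have hbc := Hc.isLocalDensity_bracketDensity hU hf hh
    have hloc : ∀ k, IsLocalDensity U (![bracketDensity (fun u => g u + c • g' u)
        (fun i j k u => Γ i j k u + c * Γ' i j k u) f h, bracketDensity g Γ f h,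
        bracketDensity g' Γ' f h] k) := by
      simp only [Fin.forall_fin_succ, IsEmpty.forall_iff, and_true]
      exact ⟨hbc, hb, hb'⟩
    have h0 : ∀ u, IsField U u → ∑ k, (![1, -1, -c] : Fin 3 → ℝ) k *
        functional (![bracketDensity (fun u => g u + c • g' u)
        (fun i j k u => Γ i j k u + c * Γ' i j k u) f h, bracketDensity g Γ f h,
        bracketDensity g' Γ' f h] k) u = 0 := fun u hu => by
      simp only [Fin.sum_univ_three, Matrix.cons_val]
      rw [bracketDensity_pencil, functional_add hb hb' c hu]
      ring
    have k1 := H.sum_functional_bracketDensity hU _ hloc h0 hl hu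
    have k2 := H'.sum_functional_bracketDensity hU _ hloc h0 hl hu
    simp only [Fin.sum_univ_three, Matrix.cons_val] at k1 k2
    rw [bracketDensity_pencil _ _ _ _ _ _ l,
      functional_add (H.isLocalDensity_bracketDensity hU hbc hl)
        (H'.isLocalDensity_bracketDensity hU hbc hl) c hu]
    linear_combination k1 + c * k2
  rw [key hf hh hl, key hh hl hf, key hl hf hh]
  have j1 := hJ f h l hf hh hl u hu
  have j2 := jacobiator_mixed hU hX H H' hg hΓ hJ hf hh hl hu
  have j3 := jacobiator_lie hU hX H H' hg hΓ hJ hg0 hΓ0 hf hh hl hu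
  simp only [jacobiator] at j1 j2 j3
  linear_combination j1 + c * j2 + c ^ 2 * j3

end Pencil

end

/-! ### Partial derivatives -/

section Calculus

variable {U : Set (Fin N → ℝ)} {u : Fin N → ℝ} {a b : (Fin N → ℝ) → ℝ}
  {X : (Fin N → ℝ) → Fin N → ℝ}

theorem differentiableAt_of_mem (ha : ContDiffOn ℝ ∞ a U) (hU : IsOpen U) (hu : u ∈ U) :
    DifferentiableAt ℝ a u :=
  (ha.contDiffAt (hU.mem_nhds hu)).differentiableAt (by simp)

theorem pderiv_congr (hU : IsOpen U) (hu : u ∈ U) (e : ∀ w ∈ U, a w = b w) (k : Fin N) :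
    pderiv k a u = pderiv k b u := by
  have : a =ᶠ[𝓝 u] b := by filter_upwards [hU.mem_nhds hu] with w hw using e w hw
  rw [pderiv, pderiv, this.fderiv_eq]

theorem dirDeriv_congr (hU : IsOpen U) (hu : u ∈ U) (e : ∀ w ∈ U, a w = b w) :
    dirDeriv X a u = dirDeriv X b u := by
  simp only [dirDeriv, pderiv_congr hU hu e]

theorem pderiv_const (c : ℝ) (k : Fin N) : pderiv k (fun _ => c) u = 0 := by simp [pderiv]

theorem pderiv_mul (ha : DifferentiableAt ℝ a u) (hb : DifferentiableAt ℝ b u) (k : Fin N) :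
    pderiv k (fun w => a w * b w) u = pderiv k a u * b u + a u * pderiv k b u := by
  simp only [pderiv]
  rw [fderiv_fun_mul ha hb]
  simp
  ring

theorem pderiv_add (ha : DifferentiableAt ℝ a u) (hb : DifferentiableAt ℝ b u) (k : Fin N) :
    pderiv k (fun w => a w + b w) u = pderiv k a u + pderiv k b u := by
  simp only [pderiv]
  rw [fderiv_fun_add ha hb]
  simp

theorem pderiv_sub (ha : DifferentiableAt ℝ a u) (hb : DifferentiableAt ℝ b u) (k : Fin N) :
    pderiv k (fun w => a w - b w) u = pderiv k a u - pderiv k b u := by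
  simp only [pderiv]
  rw [fderiv_fun_sub ha hb]
  simp

theorem pderiv_sum {ι : Type*} (s : Finset ι) {a : ι → (Fin N → ℝ) → ℝ}
    (ha : ∀ i ∈ s, DifferentiableAt ℝ (a i) u) (k : Fin N) :
    pderiv k (fun w => ∑ i ∈ s, a i w) u = ∑ i ∈ s, pderiv k (a i) u := by
  simp only [pderiv]
  rw [fderiv_fun_sum ha]
  simp

theorem dirDeriv_const (c : ℝ) : dirDeriv X (fun _ => c) u = 0 := by
  simp [dirDeriv, pderiv_const]

theorem dirDeriv_mul (ha : DifferentiableAt ℝ a u) (hb : DifferentiableAt ℝ b u) :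
    dirDeriv X (fun w => a w * b w) u = dirDeriv X a u * b u + a u * dirDeriv X b u := by
  simp only [dirDeriv, pderiv_mul ha hb, mul_add, Finset.sum_add_distrib, Finset.sum_mul,
    Finset.mul_sum]
  congr 1 <;> exact Finset.sum_congr rfl fun k _ => by ring

theorem dirDeriv_add (ha : DifferentiableAt ℝ a u) (hb : DifferentiableAt ℝ b u) :
    dirDeriv X (fun w => a w + b w) u = dirDeriv X a u + dirDeriv X b u := by
  simp only [dirDeriv, pderiv_add ha hb, mul_add, Finset.sum_add_distrib]

theorem dirDeriv_sum {ι : Type*} (s : Finset ι) {a : ι → (Fin N → ℝ) → ℝ}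
    (ha : ∀ i ∈ s, DifferentiableAt ℝ (a i) u) :
    dirDeriv X (fun w => ∑ i ∈ s, a i w) u = ∑ i ∈ s, dirDeriv X (a i) u := by
  simp only [dirDeriv, pderiv_sum s ha, Finset.mul_sum]
  exact Finset.sum_comm

theorem pderiv_comm (ha : ContDiffOn ℝ ∞ a U) (hU : IsOpen U) (hu : u ∈ U) (i j : Fin N) :
    pderiv i (pderiv j a) u = pderiv j (pderiv i a) u := by
  have hd : DifferentiableAt ℝ (fderiv ℝ a) u :=
    ((ha.fderiv_of_isOpen (m := ∞) hU (by simp)).contDiffAt (hU.mem_nhds hu)).differentiableAt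
      (by simp)
  have e : ∀ i j, pderiv i (pderiv j a) u =
      fderiv ℝ (fderiv ℝ a) u (Pi.single i 1) (Pi.single j 1) := fun i j => by
    have : pderiv j a = fun w => fderiv ℝ a w (Pi.single j 1) := rfl
    rw [pderiv, this, fderiv_clm_apply hd (by fun_prop)]
    simp
  rw [e, e, ((ha.contDiffAt (hU.mem_nhds hu)).isSymmSndFDerivAt
    (by simpa using two_le_infty)).eq]

theorem contDiffOn_dirDeriv (hX : ∀ i, ContDiffOn ℝ ∞ (fun u => X u i) U) (hU : IsOpen U)
    (ha : ContDiffOn ℝ ∞ a U) : ContDiffOn ℝ ∞ (dirDeriv X a) U :=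
  ContDiffOn.sum fun k _ => (hX k).mul (contDiffOn_pderiv ha hU k)

/-- The commutator [X, ∂_i] = -(∂_i X^s) ∂_s. All first-order correction terms in the Lie
derivatives below originate here. -/
theorem dirDeriv_pderiv (hX : ∀ i, ContDiffOn ℝ ∞ (fun u => X u i) U) (hU : IsOpen U)
    (ha : ContDiffOn ℝ ∞ a U) (hu : u ∈ U) (i : Fin N) :
    dirDeriv X (pderiv i a) u =
      pderiv i (dirDeriv X a) u - ∑ s, pderiv i (fun w => X w s) u * pderiv s a u := by
  have h1 := fun k => differentiableAt_of_mem (hX k) hU hu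
  have h2 := fun k => differentiableAt_of_mem (contDiffOn_pderiv ha hU k) hU hu
  have e : pderiv i (dirDeriv X a) u =
      ∑ k, (pderiv i (fun w => X w k) u * pderiv k a u + X u k * pderiv i (pderiv k a) u) := by
    have : dirDeriv X a = fun w => ∑ k, X w k * pderiv k a w := rfl
    rw [this, pderiv_sum _ fun k _ => (h1 k).fun_mul (h2 k)]
    exact Finset.sum_congr rfl fun k _ => pderiv_mul (h1 k) (h2 k) i
  rw [e, Finset.sum_add_distrib, add_sub_cancel_left]
  exact Finset.sum_congr rfl fun k _ => by rw [pderiv_comm ha hU hu]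

end Calculus

/-! ### Inverse matrices and the contravariant Levi-Civita connection -/

section LeviCivita

variable {U : Set (Fin N → ℝ)} {u : Fin N → ℝ} {g : (Fin N → ℝ) → Matrix (Fin N) (Fin N) ℝ}
  {Γ : Fin N → Fin N → Fin N → (Fin N → ℝ) → ℝ}

theorem contDiffOn_det {n : Type*} [Fintype n] [DecidableEq n] {A : (Fin N → ℝ) → Matrix n n ℝ}
    (hA : ∀ i j, ContDiffOn ℝ ∞ (fun u => A u i j) U) : ContDiffOn ℝ ∞ (fun u => (A u).det) U := by
  simp only [Matrix.det_apply]
  exact ContDiffOn.sum fun σ _ => (contDiffOn_prod fun i _ => hA _ _).const_smul _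

/-- Cramer's rule: the entries of the inverse are cofactors divided by the non-vanishing
determinant. -/
theorem contDiffOn_inv {n : Type*} [Fintype n] [DecidableEq n] {A : (Fin N → ℝ) → Matrix n n ℝ}
    (hA : ∀ i j, ContDiffOn ℝ ∞ (fun u => A u i j) U) (hdet : ∀ u ∈ U, (A u).det ≠ 0) (i j : n) :
    ContDiffOn ℝ ∞ (fun u => (A u)⁻¹ i j) U := by
  simp only [Matrix.inv_def, Ring.inverse_eq_inv', Matrix.smul_apply, smul_eq_mul]
  refine ((contDiffOn_det hA).inv hdet).mul ?_
  simp only [Matrix.adjugate_apply]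
  refine contDiffOn_det fun k l => ?_
  by_cases hk : k = j
  · subst hk
    simpa using contDiffOn_const
  · simpa [Matrix.updateRow_ne hk] using hA k l

/-- The contravariant coefficients of the metric connection are determined by compatibility with the
metric and the vanishing of the torsion. -/
theorem contraChristoffel_eq (hU : IsOpen U) (hs : ∀ i j, ContDiffOn ℝ ∞ (fun u => g u i j) U)
    (hsymm : ∀ u ∈ U, ∀ i j, g u i j = g u j i) (hdet : ∀ u ∈ U, (g u).det ≠ 0) (hu : u ∈ U)
    (hΓ : ∀ i j k, pderiv k (fun w => g w i j) u = Γ i j k u + Γ j i k u)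
    (hT : ∀ i j k, ∑ s, g u i s * Γ j k s u = ∑ s, g u j s * Γ i k s u) (i j k : Fin N) :
    contraChristoffel g i j k u = Γ i j k u := by
  have hunit : ∀ w ∈ U, IsUnit (g w).det := fun w hw => (hdet w hw).isUnit
  set P : Fin N → Fin N → Fin N → ℝ := fun s l k => pderiv s (fun w => (g w)⁻¹ l k) u with hP
  -- Differentiation of g g⁻¹ = 1, with the derivative of g expressed through Γ.
  have h1 : ∀ s j k, ∑ l, g u j l * P s l k =
      -∑ l, (Γ j l s u + Γ l j s u) * (g u)⁻¹ l k := by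
    intro s j k
    have e : pderiv s (fun w => ∑ l, g w j l * (g w)⁻¹ l k) u = 0 := by
      rw [pderiv_congr hU hu (b := fun _ => (1 : Matrix (Fin N) (Fin N) ℝ) j k), pderiv_const]
      intro w hw
      rw [← Matrix.mul_nonsing_inv _ (hunit w hw), Matrix.mul_apply]
    have d1 := fun l => differentiableAt_of_mem (hs j l) hU hu
    have d2 := fun l => differentiableAt_of_mem (contDiffOn_inv hs hdet l k) hU hu
    rw [pderiv_sum _ fun l _ => (d1 l).fun_mul (d2 l)] at e
    simp only [pderiv_mul (d1 _) (d2 _), hΓ, Finset.sum_add_distrib] at e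
    simp only [hP]
    linarith
  have h2 : ∀ s j m, ∑ k, g u m k * ∑ l, g u j l * P s l k = -(Γ j m s u + Γ m j s u) := by
    intro s j m
    simp only [h1, mul_neg, Finset.sum_neg_distrib, Finset.mul_sum]
    rw [Finset.sum_comm]
    have : ∀ l, ∑ k, g u m k * ((Γ j l s u + Γ l j s u) * (g u)⁻¹ l k) =
        (Γ j l s u + Γ l j s u) * (1 : Matrix (Fin N) (Fin N) ℝ) l m := fun l => by
      rw [← Matrix.nonsing_inv_mul _ (hunit u hu), Matrix.mul_apply, Finset.mul_sum]
      exact Finset.sum_congr rfl fun k _ => by rw [hsymm u hu m k]; ring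
    simp [this, Matrix.one_apply]
  have h3 : ∀ m, ∑ k, g u m k * contraChristoffel g i j k u = ∑ k, g u m k * Γ i j k u := by
    intro m
    -- The Christoffel formula with all indices raised; it then involves g⁻¹ only through the
    -- contractions computed in `h2`.
    have e : ∑ k, g u m k * contraChristoffel g i j k u =
        -(1 / 2) * (∑ s, g u i s * ∑ k, g u m k * ∑ l, g u j l * P s l k +
          ∑ k, g u m k * ∑ s, g u i s * ∑ l, g u j l * P k l s -
          ∑ l, g u j l * ∑ k, g u m k * ∑ s, g u i s * P l s k) := by
      have c1 : ∑ s, g u i s * ∑ k, g u m k * ∑ l, g u j l * P s l k =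
          ∑ k, ∑ s, ∑ l, g u m k * g u i s * g u j l * P s l k := by
        simp only [Finset.mul_sum]
        rw [Finset.sum_comm]
        exact Finset.sum_congr rfl fun k _ => Finset.sum_congr rfl fun s _ =>
          Finset.sum_congr rfl fun l _ => by ring
      have c2 : ∑ k, g u m k * ∑ s, g u i s * ∑ l, g u j l * P k l s =
          ∑ k, ∑ s, ∑ l, g u m k * g u i s * g u j l * P k l s := by
        simp only [Finset.mul_sum]
        exact Finset.sum_congr rfl fun k _ => Finset.sum_congr rfl fun s _ =>
          Finset.sum_congr rfl fun l _ => by ring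
      have c3 : ∑ l, g u j l * ∑ k, g u m k * ∑ s, g u i s * P l s k =
          ∑ k, ∑ s, ∑ l, g u m k * g u i s * g u j l * P l s k := by
        simp only [Finset.mul_sum]
        rw [Finset.sum_comm]
        refine Finset.sum_congr rfl fun k _ => ?_
        rw [Finset.sum_comm]
        exact Finset.sum_congr rfl fun s _ => Finset.sum_congr rfl fun l _ => by ring
      rw [c1, c2, c3, ← Finset.sum_add_distrib, ← Finset.sum_sub_distrib, Finset.mul_sum]
      refine Finset.sum_congr rfl fun k _ => ?_
      rw [← Finset.sum_add_distrib, ← Finset.sum_sub_distrib, Finset.mul_sum, contraChristoffel,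
        mul_neg, Finset.mul_sum, ← Finset.sum_neg_distrib]
      refine Finset.sum_congr rfl fun s _ => ?_
      rw [← Finset.sum_add_distrib, ← Finset.sum_sub_distrib, christoffel]
      simp only [Finset.mul_sum]
      rw [← Finset.sum_neg_distrib]
      exact Finset.sum_congr rfl fun l _ => by simp only [hP]; ring
    rw [e]
    simp only [h2, mul_neg, mul_add, Finset.sum_neg_distrib, Finset.sum_add_distrib]
    -- Of the six terms, the torsion identities cancel four in pairs and equate the remaining two,
    -- which absorbs the factor 1/2.
    linarith [hT i j m, hT m j i, hT i m j]
  have h4 : ((g u).mulVec fun k => contraChristoffel g i j k u) =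
      (g u).mulVec fun k => Γ i j k u := funext h3
  have h5 := congrArg ((g u)⁻¹.mulVec) h4
  rw [Matrix.mulVec_mulVec, Matrix.mulVec_mulVec, Matrix.nonsing_inv_mul _ (hunit u hu),
    Matrix.one_mulVec, Matrix.one_mulVec] at h5
  exact congrFun h5 k

end LeviCivita

/-! ### Lie derivatives of tensors and of connections -/

section Lie

variable {U : Set (Fin N → ℝ)} {u : Fin N → ℝ} {X : (Fin N → ℝ) → Fin N → ℝ}
  {g : (Fin N → ℝ) → Matrix (Fin N) (Fin N) ℝ} {Γ : Fin N → Fin N → Fin N → (Fin N → ℝ) → ℝ}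
  {φ ψ : (Fin N → ℝ) → ℝ}

/-- Product rule for X(g^{ij} φ_i ψ_j). Moving X past ∂_i and ∂_j leaves d(Xφ) and d(Xψ), and the
two commutators supply the terms with ∂X in the component formula. -/
theorem isLieDerivative_lieMetric (hU : IsOpen U) (hX : ∀ i, ContDiffOn ℝ ∞ (fun u => X u i) U)
    (hg : ∀ i j, ContDiffOn ℝ ∞ (fun u => g u i j) U) :
    IsLieDerivative U X g (lieMetric X g) := by
  intro φ ψ hφ hψ u hu
  have d1 := fun i j => differentiableAt_of_mem (hg i j) hU hu
  have d2 := fun i => differentiableAt_of_mem (contDiffOn_pderiv hφ hU i) hU hu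
  have d3 := fun i => differentiableAt_of_mem (contDiffOn_pderiv hψ hU i) hU hu
  have e : dirDeriv X (pairing g φ ψ) u = ∑ i, ∑ j,
      ((dirDeriv X (fun w => g w i j) u * pderiv i φ u + g u i j * dirDeriv X (pderiv i φ) u) *
        pderiv j ψ u + g u i j * pderiv i φ u * dirDeriv X (pderiv j ψ) u) := by
    have : pairing g φ ψ = fun w => ∑ i, ∑ j, g w i j * pderiv i φ w * pderiv j ψ w := rfl
    rw [this, dirDeriv_sum _ fun i _ => DifferentiableAt.fun_sum fun j _ =>
      ((d1 i j).fun_mul (d2 i)).fun_mul (d3 j)]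
    refine Finset.sum_congr rfl fun i _ => ?_
    rw [dirDeriv_sum _ fun j _ => ((d1 i j).fun_mul (d2 i)).fun_mul (d3 j)]
    refine Finset.sum_congr rfl fun j _ => ?_
    rw [dirDeriv_mul ((d1 i j).fun_mul (d2 i)) (d3 j), dirDeriv_mul (d1 i j) (d2 i)]
  rw [e]
  simp only [dirDeriv_pderiv hX hU hφ hu, dirDeriv_pderiv hX hU hψ hu, pairing, lieMetric,
    Matrix.of_apply]
  have s1 : ∑ i, ∑ j, g u i j * (∑ s, pderiv i (fun w => X w s) u * pderiv s φ u) * pderiv j ψ u =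
      ∑ i, ∑ j, (∑ k, pderiv k (fun w => X w i) u * g u k j) * pderiv i φ u * pderiv j ψ u := by
    simp only [Finset.mul_sum, Finset.sum_mul]
    rw [Finset.sum_comm, Finset.sum_comm (γ := Fin N) (s := Finset.univ) (t := Finset.univ)
      (f := fun i j => ∑ k, pderiv k (fun w => X w i) u * g u k j * pderiv i φ u * pderiv j ψ u)]
    refine Finset.sum_congr rfl fun j _ => ?_
    rw [Finset.sum_comm]
    exact Finset.sum_congr rfl fun i _ => Finset.sum_congr rfl fun k _ => by ring
  have s2 : ∑ i, ∑ j, g u i j * pderiv i φ u * (∑ s, pderiv j (fun w => X w s) u * pderiv s ψ u) =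
      ∑ i, ∑ j, (∑ k, pderiv k (fun w => X w j) u * g u i k) * pderiv i φ u * pderiv j ψ u := by
    simp only [Finset.mul_sum, Finset.sum_mul]
    refine Finset.sum_congr rfl fun i _ => ?_
    rw [Finset.sum_comm]
    exact Finset.sum_congr rfl fun j _ => Finset.sum_congr rfl fun k _ => by ring
  simp only [mul_sub, sub_mul, add_mul, Finset.sum_add_distrib, Finset.sum_sub_distrib, s1, s2]
  ring

/-- The function `φ` is affine along `X` on `U`: its derivative along `X` is a constant. -/
def HasConstDeriv (U : Set (Fin N → ℝ)) (X : (Fin N → ℝ) → Fin N → ℝ) (φ : (Fin N → ℝ) → ℝ)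
    (c : ℝ) : Prop :=
  ContDiffOn ℝ ∞ φ U ∧ ∀ u ∈ U, dirDeriv X φ u = c

theorem HasConstDeriv.pderiv_dirDeriv {c : ℝ} (hφ : HasConstDeriv U X φ c) (hU : IsOpen U)
    (hu : u ∈ U) (k : Fin N) : pderiv k (dirDeriv X φ) u = 0 := by
  rw [pderiv_congr hU hu (b := fun _ => c) hφ.2, pderiv_const]

/-- If Xφ and Xψ are constant, then d(Xφ) = d(Xψ) = 0 and the Lie derivative acts on the tensor
alone. -/
theorem dirDeriv_pairing {c d : ℝ} (hU : IsOpen U) (hX : ∀ i, ContDiffOn ℝ ∞ (fun u => X u i) U)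
    (hg : ∀ i j, ContDiffOn ℝ ∞ (fun u => g u i j) U) (hφ : HasConstDeriv U X φ c)
    (hψ : HasConstDeriv U X ψ d) (hu : u ∈ U) :
    dirDeriv X (pairing g φ ψ) u = pairing (lieMetric X g) φ ψ u := by
  rw [isLieDerivative_lieMetric hU hX hg φ ψ hφ.1 hψ.1 u hu]
  simp [pairing, hφ.pderiv_dirDeriv hU hu, hψ.pderiv_dirDeriv hU hu]

/-- The components of the one-form `∇ dψ (grad φ, ·)`. -/
noncomputable def connForm (g : (Fin N → ℝ) → Matrix (Fin N) (Fin N) ℝ)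
    (Γ : Fin N → Fin N → Fin N → (Fin N → ℝ) → ℝ) (φ ψ : (Fin N → ℝ) → ℝ) (k : Fin N)
    (u : Fin N → ℝ) : ℝ :=
  ∑ i, ∑ j, (Γ i j k u * (pderiv i φ u * pderiv j ψ u) +
    g u i j * (pderiv i φ u * pderiv k (pderiv j ψ) u))

/-- The index bookkeeping behind `lie_connForm`: a i s stands for ∂_s X^i, c j s for ∂_k ∂_s X^j,
and ψ₂ for the second derivatives of ψ. -/
theorem lie_connForm_identity (g : Fin N → Fin N → ℝ) (dg : Fin N → Fin N → ℝ)
    (Γ : Fin N → Fin N → Fin N → ℝ) (dΓ : Fin N → Fin N → ℝ) (a : Fin N → Fin N → ℝ)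
    (c : Fin N → Fin N → ℝ) (φ ψ : Fin N → ℝ) (ψ₂ : Fin N → Fin N → ℝ) (k : Fin N) :
    ∑ i, ∑ j, ((dΓ i j * (φ i * ψ j) + Γ i j k * ((-∑ s, a s i * φ s) * ψ j +
        φ i * (-∑ s, a s j * ψ s))) +
      (dg i j * (φ i * ψ₂ k j) + g i j * ((-∑ s, a s i * φ s) * ψ₂ k j +
        φ i * (-∑ s, (c s j * ψ s + a s j * ψ₂ k s) - ∑ s, a s k * ψ₂ s j)))) +
      ∑ s, (∑ i, ∑ j, (Γ i j s * (φ i * ψ j) + g i j * (φ i * ψ₂ s j))) * a s k =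
    ∑ i, ∑ j, ((dΓ i j + ∑ s, Γ i j s * a s k - ∑ s, a i s * Γ s j k - ∑ s, Γ i s k * a j s -
        ∑ s, g i s * c j s) * (φ i * ψ j) +
      (dg i j - ∑ s, a i s * g s j - ∑ s, a j s * g i s) * (φ i * ψ₂ k j)) := by
  have h1 : ∀ (G : Fin N → Fin N → ℝ) (y : Fin N → ℝ),
      ∑ i, ∑ j, G i j * ((∑ s, a s i * φ s) * y j) =
      ∑ i, ∑ j, (∑ s, a i s * G s j) * (φ i * y j) := by
    intro G y
    simp only [Finset.mul_sum, Finset.sum_mul]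
    rw [Finset.sum_comm, Finset.sum_comm (γ := Fin N) (s := Finset.univ) (t := Finset.univ)
      (f := fun i j => ∑ s, a i s * G s j * (φ i * y j))]
    refine Finset.sum_congr rfl fun j _ => ?_
    rw [Finset.sum_comm]
    exact Finset.sum_congr rfl fun i _ => Finset.sum_congr rfl fun k _ => by ring
  have h2 : ∀ (G : Fin N → Fin N → ℝ) (b : Fin N → Fin N → ℝ) (y : Fin N → ℝ),
      ∑ i, ∑ j, G i j * (φ i * ∑ s, b s j * y s) =
      ∑ i, ∑ j, (∑ s, G i s * b j s) * (φ i * y j) := by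
    intro G b y
    simp only [Finset.mul_sum, Finset.sum_mul]
    refine Finset.sum_congr rfl fun i _ => ?_
    rw [Finset.sum_comm]
    exact Finset.sum_congr rfl fun j _ => Finset.sum_congr rfl fun k _ => by ring
  have h3 : ∑ s, (∑ i, ∑ j, Γ i j s * (φ i * ψ j)) * a s k =
      ∑ i, ∑ j, (∑ s, Γ i j s * a s k) * (φ i * ψ j) := by
    simp only [Finset.sum_mul]
    rw [Finset.sum_comm]
    refine Finset.sum_congr rfl fun i _ => ?_
    rw [Finset.sum_comm]
    exact Finset.sum_congr rfl fun j _ => Finset.sum_congr rfl fun k _ => by ring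
  have h4 : ∑ s, (∑ i, ∑ j, g i j * (φ i * ψ₂ s j)) * a s k =
      ∑ i, ∑ j, g i j * (φ i * ∑ s, a s k * ψ₂ s j) := by
    simp only [Finset.sum_mul, Finset.mul_sum]
    rw [Finset.sum_comm]
    refine Finset.sum_congr rfl fun i _ => ?_
    rw [Finset.sum_comm]
    exact Finset.sum_congr rfl fun j _ => Finset.sum_congr rfl fun k _ => by ring
  have h5 : ∀ i j, ∑ s, g i s * a j s = ∑ s, a j s * g i s := fun i j =>
    Finset.sum_congr rfl fun s _ => mul_comm _ _
  simp only [Finset.sum_add_distrib, Finset.sum_sub_distrib, mul_add, mul_sub, add_mul, sub_mul,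
    mul_neg, neg_mul, Finset.sum_neg_distrib, neg_add, h1, h2, h3, h4, h5]
  ring

/-- The left side is the Lie derivative of a one-form built naturally from g, Γ, dφ and dψ. As dφ
and dψ are invariant under X, only g and Γ are differentiated. The second derivatives of X coming
from ∂_k ∂_j ψ are matched by the inhomogeneous term of `lieConn`. -/
theorem lie_connForm {c d : ℝ} (hU : IsOpen U) (hX : ∀ i, ContDiffOn ℝ ∞ (fun u => X u i) U)
    (hg : ∀ i j, ContDiffOn ℝ ∞ (fun u => g u i j) U) (hΓ : ∀ i j k, ContDiffOn ℝ ∞ (Γ i j k) U)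
    (hφ : HasConstDeriv U X φ c) (hψ : HasConstDeriv U X ψ d) (hu : u ∈ U) (k : Fin N) :
    dirDeriv X (connForm g Γ φ ψ k) u
      + ∑ s, connForm g Γ φ ψ s u * pderiv k (fun w => X w s) u =
    connForm (lieMetric X g) (lieConn X g Γ) φ ψ k u := by
  have hψj := fun j => contDiffOn_pderiv hψ.1 hU j
  have d1 := fun i j => differentiableAt_of_mem (hg i j) hU hu
  have d2 := fun i => differentiableAt_of_mem (contDiffOn_pderiv hφ.1 hU i) hU hu
  have d3 := fun i => differentiableAt_of_mem (hψj i) hU hu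
  have d4 := fun i j => differentiableAt_of_mem (hΓ i j k) hU hu
  have d5 := fun j => differentiableAt_of_mem (contDiffOn_pderiv (hψj j) hU k) hU hu
  have dX := fun s => differentiableAt_of_mem (hX s) hU hu
  have dX2 := fun s j => differentiableAt_of_mem (contDiffOn_pderiv (hX s) hU j) hU hu
  have X1 : ∀ {χ : (Fin N → ℝ) → ℝ} {c : ℝ}, HasConstDeriv U X χ c → ∀ w ∈ U, ∀ i,
      dirDeriv X (pderiv i χ) w = -∑ s, pderiv i (fun w => X w s) w * pderiv s χ w :=
    fun h w hw i => by
      rw [dirDeriv_pderiv hX hU h.1 hw, h.pderiv_dirDeriv hU hw, zero_sub]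
  have X2 : ∀ j, dirDeriv X (pderiv k (pderiv j ψ)) u =
      -∑ s, (pderiv k (pderiv j (fun w => X w s)) u * pderiv s ψ u +
        pderiv j (fun w => X w s) u * pderiv k (pderiv s ψ) u) -
      ∑ s, pderiv k (fun w => X w s) u * pderiv s (pderiv j ψ) u := fun j => by
    rw [dirDeriv_pderiv hX hU (hψj j) hu, pderiv_congr hU hu (fun w hw => X1 hψ w hw j)]
    have e : pderiv k (fun w => -∑ s, pderiv j (fun w => X w s) w * pderiv s ψ w) u =
        -pderiv k (fun w => ∑ s, pderiv j (fun w => X w s) w * pderiv s ψ w) u := by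
      simp [pderiv]
    rw [e, pderiv_sum _ fun s _ => (dX2 s j).fun_mul (d3 s)]
    simp only [pderiv_mul (dX2 _ j) (d3 _)]
  have e : dirDeriv X (connForm g Γ φ ψ k) u = ∑ i, ∑ j,
      ((dirDeriv X (Γ i j k) u * (pderiv i φ u * pderiv j ψ u) + Γ i j k u *
        (dirDeriv X (pderiv i φ) u * pderiv j ψ u + pderiv i φ u * dirDeriv X (pderiv j ψ) u)) +
      (dirDeriv X (fun w => g w i j) u * (pderiv i φ u * pderiv k (pderiv j ψ) u) + g u i j *
        (dirDeriv X (pderiv i φ) u * pderiv k (pderiv j ψ) u +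
          pderiv i φ u * dirDeriv X (pderiv k (pderiv j ψ)) u))) := by
    have : connForm g Γ φ ψ k = fun w => ∑ i, ∑ j, (Γ i j k w * (pderiv i φ w * pderiv j ψ w) +
      g w i j * (pderiv i φ w * pderiv k (pderiv j ψ) w)) := rfl
    have dd := fun i j => ((d4 i j).fun_mul ((d2 i).fun_mul (d3 j))).fun_add
      ((d1 i j).fun_mul ((d2 i).fun_mul (d5 j)))
    rw [this, dirDeriv_sum _ fun i _ => DifferentiableAt.fun_sum fun j _ => dd i j]
    refine Finset.sum_congr rfl fun i _ => ?_
    rw [dirDeriv_sum _ fun j _ => dd i j]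
    refine Finset.sum_congr rfl fun j _ => ?_
    rw [dirDeriv_add ((d4 i j).fun_mul ((d2 i).fun_mul (d3 j)))
      ((d1 i j).fun_mul ((d2 i).fun_mul (d5 j))),
      dirDeriv_mul (d4 i j) ((d2 i).fun_mul (d3 j)), dirDeriv_mul (d1 i j) ((d2 i).fun_mul (d5 j)),
      dirDeriv_mul (d2 i) (d3 j), dirDeriv_mul (d2 i) (d5 j)]
  rw [e]
  simp only [X1 hφ u hu, X1 hψ u hu, X2]
  exact lie_connForm_identity (g u) (fun i j => dirDeriv X (fun w => g w i j) u)
    (fun i j k => Γ i j k u) (fun i j => dirDeriv X (Γ i j k) u)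
    (fun i s => pderiv s (fun w => X w i) u) (fun j s => pderiv k (pderiv s (fun w => X w j)) u)
    (fun i => pderiv i φ u) (fun i => pderiv i ψ u) (fun k j => pderiv k (pderiv j ψ) u) k

/-- The Lie derivative of a skew-adjoint operator is skew-adjoint. -/
theorem IsSkewOperator.lie (H : IsSkewOperator U g Γ) (hU : IsOpen U)
    (hX : ∀ i, ContDiffOn ℝ ∞ (fun u => X u i) U) :
    IsSkewOperator U (lieMetric X g) (lieConn X g Γ) := by
  have hg := H.smooth_metric
  have hΓ := H.smooth_conn
  have hXd := fun i s => contDiffOn_pderiv (hX i) hU s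
  refine ⟨fun i j => ?_, fun i j k => ?_, fun u hu i j => ?_, fun u hu i j k => ?_⟩
  · exact ((contDiffOn_dirDeriv hX hU (hg i j)).sub
      (ContDiffOn.sum fun k _ => (hXd i k).mul (hg k j))).sub
      (ContDiffOn.sum fun k _ => (hXd j k).mul (hg i k))
  · exact ((((contDiffOn_dirDeriv hX hU (hΓ i j k)).add
      (ContDiffOn.sum fun s _ => (hΓ i j s).mul (hXd s k))).sub
      (ContDiffOn.sum fun s _ => (hXd i s).mul (hΓ s j k))).sub
      (ContDiffOn.sum fun s _ => (hΓ i s k).mul (hXd j s))).sub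
      (ContDiffOn.sum fun s _ => (hg i s).mul (contDiffOn_pderiv (hXd j s) hU k))
  · simp only [lieMetric, Matrix.of_apply]
    rw [dirDeriv_congr hU hu (fun w hw => H.symm w hw i j)]
    simp only [fun k => H.symm u hu k j, fun k => H.symm u hu i k]
    ring
  · have d1 := fun i j => differentiableAt_of_mem (hg i j) hU hu
    have d2 := fun i s => differentiableAt_of_mem (hXd i s) hU hu
    have d3 := fun i j => differentiableAt_of_mem (contDiffOn_dirDeriv hX hU (hg i j)) hU hu
    have d4 := fun i j k => differentiableAt_of_mem (hΓ i j k) hU hu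
    have e1 : pderiv k (fun w => dirDeriv X (fun w => g w i j) w) u =
        dirDeriv X (Γ i j k) u + dirDeriv X (Γ j i k) u +
        ∑ s, pderiv k (fun w => X w s) u * (Γ i j s u + Γ j i s u) := by
      have := dirDeriv_pderiv hX hU (hg i j) hu k
      rw [dirDeriv_congr hU hu (fun w hw => H.pderiv_metric w hw i j k),
        dirDeriv_add (d4 i j k) (d4 j i k)] at this
      simp only [H.pderiv_metric u hu] at this
      linarith
    have dm : ∀ i j, DifferentiableAt ℝ (fun w => ∑ s, pderiv s (fun w => X w i) w * g w s j) u :=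
      fun i j => DifferentiableAt.fun_sum fun s _ => (d2 i s).fun_mul (d1 s j)
    have dm' : ∀ i j, DifferentiableAt ℝ (fun w => ∑ s, pderiv s (fun w => X w j) w * g w i s) u :=
      fun i j => DifferentiableAt.fun_sum fun s _ => (d2 j s).fun_mul (d1 i s)
    simp only [lieMetric, Matrix.of_apply]
    rw [pderiv_sub ((d3 i j).fun_sub (dm i j)) (dm' i j), pderiv_sub (d3 i j) (dm i j), e1,
      pderiv_sum _ fun s _ => (d2 i s).fun_mul (d1 s j),
      pderiv_sum _ fun s _ => (d2 j s).fun_mul (d1 i s)]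
    simp only [pderiv_mul (d2 _ _) (d1 _ _), H.pderiv_metric u hu, lieConn, mul_add,
      Finset.sum_add_distrib]
    have c1 : ∀ i, ∑ s, pderiv k (pderiv s (fun w => X w i)) u * g u s j =
        ∑ s, g u j s * pderiv k (pderiv s (fun w => X w i)) u := fun i =>
      Finset.sum_congr rfl fun s _ => by rw [H.symm u hu s j, mul_comm]
    simp only [c1, mul_comm (Γ _ _ _ _), mul_comm (g u i _)]
    ring

end Lie

/-! ### The metric of the Lax function and its connection -/

theorem isOpen_modifiedDomain (N : ℕ) : IsOpen (modifiedDomain N) := by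
  have : modifiedDomain N = (⋂ i, ⋂ j, {u : Fin N → ℝ | i ≠ j → u i ≠ u j}) ∩
      ⋂ i, {u : Fin N → ℝ | u i ≠ 0} := by
    ext u
    simp only [modifiedDomain, Set.mem_ofPred_eq, Set.mem_inter_iff, Set.mem_iInter]
    refine and_congr_left fun _ => ⟨fun h i j hij e => hij (h e), fun h i j e => ?_⟩
    by_contra hij
    exact h i j hij e
  rw [this]
  refine IsOpen.inter (isOpen_iInter_of_finite fun i => isOpen_iInter_of_finite fun j => ?_)
    (isOpen_iInter_of_finite fun i => isOpen_ne_fun (continuous_apply i) continuous_const)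
  by_cases hij : i = j
  · simp [hij]
  · simpa [hij] using isOpen_ne_fun (continuous_apply i) (continuous_apply j)

/-- The constant matrix of the metric in the coordinates `log |u^i|`. -/
noncomputable def logMetric (N M : ℕ) (i j : Fin N) : ℝ :=
  if i = j then 1 - ((N : ℝ) - (M : ℝ)) else 1

/-- The contravariant connection coefficients of the metric in the modified variables. -/
noncomputable def laxConn (N M : ℕ) (i j k : Fin N) (u : Fin N → ℝ) : ℝ :=
  if j = k then u i * logMetric N M i j else 0

theorem laxMetric_apply (M : ℕ) (u : Fin N → ℝ) (i j : Fin N) :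
    laxMetric N M u i j = u i * u j * logMetric N M i j := by
  by_cases h : i = j
  · subst h; simp [laxMetric, logMetric]; ring
  · simp [laxMetric, logMetric, h]

theorem logMetric_symm (M : ℕ) (i j : Fin N) : logMetric N M i j = logMetric N M j i := by
  simp only [logMetric, eq_comm]

theorem sum_logMetric_mul (M : ℕ) (i : Fin N) (y : Fin N → ℝ) :
    ∑ j, logMetric N M i j * y j = ∑ j, y j - ((N : ℝ) - M) * y i := by
  have : ∀ j, logMetric N M i j * y j = y j - if i = j then ((N : ℝ) - M) * y j else 0 := by
    intro j
    by_cases h : i = j <;> simp [logMetric, h]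
    ring
  simp [this]

theorem hasFDerivAt_coord (i : Fin N) (u : Fin N → ℝ) :
    HasFDerivAt (fun w : Fin N → ℝ => w i)
      (ContinuousLinearMap.proj (R := ℝ) (φ := fun _ : Fin N => ℝ) i) u :=
  (ContinuousLinearMap.proj (R := ℝ) (φ := fun _ : Fin N => ℝ) i).hasFDerivAt

theorem differentiableAt_coord (i : Fin N) (u : Fin N → ℝ) :
    DifferentiableAt ℝ (fun w : Fin N → ℝ => w i) u := (hasFDerivAt_coord i u).differentiableAt

theorem pderiv_coord (i k : Fin N) (u : Fin N → ℝ) :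
    pderiv k (fun w => w i) u = if i = k then 1 else 0 := by
  rw [pderiv, (hasFDerivAt_coord i u).fderiv]
  simp [Pi.single_apply]

theorem pderiv_mul_const {a : (Fin N → ℝ) → ℝ} {u : Fin N → ℝ} (ha : DifferentiableAt ℝ a u)
    (c : ℝ) (k : Fin N) : pderiv k (fun w => a w * c) u = pderiv k a u * c := by
  rw [pderiv_mul ha (differentiableAt_const c), pderiv_const]; ring

theorem pderiv_laxConn (M : ℕ) (i j k s : Fin N) (u : Fin N → ℝ) :
    pderiv s (laxConn N M i j k) u =
      if j = k then (if i = s then 1 else 0) * logMetric N M i j else 0 := by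
  by_cases h : j = k
  · have : laxConn N M i j k = fun w => w i * logMetric N M i j := by
      funext w; simp [laxConn, h]
    rw [this, pderiv_mul_const (differentiableAt_coord i u), pderiv_coord]
    simp [h]
  · have : laxConn N M i j k = fun w => 0 := by
      funext w; simp [laxConn, h]
    rw [this, pderiv_const]
    simp [h]

theorem isSkewOperator_lax (U : Set (Fin N → ℝ)) (M : ℕ) :
    IsSkewOperator U (laxMetric N M) (laxConn N M) where
  smooth_metric i j := by
    simp only [laxMetric_apply]
    exact ((contDiff_apply _ _ i).contDiffOn.mul (contDiff_apply _ _ j).contDiffOn).mul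
      contDiffOn_const
  smooth_conn i j k := by
    by_cases h : j = k
    · have e : laxConn N M i j k = fun w => w i * logMetric N M i j := by
        funext w; simp [laxConn, h]
      rw [e]
      exact (contDiff_apply _ _ i).contDiffOn.mul contDiffOn_const
    · have e : laxConn N M i j k = fun _ => 0 := by
        funext w; simp [laxConn, h]
      rw [e]
      exact contDiffOn_const
  symm u _ i j := by
    rw [laxMetric_apply, laxMetric_apply, logMetric_symm]; ring
  pderiv_metric u _ i j k := by
    simp only [laxMetric_apply]
    rw [pderiv_mul_const ((differentiableAt_coord i u).fun_mul (differentiableAt_coord j u)),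
      pderiv_mul (differentiableAt_coord i u) (differentiableAt_coord j u), pderiv_coord,
      pderiv_coord, laxConn, laxConn, logMetric_symm M j i]
    by_cases h1 : i = k <;> by_cases h2 : j = k <;> simp [h1, h2]
    ring

theorem laxConn_torsion (M : ℕ) (u : Fin N → ℝ) (i j k : Fin N) :
    ∑ s, laxMetric N M u i s * laxConn N M j k s u =
      ∑ s, laxMetric N M u j s * laxConn N M i k s u := by
  simp only [laxConn, laxMetric_apply, mul_ite, mul_zero, Finset.sum_ite_eq, Finset.mem_univ,
    if_true]
  ring

/-- For a kernel vector c put y_j = u^j c_j. Then ∑ y = (N - M) y_i for each i; summing over i gives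
M ∑ y = 0, so every y_i vanishes. Both M > 0 and M < N are needed. -/
theorem det_laxMetric_ne_zero {M : ℕ} (hM : 0 < M) (hMN : M < N) {u : Fin N → ℝ}
    (hu : ∀ i, u i ≠ 0) : (laxMetric N M u).det ≠ 0 := by
  intro h
  obtain ⟨c, hc, h0⟩ := Matrix.exists_mulVec_eq_zero_iff.2 h
  refine hc (funext fun i => ?_)
  have hM' : (0 : ℝ) < M := by exact_mod_cast hM
  have hK : (0 : ℝ) < (N : ℝ) - M := sub_pos.2 (by exact_mod_cast hMN)
  have h1 : ∀ i, ∑ j, u j * c j = ((N : ℝ) - M) * (u i * c i) := fun i => by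
    have e := congrFun h0 i
    simp only [Matrix.mulVec, dotProduct, laxMetric_apply, Pi.zero_apply] at e
    have e2 : ∑ j, u i * u j * logMetric N M i j * c j =
        u i * ∑ j, logMetric N M i j * (u j * c j) := by
      rw [Finset.mul_sum]
      exact Finset.sum_congr rfl fun j _ => by ring
    rw [e2, sum_logMetric_mul] at e
    have := (mul_eq_zero.1 e).resolve_left (hu i)
    linarith
  have h2 : (N : ℝ) * ∑ j, u j * c j = ((N : ℝ) - M) * ∑ j, u j * c j := by
    have := Finset.sum_congr rfl fun i (_ : i ∈ Finset.univ) => h1 i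
    rw [← Finset.mul_sum] at this
    simpa using this
  have h3 : ∑ j, u j * c j = 0 := by
    have : (M : ℝ) * ∑ j, u j * c j = 0 := by linarith
    exact (mul_eq_zero.1 this).resolve_left hM'.ne'
  have h4 := h1 i
  rw [h3] at h4
  have h5 := (mul_eq_zero.1 h4.symm).resolve_left hK.ne'
  exact (mul_eq_zero.1 h5).resolve_left (hu i)

theorem contraChristoffel_laxMetric {M : ℕ} (hM : 0 < M) (hMN : M < N) {u : Fin N → ℝ}
    (hu : u ∈ modifiedDomain N) (i j k : Fin N) :
    contraChristoffel (laxMetric N M) i j k u = laxConn N M i j k u := by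
  have H := isSkewOperator_lax (modifiedDomain N) M
  exact contraChristoffel_eq (isOpen_modifiedDomain N) H.smooth_metric H.symm
    (fun w hw => det_laxMetric_ne_zero hM hMN hw.2) hu (H.pderiv_metric u hu)
    (laxConn_torsion M u) i j k

/-! ### The Jacobi identity of the bracket of the Lax metric. -/

section Jacobi

variable {U : Set (Fin N → ℝ)} {u : ℝ → Fin N → ℝ} {M : ℕ}

/-- The covector field `G^{ij} (u^j a_j)_x`, where `G` is the metric in the coordinates
`log |u^i|`. -/
noncomputable def logGrad (N M : ℕ) (u a : ℝ → Fin N → ℝ) (x : ℝ) (i : Fin N) : ℝ :=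
  ∑ j, logMetric N M i j * (u x j * jet a x 1 j + jet u x 1 j * a x j)

/-- The operator factors as u^i G^{ij} (d/dx) u^j with G constant, that is, it is G d/dx in the
coordinates log |u^i|. The connection `laxConn` is what this factorization produces. -/
theorem opField_lax (u a : ℝ → Fin N → ℝ) (x : ℝ) (i : Fin N) :
    opField (laxMetric N M) (laxConn N M) u a x i = u x i * logGrad N M u a x i := by
  simp only [opField, logGrad, Finset.mul_sum, laxConn, laxMetric_apply, ite_mul, zero_mul,
    Finset.sum_ite_eq, Finset.mem_univ, if_true]
  exact Finset.sum_congr rfl fun j _ => by ring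

theorem opVariation_lax (u ξ a : ℝ → Fin N → ℝ) (x : ℝ) (i : Fin N) :
    opVariation (laxMetric N M) (laxConn N M) u ξ a x i = ξ x i * logGrad N M u a x i +
      u x i * ∑ j, logMetric N M i j * (ξ x j * jet a x 1 j + jet ξ x 1 j * a x j) := by
  have e1 : ∀ j, ∑ s, pderiv s (fun w => laxMetric N M w i j) (u x) * ξ x s =
      u x i * logMetric N M i j * ξ x j + u x j * logMetric N M i j * ξ x i := fun j => by
    simp only [(isSkewOperator_lax Set.univ M).pderiv_metric _ (Set.mem_univ _), add_mul,
      Finset.sum_add_distrib, laxConn, ite_mul, zero_mul, Finset.sum_ite_eq, Finset.mem_univ,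
      if_true, logMetric_symm M j i]
  have e2 : ∀ j, ∑ k, ((∑ s, pderiv s (laxConn N M i j k) (u x) * ξ x s) * jet u x 1 k +
      laxConn N M i j k (u x) * jet ξ x 1 k) =
      logMetric N M i j * ξ x i * jet u x 1 j + u x i * logMetric N M i j * jet ξ x 1 j := fun j => by
    have : ∀ k, ∑ s, pderiv s (laxConn N M i j k) (u x) * ξ x s =
        if j = k then logMetric N M i j * ξ x i else 0 := fun k => by
      by_cases h : j = k <;> simp [pderiv_laxConn, h]
    simp only [this, laxConn, ite_mul, zero_mul, Finset.sum_add_distrib, Finset.sum_ite_eq,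
      Finset.mem_univ, if_true]
  simp only [opVariation, e1, e2, logGrad, Finset.mul_sum]
  rw [← Finset.sum_add_distrib]
  exact Finset.sum_congr rfl fun j _ => by ring

theorem isLoop_logGrad (hu : IsLoop u) {a : ℝ → Fin N → ℝ} (ha : IsLoop a) :
    IsLoop (logGrad N M u a) :=
  isLoop_pi.2 fun _ => IsLoop.sum _ fun j _ => (isLoop_const _).mul
    (((isLoop_pi.1 hu j).mul (ha.jet 1 j)).add ((hu.jet 1 j).mul (isLoop_pi.1 ha j)))

/-- In the variation of u^i G^{ij} (d/dx) u^j, integration by parts moves d/dx from ξ b onto u a.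
Since ξ = u W(c), with W = `logGrad`, an expression algebraic in u, a, b and the W's remains. -/
theorem loopPairing_opVariation_lax (hu : IsField U u) {a b c : ℝ → Fin N → ℝ} (ha : IsLoop a)
    (hb : IsLoop b) (hc : IsLoop c) :
    loopPairing a (opVariation (laxMetric N M) (laxConn N M) u
        (opField (laxMetric N M) (laxConn N M) u c) b) =
      ∫ x in (0 : ℝ)..1, ∑ i, u x i * logGrad N M u c x i *
        (a x i * logGrad N M u b x i - b x i * logGrad N M u a x i) := by
  set ξ := opField (laxMetric N M) (laxConn N M) u c with hξdef
  have hul := hu.isLoop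
  have hξ : IsLoop ξ := (isSkewOperator_lax U M).isLoop_opField hu hc
  -- The boundary term of that integration by parts.
  have hQ : IsLoop (fun x => ∑ i, ∑ j, logMetric N M i j * ((u x i * a x i) * (ξ x j * b x j))) :=
    IsLoop.sum _ fun i _ => IsLoop.sum _ fun j _ => (isLoop_const _).mul
      (((isLoop_pi.1 hul i).mul (isLoop_pi.1 ha i)).mul ((isLoop_pi.1 hξ j).mul (isLoop_pi.1 hb j)))
  have hW := fun {a : ℝ → Fin N → ℝ} (ha : IsLoop a) => isLoop_pi.1 (isLoop_logGrad (M := M) hul ha)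
  have hR : IsLoop (fun x => ∑ i, u x i * logGrad N M u c x i *
      (a x i * logGrad N M u b x i + -1 * (b x i * logGrad N M u a x i))) :=
    IsLoop.sum _ fun i _ => ((isLoop_pi.1 hul i).mul (hW hc i)).mul
      (((isLoop_pi.1 ha i).mul (hW hb i)).add
        ((isLoop_const (-1)).mul ((isLoop_pi.1 hb i).mul (hW ha i))))
  have hd : ∀ x, deriv (fun x => ∑ i, ∑ j,
      logMetric N M i j * ((u x i * a x i) * (ξ x j * b x j))) x =
      ∑ i, ∑ j, logMetric N M i j * ((jet u x 1 i * a x i + u x i * jet a x 1 i) *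
        (ξ x j * b x j) + (u x i * a x i) * (jet ξ x 1 j * b x j + ξ x j * jet b x 1 j)) := by
    intro x
    have hj : ∀ {a : ℝ → Fin N → ℝ}, IsLoop a → ∀ i,
        HasDerivAt (fun x => a x i) (jet a x 1 i) x := fun ha i => by
      simpa [jet] using ha.hasDerivAt_jet 0 i x
    exact (HasDerivAt.fun_sum fun i _ => HasDerivAt.fun_sum fun j _ =>
      (((hj hul i).fun_mul (hj ha i)).fun_mul ((hj hξ j).fun_mul (hj hb j))).const_mul _).deriv
  have key : ∀ x, ∑ i, a x i * opVariation (laxMetric N M) (laxConn N M) u ξ b x i =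
      ∑ i, u x i * logGrad N M u c x i *
        (a x i * logGrad N M u b x i + -1 * (b x i * logGrad N M u a x i)) +
      deriv (fun x => ∑ i, ∑ j, logMetric N M i j * ((u x i * a x i) * (ξ x j * b x j))) x := by
    intro x
    have e1 : ∑ i, u x i * logGrad N M u c x i * (b x i * logGrad N M u a x i) =
        ∑ i, ∑ j, logMetric N M i j * ((jet u x 1 i * a x i + u x i * jet a x 1 i) *
          (ξ x j * b x j)) := by
      rw [Finset.sum_comm]
      refine Finset.sum_congr rfl fun j _ => ?_
      rw [hξdef, opField_lax]
      conv_lhs => rw [logGrad.eq_def N M u a]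
      simp only [Finset.mul_sum]
      refine Finset.sum_congr rfl fun i _ => ?_
      rw [logMetric_symm]
      ring
    have e2 : ∀ i, a x i * opVariation (laxMetric N M) (laxConn N M) u ξ b x i =
        u x i * logGrad N M u c x i * (a x i * logGrad N M u b x i) +
        ∑ j, logMetric N M i j * ((u x i * a x i) *
          (jet ξ x 1 j * b x j + ξ x j * jet b x 1 j)) := fun i => by
      have e3 : ∑ j, logMetric N M i j * ((u x i * a x i) *
          (jet ξ x 1 j * b x j + ξ x j * jet b x 1 j)) = (u x i * a x i) *
          ∑ j, logMetric N M i j * (ξ x j * jet b x 1 j + jet ξ x 1 j * b x j) := by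
        rw [Finset.mul_sum]
        exact Finset.sum_congr rfl fun j _ => by ring
      have e4 : ξ x i = u x i * logGrad N M u c x i := opField_lax u c x i
      rw [opVariation_lax, e3, e4]
      ring
    rw [hd]
    simp only [e2, mul_add, Finset.sum_add_distrib, neg_mul, one_mul, mul_neg,
      Finset.sum_neg_distrib]
    rw [e1]
    ring
  unfold loopPairing
  simp only [key]
  rw [intervalIntegral.integral_add hR.intervalIntegrable hQ.deriv.intervalIntegrable,
    hQ.integral_deriv, add_zero]
  simp only [neg_mul, one_mul, ← sub_eq_add_neg]

theorem jacobiator_lax (hU : IsOpen U) {f h l : (ℕ → Fin N → ℝ) → ℝ} (hf : IsLocalDensity U f)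
    (hh : IsLocalDensity U h) (hl : IsLocalDensity U l) (hu : IsField U u) :
    jacobiator (laxMetric N M) (laxConn N M) (laxMetric N M) (laxConn N M) f h l u = 0 := by
  refine (isSkewOperator_lax U M).jacobi hU (fun u hu a b c ha hb hc => ?_) hf hh hl hu
  rw [loopPairing_opVariation_lax hu ha hb hc, loopPairing_opVariation_lax hu hb hc ha,
    loopPairing_opVariation_lax hu hc ha hb]
  have hul := hu.isLoop
  have hW := fun {a : ℝ → Fin N → ℝ} (ha : IsLoop a) => isLoop_pi.1 (isLoop_logGrad (M := M) hul ha)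
  have hI : ∀ {a b c : ℝ → Fin N → ℝ}, IsLoop a → IsLoop b → IsLoop c →
      IntervalIntegrable (fun x => ∑ i, u x i * logGrad N M u c x i *
        (a x i * logGrad N M u b x i - b x i * logGrad N M u a x i)) MeasureTheory.volume 0 1 := by
    intro a b c ha hb hc
    have : IsLoop (fun x => ∑ i, u x i * logGrad N M u c x i *
        (a x i * logGrad N M u b x i + -1 * (b x i * logGrad N M u a x i))) :=
      IsLoop.sum _ fun i _ => ((isLoop_pi.1 hul i).mul (hW hc i)).mul
        (((isLoop_pi.1 ha i).mul (hW hb i)).add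
          ((isLoop_const (-1)).mul ((isLoop_pi.1 hb i).mul (hW ha i))))
    simpa only [neg_mul, one_mul, ← sub_eq_add_neg] using this.intervalIntegrable
  rw [← intervalIntegral.integral_add (hI ha hb hc) (hI hb hc ha),
    ← intervalIntegral.integral_add ((hI ha hb hc).add (hI hb hc ha)) (hI hc ha hb)]
  simp only [← Finset.sum_add_distrib]
  refine (intervalIntegral.integral_congr (g := fun _ => 0) fun x _ =>
    Finset.sum_eq_zero fun i _ => ?_).trans (by simp)
  -- The cyclic sum of W(c)(a W(b) - b W(a)) is zero for each index i, already before integration.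
  ring

end Jacobi

/-! ### The polynomial `∏ (p + u^i)` and its derivatives -/

/-- The polynomial `∏ (p + u^i)`. -/
noncomputable def laxPoly (p : ℝ) (u : Fin N → ℝ) : ℝ := ∏ i, (p + u i)

/-- The polynomial `∏_{j ≠ i} (p + u^j)`. -/
noncomputable def laxPart (p : ℝ) (i : Fin N) (u : Fin N → ℝ) : ℝ :=
  ∏ j ∈ Finset.univ.erase i, (p + u j)

/-- The polynomial `∏_{j ≠ i, k} (p + u^j)` for `i ≠ k`, and zero for `i = k`. -/
noncomputable def laxPart₂ (p : ℝ) (i k : Fin N) (u : Fin N → ℝ) : ℝ :=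
  if i = k then 0 else ∏ j ∈ (Finset.univ.erase i).erase k, (p + u j)

/-- The derivative of `∏ (p + u^i)` with respect to `p`. -/
noncomputable def laxDeriv (p : ℝ) (u : Fin N → ℝ) : ℝ := ∑ i, laxPart p i u

theorem mul_laxPart (p : ℝ) (i : Fin N) (u : Fin N → ℝ) :
    (p + u i) * laxPart p i u = laxPoly p u :=
  Finset.mul_prod_erase _ (fun j => p + u j) (Finset.mem_univ i)

theorem mul_laxPart₂ (p : ℝ) {i k : Fin N} (h : i ≠ k) (u : Fin N → ℝ) :
    (p + u k) * laxPart₂ p i k u = laxPart p i u := by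
  rw [laxPart₂, if_neg h, laxPart]
  exact Finset.mul_prod_erase _ (fun j => p + u j) (by simp [h.symm])

theorem laxPart₂_comm (p : ℝ) (i k : Fin N) (u : Fin N → ℝ) :
    laxPart₂ p i k u = laxPart₂ p k i u := by
  simp only [laxPart₂, Finset.erase_right_comm (a := i), eq_comm]

theorem laxPart₂_self (p : ℝ) (i : Fin N) (u : Fin N → ℝ) : laxPart₂ p i i u = 0 := by
  simp [laxPart₂]

theorem contDiff_shiftProd (p : ℝ) (s : Finset (Fin N)) :
    ContDiff ℝ ∞ (fun u : Fin N → ℝ => ∏ j ∈ s, (p + u j)) :=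
  contDiff_prod fun j _ => contDiff_const.add (contDiff_apply _ _ j)

theorem contDiff_laxPoly (p : ℝ) : ContDiff ℝ ∞ (laxPoly (N := N) p) := contDiff_shiftProd p _

theorem contDiff_laxPart (p : ℝ) (i : Fin N) : ContDiff ℝ ∞ (laxPart p i) := contDiff_shiftProd p _

theorem contDiff_laxDeriv (p : ℝ) : ContDiff ℝ ∞ (laxDeriv (N := N) p) :=
  ContDiff.sum fun i _ => contDiff_laxPart p i

theorem pderiv_shiftProd (p : ℝ) (s : Finset (Fin N)) (k : Fin N) (u : Fin N → ℝ) :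
    pderiv k (fun u : Fin N → ℝ => ∏ j ∈ s, (p + u j)) u =
      if k ∈ s then ∏ j ∈ s.erase k, (p + u j) else 0 := by
  induction s using Finset.induction_on with
  | empty => simp [pderiv_const]
  | insert a s ha ih =>
    have e : (fun u : Fin N → ℝ => ∏ j ∈ insert a s, (p + u j)) =
        fun u => (p + u a) * ∏ j ∈ s, (p + u j) := by
      funext u; rw [Finset.prod_insert ha]
    have d1 : DifferentiableAt ℝ (fun u : Fin N → ℝ => p + u a) u :=
      (differentiableAt_const p).fun_add (differentiableAt_coord a u)
    have d2 : DifferentiableAt ℝ (fun u : Fin N → ℝ => ∏ j ∈ s, (p + u j)) u :=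
      (contDiff_shiftProd p s).contDiffAt.differentiableAt (by simp)
    rw [e, pderiv_mul d1 d2, ih, pderiv_add (differentiableAt_const p) (differentiableAt_coord a u),
      pderiv_const, pderiv_coord, zero_add]
    by_cases hak : a = k
    · subst hak
      simp [ha]
    · have hka : k ≠ a := fun h => hak h.symm
      by_cases hk : k ∈ s
      · have : a ∉ s.erase k := fun h => ha (Finset.mem_of_mem_erase h)
        simp [hak, hk, Finset.erase_insert_of_ne hak, Finset.prod_insert this]
      · simp [hak, hk, hka]

theorem pderiv_laxPoly (p : ℝ) (i : Fin N) (u : Fin N → ℝ) :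
    pderiv i (laxPoly p) u = laxPart p i u := by
  have := pderiv_shiftProd p Finset.univ i u
  exact this.trans (by simp [laxPart])

theorem pderiv_laxPart (p : ℝ) (i k : Fin N) (u : Fin N → ℝ) :
    pderiv k (laxPart p i) u = laxPart₂ p i k u := by
  have := pderiv_shiftProd p (Finset.univ.erase i) k u
  refine this.trans ?_
  by_cases h : i = k
  · simp [laxPart₂, h]
  · simp [laxPart₂, h, Ne.symm h]

theorem pderiv_pderiv_laxPoly (p : ℝ) (i k : Fin N) (u : Fin N → ℝ) :
    pderiv k (pderiv i (laxPoly p)) u = laxPart₂ p i k u := by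
  rw [show pderiv i (laxPoly p) = laxPart p i from funext fun u => pderiv_laxPoly p i u,
    pderiv_laxPart]

theorem pderiv_laxDeriv (p : ℝ) (k : Fin N) (u : Fin N → ℝ) :
    pderiv k (laxDeriv p) u = ∑ i, laxPart₂ p i k u := by
  have : laxDeriv p = fun u : Fin N → ℝ => ∑ i, laxPart p i u := rfl
  rw [this, pderiv_sum _ fun i _ => (contDiff_laxPart p i).contDiffAt.differentiableAt (by simp)]
  simp only [pderiv_laxPart]

theorem hasDerivAt_shiftProd (s : Finset (Fin N)) (u : Fin N → ℝ) (p : ℝ) :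
    HasDerivAt (fun p => ∏ j ∈ s, (p + u j)) (∑ k ∈ s, ∏ j ∈ s.erase k, (p + u j)) p := by
  have := HasDerivAt.fun_finsetProd (u := s) (f := fun j p => p + u j) (f' := fun _ => 1) (x := p)
    fun j _ => (hasDerivAt_id p).add_const (u j)
  simpa using this

theorem hasDerivAt_laxPoly (u : Fin N → ℝ) (p : ℝ) :
    HasDerivAt (fun p => laxPoly p u) (laxDeriv p u) p :=
  hasDerivAt_shiftProd Finset.univ u p

/-- The derivatives in p and in u^i commute on P. Hence differentiating in p an identity about dP(p)
yields one about the differential of ∂_p P. -/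
theorem hasDerivAt_laxPart (i : Fin N) (u : Fin N → ℝ) (p : ℝ) :
    HasDerivAt (fun p => laxPart p i u) (pderiv i (laxDeriv p) u) p := by
  have h := hasDerivAt_shiftProd (Finset.univ.erase i) u p
  have e : ∑ k, laxPart₂ p k i u =
      ∑ k ∈ Finset.univ.erase i, ∏ j ∈ (Finset.univ.erase i).erase k, (p + u j) := by
    rw [← Finset.add_sum_erase _ _ (Finset.mem_univ i), laxPart₂_self, zero_add]
    refine Finset.sum_congr rfl fun k hk => ?_
    rw [laxPart₂_comm, laxPart₂, if_neg (Finset.ne_of_mem_erase hk).symm]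
  rw [pderiv_laxDeriv, e]
  exact h

/-! ### Testing tensors on the differentials of `∏ (p + u^i)` -/

/-- The polynomial `∑ c_i ∏_{j ≠ i} (X + u^j)`. -/
noncomputable def partPolynomial (u c : Fin N → ℝ) : Polynomial ℝ :=
  ∑ i, Polynomial.C (c i) * ∏ j ∈ Finset.univ.erase i, (Polynomial.X + Polynomial.C (u j))

theorem eval_partPolynomial (u c : Fin N → ℝ) (p : ℝ) :
    (partPolynomial u c).eval p = ∑ i, c i * laxPart p i u := by
  simp [partPolynomial, Polynomial.eval_finsetSum, Polynomial.eval_prod, laxPart]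

theorem laxPart_neg_of_ne {u : Fin N → ℝ} {i j : Fin N} (h : i ≠ j) :
    laxPart (-u j) i u = 0 :=
  Finset.prod_eq_zero (i := j) (by simp [h.symm]) (by ring)

theorem laxPart_neg_self_ne_zero {u : Fin N → ℝ} (hu : Function.Injective u) (i : Fin N) :
    laxPart (-u i) i u ≠ 0 :=
  Finset.prod_ne_zero_iff.2 fun j hj h => Finset.ne_of_mem_erase hj (hu (by linarith))

/-- Lagrange interpolation at the distinct nodes -u^j: evaluation at -u^i isolates a non-zero
multiple of c_i. -/
theorem eq_zero_of_partPolynomial_eq_zero {u : Fin N → ℝ} (hu : Function.Injective u)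
    {c : Fin N → ℝ} (h : partPolynomial u c = 0) (i : Fin N) : c i = 0 := by
  have h1 := eval_partPolynomial u c (-u i)
  rw [h, Polynomial.eval_zero, Finset.sum_eq_single i (fun j _ hj => by
    rw [laxPart_neg_of_ne hj, mul_zero]) (by simp)] at h1
  exact (mul_eq_zero.1 h1.symm).resolve_right (laxPart_neg_self_ne_zero hu i)

theorem polynomial_eq_zero_of_eval {P : Polynomial ℝ} (S : Finset ℝ)
    (h : ∀ p, p ∉ S → P.eval p = 0) : P = 0 :=
  Polynomial.eq_zero_of_infinite_isRoot P
    (S.finite_toSet.infinite_compl.mono fun p hp => h p (by simpa using hp))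

/-- A covector that vanishes on the differentials of almost all `∏ (p + u^i)` is zero. -/
theorem eq_zero_of_sum_laxPart {u : Fin N → ℝ} (hu : Function.Injective u) {c : Fin N → ℝ}
    (S : Finset ℝ) (h : ∀ p, p ∉ S → ∑ i, c i * laxPart p i u = 0) (i : Fin N) : c i = 0 :=
  eq_zero_of_partPolynomial_eq_zero hu
    (polynomial_eq_zero_of_eval S fun p hp => by rw [eval_partPolynomial, h p hp]) i

/-- The diagonal p = q can be left out, since for fixed q a polynomial in p is determined by its
values at p ≠ q. The closed formulas below carry powers of p - q, which may thus be cancelled. -/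
theorem eq_zero_of_sum_sum_laxPart {u : Fin N → ℝ} (hu : Function.Injective u)
    {T : Fin N → Fin N → ℝ}
    (h : ∀ p q, p ≠ q → ∑ i, ∑ j, T i j * (laxPart p i u * laxPart q j u) = 0) (i j : Fin N) :
    T i j = 0 := by
  refine eq_zero_of_sum_laxPart hu (c := fun j => T i j) ∅ (fun q _ => ?_) j
  refine eq_zero_of_sum_laxPart hu (c := fun i => ∑ j, T i j * laxPart q j u) {q} (fun p hp => ?_) i
  rw [← h p q (by simpa using hp)]
  simp only [Finset.sum_mul]
  exact Finset.sum_congr rfl fun i _ => Finset.sum_congr rfl fun j _ => by ring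

/-! ### The coordinates `s` and the field `∂/∂s` -/

/-- Vieta's formula. The index m starts at 0, whence the exponent N - 1 - m. -/
theorem laxPoly_eq_sum (p : ℝ) (u : Fin N → ℝ) :
    laxPoly p u = p ^ N + ∑ m : Fin N, symVar m u * p ^ (N - 1 - (m : ℕ)) := by
  have h := congrArg (fun P => Polynomial.eval p (Polynomial.map (MvPolynomial.eval u) P))
    (MvPolynomial.prod_C_add_X_eq_sum_esymm (σ := Fin N) ℝ)
  simp only [Polynomial.map_prod, Polynomial.map_add, Polynomial.map_X, Polynomial.map_C,
    Polynomial.eval_prod, Polynomial.eval_add, Polynomial.eval_X, Polynomial.eval_C,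
    MvPolynomial.eval_X, Polynomial.map_sum, Polynomial.map_mul, Polynomial.map_pow,
    Polynomial.eval_finsetSum, Polynomial.eval_mul, Polynomial.eval_pow, Fintype.card_fin] at h
  rw [laxPoly, h, Finset.sum_range_succ', add_comm, Finset.sum_range]
  congr 1
  · simp
  · refine Finset.sum_congr rfl fun m _ => ?_
    rw [symVar, Nat.sub_sub, add_comm 1]

theorem contDiff_symVar (m : Fin N) : ContDiff ℝ ∞ (symVar m) := by
  have : symVar m = fun u : Fin N → ℝ =>
      ∑ t ∈ Finset.powersetCard (m + 1) (Finset.univ : Finset (Fin N)), ∏ i ∈ t, u i := by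
    funext u
    simp [symVar, MvPolynomial.esymm]
  rw [this]
  exact ContDiff.sum fun t _ => contDiff_prod fun i _ => contDiff_apply _ _ i

theorem fderiv_laxPoly (p : ℝ) (i : Fin N) (u : Fin N → ℝ) :
    laxPart p i u = ∑ m : Fin N, symJacobian u m i * p ^ (N - 1 - (m : ℕ)) := by
  have d : ∀ m : Fin N, DifferentiableAt ℝ (symVar m) u := fun m =>
    (contDiff_symVar m).contDiffAt.differentiableAt (by simp)
  have e : laxPoly p = fun u : Fin N → ℝ =>
      p ^ N + ∑ m : Fin N, symVar m u * p ^ (N - 1 - (m : ℕ)) := funext fun u => laxPoly_eq_sum p u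
  rw [← pderiv_laxPoly, e, pderiv_add (differentiableAt_const _)
    (DifferentiableAt.fun_sum fun m _ => (d m).mul_const _), pderiv_const, zero_add,
    pderiv_sum _ fun m _ => (d m).mul_const _]
  exact Finset.sum_congr rfl fun m _ => pderiv_mul_const (d m) _ i

/-- A vector killed by all ds^m is killed by all dP(p), hence is zero. -/
theorem det_symJacobian_ne_zero {u : Fin N → ℝ} (hu : Function.Injective u) :
    (symJacobian u).det ≠ 0 := by
  intro h
  obtain ⟨c, hc, h0⟩ := Matrix.exists_mulVec_eq_zero_iff.2 h
  refine hc (funext fun i => eq_zero_of_sum_laxPart hu ∅ (fun p _ => ?_) i)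
  simp only [fderiv_laxPoly, Finset.mul_sum]
  rw [Finset.sum_comm]
  refine Finset.sum_eq_zero fun m _ => ?_
  have h1 : ∑ i, symJacobian u m i * c i = 0 := congrFun h0 m
  calc ∑ i, c i * (symJacobian u m i * p ^ (N - 1 - (m : ℕ)))
      = (∑ i, symJacobian u m i * c i) * p ^ (N - 1 - (m : ℕ)) := by
        rw [Finset.sum_mul]; exact Finset.sum_congr rfl fun i _ => by ring
    _ = 0 := by rw [h1, zero_mul]

theorem contDiffOn_symField (b i : Fin N) :
    ContDiffOn ℝ ∞ (fun u => symField b u i) (modifiedDomain N) :=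
  contDiffOn_inv (fun m i => (contDiffOn_pderiv (contDiff_symVar m).contDiffOn isOpen_univ i).mono
    (Set.subset_univ _)) (fun _ hu => det_symJacobian_ne_zero hu.1) i b

theorem sum_symJacobian_symField {u : Fin N → ℝ} (hu : u ∈ modifiedDomain N) (m b : Fin N) :
    ∑ i, symJacobian u m i * symField b u i = if m = b then 1 else 0 := by
  have h := Matrix.mul_nonsing_inv (symJacobian u) (det_symJacobian_ne_zero hu.1).isUnit
  have := congrFun (congrFun h m) b
  rwa [Matrix.mul_apply, Matrix.one_apply] at this

theorem hasConstDeriv_symVar (m b : Fin N) :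
    HasConstDeriv (modifiedDomain N) (symField b) (symVar m) (if m = b then 1 else 0) :=
  ⟨(contDiff_symVar m).contDiffOn, fun u hu => by
    rw [← sum_symJacobian_symField hu m b]
    exact Finset.sum_congr rfl fun i _ => mul_comm _ _⟩

theorem sum_symField_laxPart {u : Fin N → ℝ} (hu : u ∈ modifiedDomain N) (b : Fin N) (p : ℝ) :
    ∑ i, symField b u i * laxPart p i u = p ^ (N - 1 - (b : ℕ)) := by
  simp only [fderiv_laxPoly, Finset.mul_sum]
  rw [Finset.sum_comm]
  have : ∀ m, ∑ i, symField b u i * (symJacobian u m i * p ^ (N - 1 - (m : ℕ))) =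
      (if m = b then 1 else 0) * p ^ (N - 1 - (m : ℕ)) := fun m => by
    rw [← sum_symJacobian_symField hu m b, Finset.sum_mul]
    exact Finset.sum_congr rfl fun i _ => by ring
  simp [this]

variable {M : ℕ} {b : Fin N}

/-- s^{N-M} is the coefficient of p^M in P, and the other coefficients do not change along its
coordinate field. -/
theorem hasConstDeriv_laxPoly (hb : (b : ℕ) + 1 + M = N) (p : ℝ) :
    HasConstDeriv (modifiedDomain N) (symField b) (laxPoly p) (p ^ M) :=
  ⟨(contDiff_laxPoly p).contDiffOn, fun u hu => by
    rw [show M = N - 1 - (b : ℕ) by omega, ← sum_symField_laxPart hu b p]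
    simp only [dirDeriv, pderiv_laxPoly]⟩

theorem hasConstDeriv_laxDeriv (hb : (b : ℕ) + 1 + M = N) (p : ℝ) :
    HasConstDeriv (modifiedDomain N) (symField b) (laxDeriv p) (M * p ^ (M - 1)) :=
  ⟨(contDiff_laxDeriv p).contDiffOn, fun u hu => by
    have h1 : HasDerivAt (fun p => ∑ i, symField b u i * laxPart p i u)
        (dirDeriv (symField b) (laxDeriv p) u) p :=
      HasDerivAt.fun_sum fun i _ => (hasDerivAt_laxPart i u p).const_mul _
    have h2 : (fun p => ∑ i, symField b u i * laxPart p i u) = fun p => p ^ M := by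
      funext p
      rw [sum_symField_laxPart hu b p, show N - 1 - (b : ℕ) = M by omega]
    rw [h2] at h1
    exact h1.unique (hasDerivAt_pow M p)⟩

/-! ### Lie derivatives of expressions in functions affine along a field -/

section Affine

variable {U : Set (Fin N → ℝ)} {u : Fin N → ℝ} {X : (Fin N → ℝ) → Fin N → ℝ}
  {g : (Fin N → ℝ) → Matrix (Fin N) (Fin N) ℝ} {Γ : Fin N → Fin N → Fin N → (Fin N → ℝ) → ℝ}

theorem hasConstDeriv_const (c : ℝ) : HasConstDeriv U X (fun _ => c) 0 :=
  ⟨contDiffOn_const, fun _ _ => dirDeriv_const c⟩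

theorem contDiffOn_pairing {φ ψ : (Fin N → ℝ) → ℝ} (hU : IsOpen U)
    (hg : ∀ i j, ContDiffOn ℝ ∞ (fun u => g u i j) U) (hφ : ContDiffOn ℝ ∞ φ U)
    (hψ : ContDiffOn ℝ ∞ ψ U) : ContDiffOn ℝ ∞ (pairing g φ ψ) U :=
  ContDiffOn.sum fun i _ => ContDiffOn.sum fun j _ =>
    ((hg i j).mul (contDiffOn_pderiv hφ hU i)).mul (contDiffOn_pderiv hψ hU j)

theorem contDiffOn_connForm {φ ψ : (Fin N → ℝ) → ℝ} (hU : IsOpen U)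
    (hg : ∀ i j, ContDiffOn ℝ ∞ (fun u => g u i j) U) (hΓ : ∀ i j k, ContDiffOn ℝ ∞ (Γ i j k) U)
    (hφ : ContDiffOn ℝ ∞ φ U) (hψ : ContDiffOn ℝ ∞ ψ U) (k : Fin N) :
    ContDiffOn ℝ ∞ (connForm g Γ φ ψ k) U :=
  ContDiffOn.sum fun i _ => ContDiffOn.sum fun j _ =>
    ((hΓ i j k).mul ((contDiffOn_pderiv hφ hU i).mul (contDiffOn_pderiv hψ hU j))).add
      ((hg i j).mul ((contDiffOn_pderiv hφ hU i).mul
        (contDiffOn_pderiv (contDiffOn_pderiv hψ hU j) hU k)))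

theorem dirDeriv_const_mul {a : (Fin N → ℝ) → ℝ} (ha : DifferentiableAt ℝ a u) (c : ℝ) :
    dirDeriv X (fun w => c * a w) u = c * dirDeriv X a u := by
  rw [dirDeriv_mul (differentiableAt_const c) ha, dirDeriv_const]; ring

/-- Differentiates a generating function known as a bilinear expression in functions affine along X,
after clearing the denominator κ. -/
theorem mul_dirDeriv_of_eq_sum {n : ℕ} (hU : IsOpen U) (hu : u ∈ U) {θ : (Fin N → ℝ) → ℝ}
    (hθ : ContDiffOn ℝ ∞ θ U) {κ : ℝ} {c α β : Fin n → ℝ} {f h : Fin n → (Fin N → ℝ) → ℝ}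
    (hf : ∀ r, HasConstDeriv U X (f r) (α r)) (hh : ∀ r, HasConstDeriv U X (h r) (β r))
    (e : ∀ w ∈ U, κ * θ w = ∑ r, c r * (f r w * h r w)) :
    κ * dirDeriv X θ u = ∑ r, c r * (α r * h r u + f r u * β r) := by
  have d1 := fun r => differentiableAt_of_mem (hf r).1 hU hu
  have d2 := fun r => differentiableAt_of_mem (hh r).1 hU hu
  rw [← dirDeriv_const_mul (differentiableAt_of_mem hθ hU hu), dirDeriv_congr hU hu e,
    dirDeriv_sum _ fun r _ => ((d1 r).fun_mul (d2 r)).const_mul _]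
  refine Finset.sum_congr rfl fun r _ => ?_
  rw [dirDeriv_const_mul ((d1 r).fun_mul (d2 r)), dirDeriv_mul (d1 r) (d2 r), (hf r).2 u hu,
    (hh r).2 u hu]

/-- The Lie derivative of the one-form `∑ c f dh`, for `f` and `h` affine along `X`. -/
theorem lie_oneForm {n : ℕ} (hU : IsOpen U) (hX : ∀ i, ContDiffOn ℝ ∞ (fun u => X u i) U)
    (hu : u ∈ U) {θ : Fin N → (Fin N → ℝ) → ℝ} (hθ : ∀ k, ContDiffOn ℝ ∞ (θ k) U) {κ : ℝ}
    {c α β : Fin n → ℝ} {f h : Fin n → (Fin N → ℝ) → ℝ}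
    (hf : ∀ r, HasConstDeriv U X (f r) (α r)) (hh : ∀ r, HasConstDeriv U X (h r) (β r))
    (e : ∀ w ∈ U, ∀ k, κ * θ k w = ∑ r, c r * (f r w * pderiv k (h r) w)) (k : Fin N) :
    κ * (dirDeriv X (θ k) u + ∑ s, θ s u * pderiv k (fun w => X w s) u) =
      ∑ r, c r * (α r * pderiv k (h r) u) := by
  have d1 := fun r => differentiableAt_of_mem (hf r).1 hU hu
  have d2 := fun r => differentiableAt_of_mem (contDiffOn_pderiv (hh r).1 hU k) hU hu
  have e1 : κ * dirDeriv X (θ k) u = ∑ r, c r * (α r * pderiv k (h r) u + f r u *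
      -∑ s, pderiv k (fun w => X w s) u * pderiv s (h r) u) := by
    rw [← dirDeriv_const_mul (differentiableAt_of_mem (hθ k) hU hu),
      dirDeriv_congr hU hu fun w hw => e w hw k,
      dirDeriv_sum _ fun r _ => ((d1 r).fun_mul (d2 r)).const_mul _]
    refine Finset.sum_congr rfl fun r _ => ?_
    rw [dirDeriv_const_mul ((d1 r).fun_mul (d2 r)), dirDeriv_mul (d1 r) (d2 r), (hf r).2 u hu,
      dirDeriv_pderiv hX hU (hh r).1 hu, (hh r).pderiv_dirDeriv hU hu, zero_sub]
  have e2 : κ * ∑ s, θ s u * pderiv k (fun w => X w s) u =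
      ∑ r, c r * (f r u * ∑ s, pderiv k (fun w => X w s) u * pderiv s (h r) u) := by
    simp only [Finset.mul_sum, ← mul_assoc, e u hu, Finset.sum_mul]
    rw [Finset.sum_comm]
    exact Finset.sum_congr rfl fun r _ => Finset.sum_congr rfl fun s _ => by ring
  rw [mul_add, e1, e2, ← Finset.sum_add_distrib]
  exact Finset.sum_congr rfl fun r _ => by ring

end Affine

/-! ### The metric on the differentials of `∏ (p + u^i)` -/

theorem sum_mul_laxPart (p : ℝ) (u : Fin N → ℝ) :
    ∑ i, u i * laxPart p i u = N * laxPoly p u - p * laxDeriv p u := by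
  have : ∀ i, u i * laxPart p i u = laxPoly p u - p * laxPart p i u := fun i => by
    rw [← mul_laxPart p i u]; ring
  simp only [this, Finset.sum_sub_distrib, ← Finset.mul_sum, laxDeriv]
  simp

theorem sum_mul_laxPart₂ (q : ℝ) (k : Fin N) (u : Fin N → ℝ) :
    ∑ j, u j * laxPart₂ q j k u = (N - 1) * laxPart q k u - q * pderiv k (laxDeriv q) u := by
  have : ∀ j, u j * laxPart₂ q j k u =
      laxPart q k u - (if j = k then laxPart q k u else 0) - q * laxPart₂ q j k u := fun j => by
    by_cases h : j = k
    · simp [h, laxPart₂_self]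
    · rw [laxPart₂_comm, ← mul_laxPart₂ q (Ne.symm h) u, if_neg h]; ring
  simp only [this, Finset.sum_sub_distrib, ← Finset.mul_sum, pderiv_laxDeriv]
  simp
  ring

theorem pairing_laxPoly (T : (Fin N → ℝ) → Matrix (Fin N) (Fin N) ℝ) (p q : ℝ) (u : Fin N → ℝ) :
    pairing T (laxPoly p) (laxPoly q) u =
      ∑ i, ∑ j, T u i j * (laxPart p i u * laxPart q j u) := by
  simp only [pairing, pderiv_laxPoly, mul_assoc]

theorem connForm_laxPoly (T : (Fin N → ℝ) → Matrix (Fin N) (Fin N) ℝ)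
    (Γ : Fin N → Fin N → Fin N → (Fin N → ℝ) → ℝ) (p q : ℝ) (k : Fin N) (u : Fin N → ℝ) :
    connForm T Γ (laxPoly p) (laxPoly q) k u =
      ∑ i, ∑ j, (Γ i j k u * (laxPart p i u * laxPart q j u) +
        T u i j * (laxPart p i u * laxPart₂ q j k u)) := by
  simp only [connForm, pderiv_laxPoly, pderiv_pderiv_laxPoly]

/-- The diagonal part of the metric is summed by partial fractions: (p - q) u² / ((p + u)(q + u)) =
(p - q) - p² / (p + u) + q² / (q + u), multiplied by P(p) P(q). -/
theorem pairing_laxMetric (M : ℕ) (p q : ℝ) (u : Fin N → ℝ) :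
    (p - q) * pairing (laxMetric N M) (laxPoly p) (laxPoly q) u =
      (p - q) * ((N * laxPoly p u - p * laxDeriv p u) * (N * laxPoly q u - q * laxDeriv q u) -
        ((N : ℝ) - M) * N * (laxPoly p u * laxPoly q u)) +
      ((N : ℝ) - M) * (p ^ 2 * laxDeriv p u * laxPoly q u -
        q ^ 2 * laxDeriv q u * laxPoly p u) := by
  have h1 : pairing (laxMetric N M) (laxPoly p) (laxPoly q) u =
      (∑ i, u i * laxPart p i u) * (∑ i, u i * laxPart q i u) -
        ((N : ℝ) - M) * ∑ i, u i ^ 2 * (laxPart p i u * laxPart q i u) := by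
    have : ∀ i, ∑ j, laxMetric N M u i j * (laxPart p i u * laxPart q j u) =
        u i * laxPart p i u * ∑ j, logMetric N M i j * (u j * laxPart q j u) := fun i => by
      rw [Finset.mul_sum]
      exact Finset.sum_congr rfl fun j _ => by rw [laxMetric_apply]; ring
    have e3 : ∑ i, u i * laxPart p i u * (((N : ℝ) - M) * (u i * laxPart q i u)) =
        ((N : ℝ) - M) * ∑ i, u i ^ 2 * (laxPart p i u * laxPart q i u) := by
      rw [Finset.mul_sum]
      exact Finset.sum_congr rfl fun i _ => by ring
    simp only [pairing_laxPoly, this, sum_logMetric_mul, mul_sub, Finset.sum_sub_distrib,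
      ← Finset.sum_mul]
    rw [e3]
  have h2 : (p - q) * ∑ i, u i ^ 2 * (laxPart p i u * laxPart q i u) =
      (p - q) * (N * (laxPoly p u * laxPoly q u)) - p ^ 2 * laxDeriv p u * laxPoly q u +
        q ^ 2 * laxDeriv q u * laxPoly p u := by
    have : ∀ i, (p - q) * (u i ^ 2 * (laxPart p i u * laxPart q i u)) =
        (p - q) * (laxPoly p u * laxPoly q u) - p ^ 2 * laxPart p i u * laxPoly q u +
          q ^ 2 * laxPart q i u * laxPoly p u := fun i => by
      rw [← mul_laxPart p i u, ← mul_laxPart q i u]; ring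
    rw [Finset.mul_sum]
    simp only [this, Finset.sum_sub_distrib, Finset.sum_add_distrib, ← Finset.mul_sum,
      ← Finset.sum_mul, laxDeriv]
    simp only [Finset.sum_const, Finset.card_univ, Fintype.card_fin, nsmul_eq_mul]
    ring
  rw [h1, sum_mul_laxPart, sum_mul_laxPart]
  linear_combination (-((N : ℝ) - M)) * h2

/-- The same partial fractions, multiplied by P(p) ∂_kP(q). The index i = k is exceptional: its
product ∂_kP(p) ∂_kP(q) becomes linear in the differentials through P(q) ∂_kP(p) - P(p) ∂_kP(q) = (q
- p) ∂_kP(p) ∂_kP(q), which costs the second factor p - q. -/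
theorem connForm_laxMetric (M : ℕ) (p q : ℝ) (k : Fin N) (u : Fin N → ℝ) :
    (p - q) ^ 2 * connForm (laxMetric N M) (laxConn N M) (laxPoly p) (laxPoly q) k u =
      (p - q) ^ 2 * ((N * laxPoly p u - p * laxDeriv p u) *
        (N * laxPart q k u - q * pderiv k (laxDeriv q) u)) -
      ((N : ℝ) - M) * ((p - q) ^ 2 * (N * (laxPoly p u * laxPart q k u)) -
        (p - q) * p ^ 2 * (laxDeriv p u * laxPart q k u) +
        (p - q) * q ^ 2 * (laxPoly p u * pderiv k (laxDeriv q) u) -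
        p * q * (laxPoly q u * laxPart p k u - laxPoly p u * laxPart q k u)) := by
  have h1 : connForm (laxMetric N M) (laxConn N M) (laxPoly p) (laxPoly q) k u =
      (∑ i, u i * laxPart p i u) * (laxPart q k u + ∑ j, u j * laxPart₂ q j k u) -
        ((N : ℝ) - M) * ∑ i, (u i ^ 2 * (laxPart p i u * laxPart₂ q i k u) +
          if i = k then u k * (laxPart p k u * laxPart q k u) else 0) := by
    have : ∀ i, ∑ j, (laxConn N M i j k u * (laxPart p i u * laxPart q j u) +
        laxMetric N M u i j * (laxPart p i u * laxPart₂ q j k u)) =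
        u i * laxPart p i u * (logMetric N M i k * laxPart q k u) +
        u i * laxPart p i u * ∑ j, logMetric N M i j * (u j * laxPart₂ q j k u) := fun i => by
      simp only [laxConn, ite_mul, zero_mul, Finset.sum_add_distrib, Finset.sum_ite_eq',
        Finset.mem_univ, if_true, laxMetric_apply, Finset.mul_sum]
      congr 1
      · ring
      · exact Finset.sum_congr rfl fun j _ => by ring
    have e2 : ∀ i, u i * laxPart p i u * (logMetric N M i k * laxPart q k u) =
        u i * laxPart p i u * laxPart q k u -
          ((N : ℝ) - M) * if i = k then u k * (laxPart p k u * laxPart q k u) else 0 := fun i => by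
      by_cases h : i = k
      · subst h; simp [logMetric]; ring
      · simp [logMetric, h]
    simp only [connForm_laxPoly, this, e2, sum_logMetric_mul, mul_sub, mul_add,
      Finset.sum_sub_distrib, Finset.sum_add_distrib, ← Finset.sum_mul, ← Finset.mul_sum]
    have e3 : ∑ i, u i * laxPart p i u * (((N : ℝ) - M) * (u i * laxPart₂ q i k u)) =
        ((N : ℝ) - M) * ∑ i, u i ^ 2 * (laxPart p i u * laxPart₂ q i k u) := by
      rw [Finset.mul_sum]
      exact Finset.sum_congr rfl fun i _ => by ring
    rw [e3]
    ring
  have h2 : (p - q) ^ 2 * ∑ i, (u i ^ 2 * (laxPart p i u * laxPart₂ q i k u) +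
          if i = k then u k * (laxPart p k u * laxPart q k u) else 0) =
      (p - q) ^ 2 * (N * (laxPoly p u * laxPart q k u)) -
        (p - q) * p ^ 2 * (laxDeriv p u * laxPart q k u) +
        (p - q) * q ^ 2 * (laxPoly p u * pderiv k (laxDeriv q) u) -
        p * q * (laxPoly q u * laxPart p k u - laxPoly p u * laxPart q k u) := by
    have : ∀ i, (p - q) ^ 2 * (u i ^ 2 * (laxPart p i u * laxPart₂ q i k u) +
          if i = k then u k * (laxPart p k u * laxPart q k u) else 0) =
        (p - q) ^ 2 * (laxPoly p u * laxPart q k u) -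
        (p - q) * p ^ 2 * (laxPart p i u * laxPart q k u) +
        (p - q) * q ^ 2 * (laxPoly p u * laxPart₂ q i k u) -
        if i = k then p * q * (laxPoly q u * laxPart p k u - laxPoly p u * laxPart q k u)
          else 0 := fun i => by
      by_cases h : i = k
      · subst h
        simp only [laxPart₂_self, if_true]
        rw [← mul_laxPart p i u, ← mul_laxPart q i u]
        ring
      · simp only [h, if_false]
        rw [← mul_laxPart p i u, ← mul_laxPart₂ q (Ne.symm h) u, laxPart₂_comm q k i]
        ring
    rw [Finset.mul_sum]
    simp only [this, Finset.sum_sub_distrib, Finset.sum_add_distrib, ← Finset.mul_sum,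
      ← Finset.sum_mul, pderiv_laxDeriv, laxDeriv]
    simp only [Finset.sum_const, Finset.card_univ, Fintype.card_fin, nsmul_eq_mul,
      Finset.sum_ite_eq', Finset.mem_univ, if_true]
    ring
  rw [h1, sum_mul_laxPart, sum_mul_laxPart₂]
  linear_combination (-((N : ℝ) - M)) * h2

/-! ### The Lie derivative of the metric -/

section Second

variable {M : ℕ} {b : Fin N} {u : Fin N → ℝ}

/-- The polynomial `p ∂_p P - M P` for `P = ∏ (p + u^i)`, the numerator of the derivative of the
Lax function. -/
noncomputable def laxNumerator (M : ℕ) (p : ℝ) (u : Fin N → ℝ) : ℝ :=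
  p * laxDeriv p u - M * laxPoly p u

/-- X replaces one factor of each product in `pairing_laxMetric` by p^M, M p^(M-1) or their
analogues in q; the result is linear in P and ∂P and collects into Q = p ∂P - M P. -/
theorem pairing_lieMetric (hM : 0 < M) (hb : (b : ℕ) + 1 + M = N) (hu : u ∈ modifiedDomain N)
    (p q : ℝ) :
    (p - q) * pairing (lieMetric (symField b) (laxMetric N M)) (laxPoly p) (laxPoly q) u =
      ((N : ℝ) - M) * (laxNumerator M p u * q ^ (M + 1) - laxNumerator M q u * p ^ (M + 1)) := by
  have hU := isOpen_modifiedDomain N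
  have H := isSkewOperator_lax (modifiedDomain N) M
  have P := fun p => hasConstDeriv_laxPoly hb p
  have P' := fun p => hasConstDeriv_laxDeriv hb p
  rw [← dirDeriv_pairing hU (contDiffOn_symField b) H.smooth_metric (P p) (P q) hu]
  have := mul_dirDeriv_of_eq_sum hU hu (X := symField b)
    (contDiffOn_pairing hU H.smooth_metric (P p).1 (P q).1) (κ := p - q)
    (c := ![(p - q) * (N ^ 2 - ((N : ℝ) - M) * N), -(p - q) * N * q - ((N : ℝ) - M) * q ^ 2,
      -(p - q) * N * p + ((N : ℝ) - M) * p ^ 2, (p - q) * p * q])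
    (f := ![laxPoly p, laxPoly p, laxDeriv p, laxDeriv p])
    (h := ![laxPoly q, laxDeriv q, laxPoly q, laxDeriv q])
    (α := ![p ^ M, p ^ M, M * p ^ (M - 1), M * p ^ (M - 1)])
    (β := ![q ^ M, M * q ^ (M - 1), q ^ M, M * q ^ (M - 1)])
    (by
      simp only [Fin.forall_fin_succ, IsEmpty.forall_iff, and_true]
      exact ⟨P p, P p, P' p, P' p⟩)
    (by
      simp only [Fin.forall_fin_succ, IsEmpty.forall_iff, and_true]
      exact ⟨P q, P' q, P q, P' q⟩)
    (fun w _ => by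
      rw [pairing_laxMetric]
      simp only [Fin.sum_univ_four, Matrix.cons_val]
      ring)
  rw [this]
  simp only [Fin.sum_univ_four, Matrix.cons_val, laxNumerator]
  -- M > 0 makes M - 1 a genuine exponent, so that p · p^(M-1) = p^M.
  obtain ⟨m, rfl⟩ : ∃ m, M = m + 1 := ⟨M - 1, by omega⟩
  simp only [Nat.add_sub_cancel, pow_succ]
  ring

/-- X Q(p) = p · M p^(M-1) - M p^M = 0, so the generating function of the first Lie derivative is
constant along X. -/
theorem lieMetric_lieMetric (hM : 0 < M) (hb : (b : ℕ) + 1 + M = N) (hu : u ∈ modifiedDomain N) :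
    lieMetric (symField b) (lieMetric (symField b) (laxMetric N M)) u = 0 := by
  have hU := isOpen_modifiedDomain N
  have H := (isSkewOperator_lax (modifiedDomain N) M).lie hU (contDiffOn_symField b)
  have P := fun p => hasConstDeriv_laxPoly hb p
  have P' := fun p => hasConstDeriv_laxDeriv hb p
  ext i j
  refine eq_zero_of_sum_sum_laxPart hu.1
    (T := lieMetric (symField b) (lieMetric (symField b) (laxMetric N M)) u) (fun p q hpq => ?_) i j
  rw [← pairing_laxPoly,
    ← dirDeriv_pairing hU (contDiffOn_symField b) H.smooth_metric (P p) (P q) hu]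
  -- The expression is now linear, so the second factors of the bilinear rule are the constant 1.
  have C := fun _ : Fin 4 => hasConstDeriv_const (U := modifiedDomain N) (X := symField b) 1
  have := mul_dirDeriv_of_eq_sum hU hu (X := symField b)
    (contDiffOn_pairing hU H.smooth_metric (P p).1 (P q).1) (κ := p - q)
    (c := ![((N : ℝ) - M) * p * q ^ (M + 1), -((N : ℝ) - M) * M * q ^ (M + 1),
      -((N : ℝ) - M) * q * p ^ (M + 1), ((N : ℝ) - M) * M * p ^ (M + 1)])
    (f := ![laxDeriv p, laxPoly p, laxDeriv q, laxPoly q])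
    (α := ![M * p ^ (M - 1), p ^ M, M * q ^ (M - 1), q ^ M])
    (by
      simp only [Fin.forall_fin_succ, IsEmpty.forall_iff, and_true]
      exact ⟨P' p, P p, P' q, P q⟩) C
    (fun w hw => by
      rw [pairing_lieMetric hM hb hw]
      simp only [Fin.sum_univ_four, Matrix.cons_val, laxNumerator]
      ring)
  refine (mul_eq_zero.1 (this.trans ?_)).resolve_left (sub_ne_zero.2 hpq)
  simp only [Fin.sum_univ_four, Matrix.cons_val]
  obtain ⟨m, rfl⟩ : ∃ m, M = m + 1 := ⟨M - 1, by omega⟩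
  simp only [Nat.add_sub_cancel, pow_succ]
  ring

/-- By `lie_oneForm`, X acts on the coefficient of each form f dh and leaves dh alone. What results
has coefficients depending only on p and q. -/
theorem connForm_lieConn (hM : 0 < M) (hb : (b : ℕ) + 1 + M = N) (hu : u ∈ modifiedDomain N)
    (p q : ℝ) (k : Fin N) :
    (p - q) ^ 2 * connForm (lieMetric (symField b) (laxMetric N M))
      (lieConn (symField b) (laxMetric N M) (laxConn N M)) (laxPoly p) (laxPoly q) k u =
      ((N : ℝ) - M) * (-(p - q) * p * q * p ^ M * pderiv k (laxDeriv q) u +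
        ((p - q) * M * p - p * q) * p ^ M * laxPart q k u + p * q * q ^ M * laxPart p k u) := by
  have hU := isOpen_modifiedDomain N
  have H := isSkewOperator_lax (modifiedDomain N) M
  have hX := contDiffOn_symField b
  have P := fun p => hasConstDeriv_laxPoly hb p
  have P' := fun p => hasConstDeriv_laxDeriv hb p
  rw [← lie_connForm hU hX H.smooth_metric H.smooth_conn (P p) (P q) hu]
  have := lie_oneForm hU hX hu (κ := (p - q) ^ 2)
    (contDiffOn_connForm hU H.smooth_metric H.smooth_conn (P p).1 (P q).1)
    (c := ![(p - q) ^ 2 * (N ^ 2 - ((N : ℝ) - M) * N) - ((N : ℝ) - M) * p * q,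
      -(p - q) ^ 2 * N * q - ((N : ℝ) - M) * (p - q) * q ^ 2,
      -(p - q) ^ 2 * p * N + ((N : ℝ) - M) * (p - q) * p ^ 2, (p - q) ^ 2 * p * q,
      ((N : ℝ) - M) * p * q])
    (f := ![laxPoly p, laxPoly p, laxDeriv p, laxDeriv p, laxPoly q])
    (h := ![laxPoly q, laxDeriv q, laxPoly q, laxDeriv q, laxPoly p])
    (α := ![p ^ M, p ^ M, M * p ^ (M - 1), M * p ^ (M - 1), q ^ M])
    (β := ![q ^ M, M * q ^ (M - 1), q ^ M, M * q ^ (M - 1), p ^ M])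
    (by
      simp only [Fin.forall_fin_succ, IsEmpty.forall_iff, and_true]
      exact ⟨P p, P p, P' p, P' p, P q⟩)
    (by
      simp only [Fin.forall_fin_succ, IsEmpty.forall_iff, and_true]
      exact ⟨P q, P' q, P q, P' q, P p⟩)
    (fun w _ k => by
      rw [connForm_laxMetric]
      simp only [Fin.sum_univ_five, Matrix.cons_val, pderiv_laxPoly]
      ring) k
  rw [this]
  simp only [Fin.sum_univ_five, Matrix.cons_val, pderiv_laxPoly]
  obtain ⟨m, rfl⟩ : ∃ m, M = m + 1 := ⟨M - 1, by omega⟩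
  simp only [Nat.add_sub_cancel, pow_succ]
  ring

/-- The forms of `connForm_lieConn` are exact, with primitives affine along X and coefficients
independent of u, so X annihilates them. -/
theorem lieConn_lieConn (hM : 0 < M) (hb : (b : ℕ) + 1 + M = N) (hu : u ∈ modifiedDomain N)
    (i j k : Fin N) :
    lieConn (symField b) (lieMetric (symField b) (laxMetric N M))
      (lieConn (symField b) (laxMetric N M) (laxConn N M)) i j k u = 0 := by
  have hU := isOpen_modifiedDomain N
  have hX := contDiffOn_symField b
  have H := (isSkewOperator_lax (modifiedDomain N) M).lie hU hX
  have P := fun p => hasConstDeriv_laxPoly hb p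
  have P' := fun p => hasConstDeriv_laxDeriv hb p
  refine eq_zero_of_sum_sum_laxPart hu.1 (T := fun i j => lieConn (symField b)
    (lieMetric (symField b) (laxMetric N M))
      (lieConn (symField b) (laxMetric N M) (laxConn N M)) i j k u) (fun p q hpq => ?_) i j
  have e := connForm_laxPoly (lieMetric (symField b) (lieMetric (symField b) (laxMetric N M)))
    (lieConn (symField b) (lieMetric (symField b) (laxMetric N M))
      (lieConn (symField b) (laxMetric N M) (laxConn N M))) p q k u
  -- With the second Lie derivative of the metric gone, the Hessian term drops out and the one-form
  -- tests the connection coefficients alone.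
  simp only [lieMetric_lieMetric hM hb hu, Matrix.zero_apply, zero_mul, add_zero] at e
  rw [← e, ← lie_connForm hU hX H.smooth_metric H.smooth_conn (P p) (P q) hu]
  have C := fun r : Fin 3 => hasConstDeriv_const (U := modifiedDomain N) (X := symField b) 1
  have := lie_oneForm hU hX hu (κ := (p - q) ^ 2)
    (contDiffOn_connForm hU H.smooth_metric H.smooth_conn (P p).1 (P q).1)
    (c := ![((N : ℝ) - M) * (-(p - q) * p * q * p ^ M),
      ((N : ℝ) - M) * (((p - q) * M * p - p * q) * p ^ M), ((N : ℝ) - M) * (p * q * q ^ M)])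
    (h := ![laxDeriv q, laxPoly q, laxPoly p])
    (β := ![M * q ^ (M - 1), q ^ M, p ^ M]) C
    (by
      simp only [Fin.forall_fin_succ, IsEmpty.forall_iff, and_true]
      exact ⟨P' q, P q, P p⟩)
    (fun w hw k => by
      rw [connForm_lieConn hM hb hw]
      simp only [Fin.sum_univ_three, Matrix.cons_val, pderiv_laxPoly]
      ring) k
  refine (mul_eq_zero.1 (this.trans ?_)).resolve_left (pow_ne_zero 2 (sub_ne_zero.2 hpq))
  simp

theorem hasDerivAt_laxDeriv (u : Fin N → ℝ) (p : ℝ) :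
    HasDerivAt (fun p => laxDeriv p u) (∑ i, pderiv i (laxDeriv p) u) p :=
  HasDerivAt.fun_sum fun i _ => hasDerivAt_laxPart i u p

/-- The pairing with the differential of `∂_q ∏ (q + u^i)`, by differentiation in `q`. -/
theorem pairing_lieMetric_laxDeriv (hM : 0 < M) (hb : (b : ℕ) + 1 + M = N)
    (hu : u ∈ modifiedDomain N) (q : ℝ) : ∃ ρ : ℝ, ∀ r,
    (r - q) * pairing (lieMetric (symField b) (laxMetric N M)) (laxPoly r) (laxDeriv q) u =
      pairing (lieMetric (symField b) (laxMetric N M)) (laxPoly r) (laxPoly q) u +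
      ((N : ℝ) - M) * ((M + 1) * laxNumerator M r u * q ^ M - ρ * r ^ (M + 1)) := by
  have hρ : HasDerivAt (fun q => laxNumerator M q u)
      (1 * laxDeriv q u + id q * ∑ i, pderiv i (laxDeriv q) u - M * laxDeriv q u) q :=
    ((hasDerivAt_id q).fun_mul (hasDerivAt_laxDeriv u q)).fun_sub
      ((hasDerivAt_laxPoly u q).const_mul (M : ℝ))
  -- Only the independence of this number from r matters: it drops out of the torsion identity.
  generalize 1 * laxDeriv q u + id q * ∑ i, pderiv i (laxDeriv q) u - M * laxDeriv q u = ρ at hρ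
  refine ⟨ρ, fun r => ?_⟩
  have h1 : HasDerivAt (fun q => pairing (lieMetric (symField b) (laxMetric N M))
      (laxPoly r) (laxPoly q) u) (pairing (lieMetric (symField b) (laxMetric N M))
      (laxPoly r) (laxDeriv q) u) q := by
    simp only [pairing, pderiv_laxPoly]
    exact HasDerivAt.fun_sum fun i _ => HasDerivAt.fun_sum fun j _ =>
      (hasDerivAt_laxPart j u q).const_mul _
  have h2 := ((hasDerivAt_id q).const_sub r).fun_mul h1
  have h3 := (((hasDerivAt_pow (M + 1) q).const_mul (laxNumerator M r u)).fun_sub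
    (hρ.mul_const (r ^ (M + 1)))).const_mul ((N : ℝ) - M)
  have h4 := h2.unique (h3.congr_of_eventuallyEq (Eventually.of_forall fun q =>
    pairing_lieMetric hM hb hu r q))
  simp only [id, Nat.add_sub_cancel, Nat.cast_add, Nat.cast_one] at h4
  linear_combination h4

end Second

/-! ### The torsion of the Lie derivative of the connection -/

/-- A three-index identity may be tested on contractions whose Hessian part is symmetric. -/
theorem sum_torsion_eq_zero (G : Fin N → Fin N → ℝ) (Γ : Fin N → Fin N → Fin N → ℝ)
    (L : Fin N → Fin N → ℝ) (hL : ∀ m s, L m s = L s m) (x y z : Fin N → ℝ)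
    (h : ∑ i, ∑ s, G i s * (x i *
        ∑ j, ∑ m, (Γ j m s * (y j * z m) + G j m * (y j * L m s))) =
      ∑ i, ∑ s, G i s * (y i *
        ∑ j, ∑ m, (Γ j m s * (x j * z m) + G j m * (x j * L m s)))) :
    ∑ i, (∑ j, ∑ m, (∑ s, G i s * Γ j m s - ∑ s, G j s * Γ i m s) * (y j * z m)) * x i = 0 := by
  have e : ∀ x y : Fin N → ℝ, ∑ i, ∑ s, G i s * (x i *
      ∑ j, ∑ m, (Γ j m s * (y j * z m) + G j m * (y j * L m s))) =
      ∑ i, ∑ j, x i * y j * ∑ m, (∑ s, G i s * Γ j m s) * z m +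
      ∑ i, ∑ j, x i * y j * ∑ m, ∑ s, G i s * G j m * L m s := fun x y => by
    rw [← Finset.sum_add_distrib]
    refine Finset.sum_congr rfl fun i _ => ?_
    rw [← Finset.sum_add_distrib]
    simp only [Finset.mul_sum, Finset.sum_mul]
    rw [Finset.sum_comm]
    refine Finset.sum_congr rfl fun j _ => ?_
    rw [← Finset.sum_add_distrib, Finset.sum_comm]
    refine Finset.sum_congr rfl fun m _ => ?_
    rw [← Finset.sum_add_distrib]
    exact Finset.sum_congr rfl fun s _ => by ring
  -- The Hessian of the third function contributes symmetrically in x and y, so it disappears from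
  -- the antisymmetrized identity.
  have e2 : ∑ i, ∑ j, y i * x j * ∑ m, ∑ s, G i s * G j m * L m s =
      ∑ i, ∑ j, x i * y j * ∑ m, ∑ s, G i s * G j m * L m s := by
    rw [Finset.sum_comm]
    refine Finset.sum_congr rfl fun i _ => Finset.sum_congr rfl fun j _ => ?_
    rw [Finset.sum_comm (f := fun m s => G j s * G i m * L m s), mul_comm (y j)]
    congr 1
    exact Finset.sum_congr rfl fun m _ => Finset.sum_congr rfl fun s _ => by rw [hL]; ring
  have e3 : ∑ i, ∑ j, y i * x j * ∑ m, (∑ s, G i s * Γ j m s) * z m =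
      ∑ i, ∑ j, x i * y j * ∑ m, (∑ s, G j s * Γ i m s) * z m := by
    rw [Finset.sum_comm]
    exact Finset.sum_congr rfl fun i _ => Finset.sum_congr rfl fun j _ => by
      rw [mul_comm (y j)]
  rw [e x y, e y x, e2, e3] at h
  rw [← sub_eq_zero.2 (add_right_cancel h), ← Finset.sum_sub_distrib]
  refine Finset.sum_congr rfl fun i _ => ?_
  rw [← Finset.sum_sub_distrib, Finset.sum_mul]
  refine Finset.sum_congr rfl fun j _ => ?_
  rw [← mul_sub, ← Finset.sum_sub_distrib, Finset.sum_mul, Finset.mul_sum]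
  exact Finset.sum_congr rfl fun m _ => by ring

/-- With η = L_X g: P, Q, R are the M-th powers of p, q, r; a, b, c are the values of `laxNumerator`
at r, p, q; erq, epq, erp, epr are values of η on differentials of ∏ (· + u^i) at the indicated
points; E and E' pair the differentials at r and p with that of the derivative at q. S and S' are
the two contractions to be compared. Multiplying by (p - q)² (r - q)² (r - p) allows all of these to
be eliminated. -/
theorem torsion_scalar_identity {p q r K m P Q R a b c ρ erq epq erp epr E E' S S' : ℝ}
    (hpq : p ≠ q) (hrq : r ≠ q) (hrp : r ≠ p)
    (h1 : (p - q) ^ 2 * S = K * (-(p - q) * p * q * P * E +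
      ((p - q) * m * p - p * q) * P * erq + p * q * Q * erp))
    (h2 : (r - q) ^ 2 * S' = K * (-(r - q) * r * q * R * E' +
      ((r - q) * m * r - r * q) * R * epq + r * q * Q * epr))
    (h3 : (r - q) * E = erq + K * ((m + 1) * a * Q - ρ * (R * r)))
    (h4 : (p - q) * E' = epq + K * ((m + 1) * b * Q - ρ * (P * p)))
    (h5 : (r - q) * erq = K * (a * (Q * q) - c * (R * r)))
    (h6 : (p - q) * epq = K * (b * (Q * q) - c * (P * p)))
    (h7 : (r - p) * erp = K * (a * (P * p) - b * (R * r)))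
    (h8 : (p - r) * epr = K * (b * (R * r) - a * (P * p))) : S = S' := by
  have d1 := sub_ne_zero.2 hpq
  have d2 := sub_ne_zero.2 hrq
  have d3 := sub_ne_zero.2 hrp
  refine mul_left_cancel₀ (mul_ne_zero (mul_ne_zero (pow_ne_zero 2 d1) (pow_ne_zero 2 d2)) d3) ?_
  linear_combination (r - q) ^ 2 * (r - p) * h1 - (p - q) ^ 2 * (r - p) * h2 -
    K * (p - q) * p * q * P * (r - q) * (r - p) * h3 +
    K * (r - q) * r * q * R * (p - q) * (r - p) * h4 +
    K * (r - p) * (-(p - q) * p * q * P + ((p - q) * m * p - p * q) * P * (r - q)) * h5 -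
    K * (r - p) * (-(r - q) * r * q * R + ((r - q) * m * r - r * q) * R * (p - q)) * h6 +
    K * p * q * Q * (r - q) ^ 2 * h7 + K * r * q * Q * (p - q) ^ 2 * h8

section Second

variable {M : ℕ} {b : Fin N} {u : Fin N → ℝ}

theorem sum_lieMetric_connForm (hM : 0 < M) (hb : (b : ℕ) + 1 + M = N)
    (hu : u ∈ modifiedDomain N) (r p q : ℝ) :
    (p - q) ^ 2 * ∑ i, ∑ s, lieMetric (symField b) (laxMetric N M) u i s * (laxPart r i u *
      connForm (lieMetric (symField b) (laxMetric N M))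
        (lieConn (symField b) (laxMetric N M) (laxConn N M)) (laxPoly p) (laxPoly q) s u) =
    ((N : ℝ) - M) * (-(p - q) * p * q * p ^ M *
        pairing (lieMetric (symField b) (laxMetric N M)) (laxPoly r) (laxDeriv q) u +
      ((p - q) * M * p - p * q) * p ^ M *
        pairing (lieMetric (symField b) (laxMetric N M)) (laxPoly r) (laxPoly q) u +
      p * q * q ^ M *
        pairing (lieMetric (symField b) (laxMetric N M)) (laxPoly r) (laxPoly p) u) := by
  simp only [pairing, pderiv_laxPoly, Finset.mul_sum, ← Finset.sum_add_distrib]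
  refine Finset.sum_congr rfl fun i _ => Finset.sum_congr rfl fun s _ => ?_
  linear_combination lieMetric (symField b) (laxMetric N M) u i s * laxPart r i u *
    connForm_lieConn hM hb hu p q s

/-- Contract with dP(r), dP(p), dP(q) for distinct r, p, q. The contractions are given by
`connForm_lieConn` and the generating function of the metric, and the symmetry becomes
`torsion_scalar_identity`. -/
theorem lieConn_torsion (hM : 0 < M) (hb : (b : ℕ) + 1 + M = N)
    (hu : u ∈ modifiedDomain N) (i j k : Fin N) :
    ∑ s, lieMetric (symField b) (laxMetric N M) u i s *
        lieConn (symField b) (laxMetric N M) (laxConn N M) j k s u =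
      ∑ s, lieMetric (symField b) (laxMetric N M) u j s *
        lieConn (symField b) (laxMetric N M) (laxConn N M) i k s u := by
  rw [← sub_eq_zero]
  refine eq_zero_of_sum_sum_laxPart hu.1 (T := fun j k =>
    ∑ s, lieMetric (symField b) (laxMetric N M) u i s *
        lieConn (symField b) (laxMetric N M) (laxConn N M) j k s u -
      ∑ s, lieMetric (symField b) (laxMetric N M) u j s *
        lieConn (symField b) (laxMetric N M) (laxConn N M) i k s u) (fun p q hpq => ?_) j k
  refine eq_zero_of_sum_laxPart hu.1 (c := fun i => ∑ j, ∑ k,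
    (∑ s, lieMetric (symField b) (laxMetric N M) u i s *
        lieConn (symField b) (laxMetric N M) (laxConn N M) j k s u -
      ∑ s, lieMetric (symField b) (laxMetric N M) u j s *
        lieConn (symField b) (laxMetric N M) (laxConn N M) i k s u) *
      (laxPart p j u * laxPart q k u)) {p, q} (fun r hr => ?_) i
  simp only [Finset.mem_insert, Finset.mem_singleton, not_or] at hr
  refine sum_torsion_eq_zero _ (fun j k s =>
    lieConn (symField b) (laxMetric N M) (laxConn N M) j k s u) (fun m s => laxPart₂ q m s u)
    (fun m s => laxPart₂_comm q m s u) (fun i => laxPart r i u) _ _ ?_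
  simp only [← connForm_laxPoly]
  obtain ⟨ρ, hρ⟩ := pairing_lieMetric_laxDeriv hM hb hu q
  have e := fun x y => pairing_lieMetric hM hb hu x y
  simp only [pow_succ _ M] at hρ e
  exact torsion_scalar_identity hpq hr.2 hr.1 (sum_lieMetric_connForm hM hb hu r p q)
    (sum_lieMetric_connForm hM hb hu p r q) (hρ r) (hρ p) (e r q) (e p q) (e r p) (e p r)

/-! ### Non-degeneracy of the Lie derivative of the metric -/

open Polynomial in
theorem natDegree_partPolynomial_lt (hN : 0 < N) (u c : Fin N → ℝ) :
    (partPolynomial u c).natDegree < N := by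
  refine lt_of_le_of_lt (natDegree_sum_le_of_forall_le (n := N - 1) _ _ fun i _ => ?_) (by omega)
  refine (natDegree_C_mul_le _ _).trans ?_
  refine (natDegree_prod_le _ _).trans ?_
  simp

/-- The polynomial `p ∂_p P - M P` for `P = ∏ (p + u^i)`, as a formal polynomial. -/
noncomputable def numeratorPolynomial (M : ℕ) (u : Fin N → ℝ) : Polynomial ℝ :=
  Polynomial.X * Polynomial.derivative (∏ i, (Polynomial.X + Polynomial.C (u i))) -
    Polynomial.C (M : ℝ) * ∏ i, (Polynomial.X + Polynomial.C (u i))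

theorem eval_numeratorPolynomial (M : ℕ) (u : Fin N → ℝ) (p : ℝ) :
    (numeratorPolynomial M u).eval p = laxNumerator M p u := by
  have e : ∀ p, (∏ i, (Polynomial.X + Polynomial.C (u i))).eval p = laxPoly p u := fun p => by
    simp [Polynomial.eval_prod, laxPoly]
  have h := (∏ i, (Polynomial.X + Polynomial.C (u i))).hasDerivAt p
  simp only [e] at h
  rw [numeratorPolynomial, Polynomial.eval_sub, Polynomial.eval_mul, Polynomial.eval_mul,
    Polynomial.eval_X, Polynomial.eval_C, e, h.unique (hasDerivAt_laxPoly u p), laxNumerator]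

/-- The coefficient of X^N is N - M, which is positive. -/
theorem le_natDegree_numeratorPolynomial (hMN : M < N) (u : Fin N → ℝ) :
    N ≤ (numeratorPolynomial M u).natDegree := by
  refine Polynomial.le_natDegree_of_ne_zero ?_
  have h1 : (∏ i, (Polynomial.X + Polynomial.C (u i))).coeff N = 1 := by
    have hm : (∏ i, (Polynomial.X + Polynomial.C (u i))).Monic :=
      Polynomial.monic_prod_of_monic _ _ fun i _ => Polynomial.monic_X_add_C _
    have hd : (∏ i, (Polynomial.X + Polynomial.C (u i))).natDegree = N := by
      rw [Polynomial.natDegree_prod_of_monic _ _ fun i _ => Polynomial.monic_X_add_C _]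
      simp
    have := hm.coeff_natDegree
    rwa [hd] at this
  obtain ⟨n, rfl⟩ : ∃ n, N = n + 1 := ⟨N - 1, by omega⟩
  rw [numeratorPolynomial, Polynomial.coeff_sub, Polynomial.coeff_X_mul, Polynomial.coeff_C_mul,
    Polynomial.coeff_derivative, h1]
  have : (M : ℝ) < (n : ℝ) + 1 := by exact_mod_cast hMN
  intro h
  linarith

/-- The constant term is -M ∏ u^i, non-zero on the admissible set. -/
theorem not_X_dvd_numeratorPolynomial (hM : 0 < M) (hu : u ∈ modifiedDomain N) :
    ¬ Polynomial.X ∣ numeratorPolynomial M u := by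
  rw [Polynomial.X_dvd_iff, Polynomial.coeff_zero_eq_eval_zero, eval_numeratorPolynomial,
    laxNumerator, laxPoly]
  simp only [zero_mul, zero_sub, zero_add, neg_eq_zero, mul_eq_zero, Nat.cast_eq_zero, hM.ne',
    false_or]
  exact Finset.prod_ne_zero_iff.2 fun i _ => hu.2 i

/-- A kernel covector yields an identity Q A₁ = X^(M+1) A₂ with A₁, A₂ of degree less than N. As X
does not divide Q, X^(M+1) divides A₁; then Q divides A₂, whose degree is too small, so the quotient
is zero. Hence A₁ = 0, and its coefficients determine the covector. -/
theorem det_lieMetric_ne_zero (hM : 0 < M) (hb : (b : ℕ) + 1 + M = N)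
    (hu : u ∈ modifiedDomain N) : (lieMetric (symField b) (laxMetric N M) u).det ≠ 0 := by
  intro h
  obtain ⟨c, hc, h0⟩ := Matrix.exists_mulVec_eq_zero_iff.2 h
  refine hc (funext fun j => ?_)
  -- At p = -u^j the differential dP(p) has only its j-th component, so these are the coefficients
  -- of c in the basis dP(-u^j).
  set d : Fin N → ℝ := fun j => c j / laxPart (-u j) j u with hd
  have hK : (N : ℝ) - M ≠ 0 := sub_ne_zero.2 (by
    have : M < N := by omega
    exact_mod_cast this.ne')
  have h1 : ∀ p, ∑ j, d j * pairing (lieMetric (symField b) (laxMetric N M)) (laxPoly p)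
      (laxPoly (-u j)) u = 0 := fun p => by
    have e : ∀ j, d j * pairing (lieMetric (symField b) (laxMetric N M)) (laxPoly p)
        (laxPoly (-u j)) u =
        ∑ i, laxPart p i u * (lieMetric (symField b) (laxMetric N M) u i j * c j) := fun j => by
      rw [pairing_laxPoly, Finset.mul_sum]
      refine Finset.sum_congr rfl fun i _ => ?_
      rw [Finset.sum_eq_single j (fun k _ hk => by rw [laxPart_neg_of_ne hk]; ring) (by simp), hd]
      field_simp [laxPart_neg_self_ne_zero hu.1 j]
    simp only [e]
    rw [Finset.sum_comm]
    refine Finset.sum_eq_zero fun i _ => ?_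
    have := congrFun h0 i
    simp only [Matrix.mulVec, dotProduct, Pi.zero_apply] at this
    rw [← Finset.mul_sum, this, mul_zero]
  have h2 : numeratorPolynomial M u * partPolynomial u (fun j => d j * (-u j) ^ (M + 1)) =
      Polynomial.X ^ (M + 1) * partPolynomial u (fun j => d j * laxNumerator M (-u j) u) := by
    refine sub_eq_zero.1 (polynomial_eq_zero_of_eval ∅ fun p _ => ?_)
    rw [Polynomial.eval_sub, Polynomial.eval_mul, Polynomial.eval_mul, Polynomial.eval_pow,
      Polynomial.eval_X, eval_partPolynomial, eval_partPolynomial, eval_numeratorPolynomial]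
    refine (mul_eq_zero.1 ?_).resolve_left hK
    -- The kernel relation is multiplied by P(p): its factor p + u^j = p - (-u^j) is the one needed
    -- to apply `pairing_lieMetric` at q = -u^j.
    rw [← mul_zero (laxPoly p u), ← h1 p]
    simp only [Finset.mul_sum]
    rw [← Finset.sum_sub_distrib, Finset.mul_sum]
    refine Finset.sum_congr rfl fun j _ => ?_
    have e := pairing_lieMetric hM hb hu p (-u j)
    have e2 := mul_laxPart p j u
    rw [← e2]
    linear_combination (-(d j * laxPart p j u)) * e
  have h3 : Polynomial.X ^ (M + 1) ∣ partPolynomial u (fun j => d j * (-u j) ^ (M + 1)) :=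
    Polynomial.prime_X.pow_dvd_of_dvd_mul_left _ (not_X_dvd_numeratorPolynomial hM hu)
      ⟨_, h2⟩
  obtain ⟨A, hA⟩ := h3
  have h4 : numeratorPolynomial M u * A =
      partPolynomial u (fun j => d j * laxNumerator M (-u j) u) := by
    refine mul_left_cancel₀ (pow_ne_zero (M + 1) Polynomial.X_ne_zero) ?_
    rw [← h2, hA]
    ring
  have h5 : A = 0 := by
    by_contra hA0
    have h6 := le_natDegree_numeratorPolynomial (M := M) (by omega) u
    have h7 : numeratorPolynomial M u ≠ 0 := fun h7 => by
      rw [h7, Polynomial.natDegree_zero] at h6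
      omega
    have h8 := natDegree_partPolynomial_lt (by omega) u
      (fun j => d j * laxNumerator M (-u j) u)
    rw [← h4, Polynomial.natDegree_mul h7 hA0] at h8
    omega
  rw [h5, mul_zero] at hA
  have h6 := eq_zero_of_partPolynomial_eq_zero hu.1 hA j
  have h7 := (mul_eq_zero.1 h6).resolve_right (pow_ne_zero _ (neg_ne_zero.2 (hu.2 j)))
  exact (div_eq_zero_iff.1 h7).resolve_right (laxPart_neg_self_ne_zero hu.1 j)

/-! ### The second metric -/

/-- X s^m is constant, so `dirDeriv_pairing` gives ∂g^{mn}(s)/∂s^b = (L_X g)(ds^m, ds^n); the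
Jacobian and its inverse then cancel. -/
theorem secondMetric_eq_lieMetric (M : ℕ) (b : Fin N) (hu : u ∈ modifiedDomain N) :
    secondMetric N M b u = lieMetric (symField b) (laxMetric N M) u := by
  have hU := isOpen_modifiedDomain N
  have H := isSkewOperator_lax (modifiedDomain N) M
  have e : ∀ m n, dirDeriv (symField b) (fun w => laxMetricSym N M w m n) u =
      (symJacobian u * lieMetric (symField b) (laxMetric N M) u * (symJacobian u).transpose) m n :=
    fun m n => by
    have : (fun w => laxMetricSym N M w m n) = pairing (laxMetric N M) (symVar m) (symVar n) := by
      funext w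
      simp only [laxMetricSym, pairing, symJacobian, Matrix.of_apply]
      exact Finset.sum_congr rfl fun i _ => Finset.sum_congr rfl fun j _ => by ring
    rw [this, dirDeriv_pairing hU (contDiffOn_symField b) H.smooth_metric
      (hasConstDeriv_symVar m b) (hasConstDeriv_symVar n b) hu, Matrix.mul_apply]
    simp only [Matrix.mul_apply, pairing, symJacobian, Matrix.of_apply, Matrix.transpose_apply,
      Finset.sum_mul]
    rw [Finset.sum_comm]
    exact Finset.sum_congr rfl fun i _ => Finset.sum_congr rfl fun j _ => by ring
  have e2 : secondMetric N M b u = (symJacobian u)⁻¹ * (symJacobian u *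
      lieMetric (symField b) (laxMetric N M) u * (symJacobian u).transpose) *
      ((symJacobian u)⁻¹).transpose := by
    generalize symJacobian u * lieMetric (symField b) (laxMetric N M) u *
      (symJacobian u).transpose = E at e
    ext i j
    simp only [secondMetric, e, symField, Matrix.of_apply, Matrix.mul_apply,
      Matrix.transpose_apply, Finset.sum_mul]
    rw [Finset.sum_comm]
    exact Finset.sum_congr rfl fun i _ => Finset.sum_congr rfl fun j _ => by ring
  have hJ := Matrix.nonsing_inv_mul _ (det_symJacobian_ne_zero hu.1).isUnit
  have hJ' : (symJacobian u).transpose * ((symJacobian u)⁻¹).transpose = 1 := by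
    rw [← Matrix.transpose_mul, hJ, Matrix.transpose_one]
  rw [e2, ← Matrix.mul_assoc, ← Matrix.mul_assoc, hJ, Matrix.one_mul, Matrix.mul_assoc, hJ',
    Matrix.mul_one]

/-- Uniqueness of the metric connection: the Lie derivative of the connection is compatible with the
second metric and torsion-free. -/
theorem contraChristoffel_secondMetric (hM : 0 < M) (hb : (b : ℕ) + 1 + M = N)
    (hu : u ∈ modifiedDomain N) (i j k : Fin N) :
    contraChristoffel (secondMetric N M b) i j k u =
      lieConn (symField b) (laxMetric N M) (laxConn N M) i j k u := by
  have hU := isOpen_modifiedDomain N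
  have H := (isSkewOperator_lax (modifiedDomain N) M).lie hU (contDiffOn_symField b)
  have e : ∀ w ∈ modifiedDomain N, secondMetric N M b w = _ := fun w hw =>
    secondMetric_eq_lieMetric M b hw
  refine contraChristoffel_eq (Γ := lieConn (symField b) (laxMetric N M) (laxConn N M)) hU
    (fun i j => (H.smooth_metric i j).congr fun w hw => by rw [e w hw])
    (fun w hw i j => by rw [e w hw, H.symm w hw]) (fun w hw => ?_) hu (fun i j k => ?_)
    (fun i j k => ?_) i j k
  · rw [e w hw]; exact det_lieMetric_ne_zero hM hb hw
  · rw [pderiv_congr hU hu (fun w hw => by rw [e w hw]), H.pderiv_metric u hu]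
  · rw [e u hu]; exact lieConn_torsion hM hb hu i j k

end Second

/-! ### Hamiltonian structures that agree on the domain -/

section Congr

variable {U : Set (Fin N → ℝ)} {g g' : (Fin N → ℝ) → Matrix (Fin N) (Fin N) ℝ}
  {Γ Γ' : Fin N → Fin N → Fin N → (Fin N → ℝ) → ℝ}

theorem bracketDensity_congr (hU : IsOpen U) (hg : ∀ u ∈ U, g u = g' u)
    (hΓ : ∀ u ∈ U, ∀ i j k, Γ i j k u = Γ' i j k u) {f f' : (ℕ → Fin N → ℝ) → ℝ}
    (hf : ∀ v, v 0 ∈ U → f v = f' v) (h : (ℕ → Fin N → ℝ) → ℝ) {v : ℕ → Fin N → ℝ}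
    (hv : v 0 ∈ U) : bracketDensity g Γ f h v = bracketDensity g' Γ' f' h v := by
  simp only [bracketDensity, hg _ hv, hΓ _ hv, varDeriv_congr hU hf _ hv]

theorem IsHamiltonianStructure.congr (H : IsHamiltonianStructure U g Γ) (hU : IsOpen U)
    (hg : ∀ u ∈ U, g u = g' u) (hΓ : ∀ u ∈ U, ∀ i j k, Γ i j k u = Γ' i j k u) :
    IsHamiltonianStructure U g' Γ' := by
  have e1 : ∀ f h u, IsField U u → functional (bracketDensity g Γ f h) u =
      functional (bracketDensity g' Γ' f h) u := fun f h u hu =>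
    intervalIntegral.integral_congr fun x _ =>
      bracketDensity_congr hU hg hΓ (fun _ _ => rfl) h (hu.jet_mem x)
  have e2 : ∀ f h l u, IsField U u → functional (bracketDensity g Γ (bracketDensity g Γ f h) l) u =
      functional (bracketDensity g' Γ' (bracketDensity g' Γ' f h) l) u := fun f h l u hu =>
    intervalIntegral.integral_congr fun x _ => bracketDensity_congr hU hg hΓ
      (fun v hv => bracketDensity_congr hU hg hΓ (fun _ _ => rfl) h hv) l (hu.jet_mem x)
  obtain ⟨h1, h2, h3, h4⟩ := H
  refine ⟨fun i j => (h1 i j).congr fun u hu => by rw [hg u hu],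
    fun i j k => (h2 i j k).congr fun u hu => (hΓ u hu i j k).symm,
    fun f h hf hh u hu => ?_, fun f h l hf hh hl u hu => ?_⟩
  · rw [← e1 f h u hu, ← e1 h f u hu]; exact h3 f h hf hh u hu
  · rw [← e2 f h l u hu, ← e2 h l f u hu, ← e2 l f h u hu]; exact h4 f h l hf hh hl u hu

end Congr

theorem areCompatible_secondMetric {M : ℕ} {b : Fin N} (hM : 0 < M)
    (hb : (b : ℕ) + 1 + M = N) :
    AreCompatible (modifiedDomain N) (laxMetric N M) (secondMetric N M b) := by
  have hU := isOpen_modifiedDomain N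
  have hX := contDiffOn_symField b
  have H := isSkewOperator_lax (modifiedDomain N) M
  -- The formal half is applied to the Lie derivatives themselves. They agree with the second metric
  -- and its connection only over the domain, which suffices for brackets on fields with values
  -- there.
  obtain ⟨h1, h2⟩ := isHamiltonianStructure_lie hU hX H (H.lie hU hX) (fun _ _ => rfl)
    (fun _ _ _ _ _ => rfl) (fun f h l hf hh hl u hu => jacobiator_lax hU hf hh hl hu)
    (fun u hu => lieMetric_lieMetric hM hb hu) (fun u hu => lieConn_lieConn hM hb hu)
  have e : ∀ w ∈ modifiedDomain N, lieMetric (symField b) (laxMetric N M) w =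
      secondMetric N M b w := fun w hw => (secondMetric_eq_lieMetric M b hw).symm
  have e' := fun w (hw : w ∈ modifiedDomain N) i j k =>
    (contraChristoffel_secondMetric hM hb hw i j k).symm
  refine ⟨h1.congr hU e e', fun c => (h2 c).congr hU (fun w hw => by rw [e w hw])
    fun w hw i j k => ?_⟩
  rw [e' w hw, contraChristoffel_laxMetric hM (by omega) hw]

theorem isLieDerivative_secondMetric (M : ℕ) (b : Fin N) :
    IsLieDerivative (modifiedDomain N) (symField b) (laxMetric N M) (secondMetric N M b) := by
  intro φ ψ hφ hψ u hu
  have h := isLieDerivative_lieMetric (isOpen_modifiedDomain N) (contDiffOn_symField b)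
    (isSkewOperator_lax (modifiedDomain N) M).smooth_metric φ ψ hφ hψ u hu
  rwa [show pairing (secondMetric N M b) φ ψ u = _ by
    simp only [pairing, secondMetric_eq_lieMetric M b hu]; rfl]

end

end HydroPoisson

theorem proposition6 (N M : ℕ) (hM : 0 < M) (hMN : M < N)
    (b : Fin N) (hb : (b : ℕ) + 1 = N - M) :
    (∀ u ∈ modifiedDomain N, (symJacobian u).det ≠ 0) ∧
    (∀ u ∈ modifiedDomain N, (secondMetric N M b u).IsSymm ∧ (secondMetric N M b u).det ≠ 0) ∧
    AreCompatible (modifiedDomain N) (laxMetric N M) (secondMetric N M b) ∧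
    IsLieDerivative (modifiedDomain N) (symField b) (laxMetric N M) (secondMetric N M b) ∧
    (∀ u ∈ modifiedDomain N, ∀ i j : Fin N,
      secondMetric N M b u i j =
        dirDeriv (symField b) (fun w => laxMetric N M w i j) u
          - ∑ k, pderiv k (fun w => symField b w i) u * laxMetric N M u k j
          - ∑ k, pderiv k (fun w => symField b w j) u * laxMetric N M u i k) := by
  -- Removes the truncated subtraction; since b counts from 0, it labels s^{N-M}.
  have hb' : (b : ℕ) + 1 + M = N := by omega
  refine ⟨fun u hu => det_symJacobian_ne_zero hu.1, fun u hu => ?_,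
    areCompatible_secondMetric hM hb', isLieDerivative_secondMetric M b, fun u hu i j => ?_⟩
  · rw [secondMetric_eq_lieMetric M b hu]
    refine ⟨Matrix.IsSymm.ext fun i j => ?_, det_lieMetric_ne_zero hM hb' hu⟩
    exact ((isSkewOperator_lax (modifiedDomain N) M).lie (isOpen_modifiedDomain N)
      (contDiffOn_symField b)).symm u hu j i
  · rw [secondMetric_eq_lieMetric M b hu]
    rfl
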